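/- Let $k$ be an algebraically closed field of characteristic zero and let $G$ be a quasireductive supergroup, i.e. an affine algebraic supergroup over $k$ whose even part $G_0$ is connected reductive, with Lie superalgebra $\mathfrak g$. Let $\theta$ be an involution of $G$ and $\mathfrak g=\mathfrak k\oplus\mathfrak p$ the decomposition into $\pm1$-eigenspaces of $\theta$. Let $K$ be a closed subgroup with $(G^\theta)^0\subseteq K\subseteq G^\theta$, put $\mathfrak k'=\mathfrak k_{\bar 0}\oplus\mathfrak p_{\bar 1}$, and let $K'$ be the closed subgroup of $G$ with $K'_0=K_0$ and $\operatorname{Lie}K'=\mathfrak k'$. Assume that there is an Iwasawa decomposition $\mathfrak g=\mathfrak k\oplus\mathfrak a\oplus\mathfrak n$, where $\mathfrak a$ is a Cartan subspace of $\mathfrak p_{\bar 0}$ (a maximal subalgebra of $\mathfrak p_{\bar0}$ consisting of semisimple elements) and $\mathfrak n$ is the sum of the root spaces for a choice of positive restricted roots. Let $f_\lambda\in k[G/K]$ be a (homogeneous) $\mathfrak a\oplus\mathfrak n$-eigenfunction of weight $\lambda\in\mathfrak a^*$, normalized by $f_\lambda(eK)=1$. Suppose that 1. the $K'$-submodule $\langle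 K'\cdot f_\lambda\rangle$ of $k[G/K]$ contains a copy of $I_{K'}(k)$, the injective hull of the trivial $K'$-module $k$; and 2. the $G$-submodule $\langle G\cdot f_\lambda\rangle$ of $k[G/K]$ is isomorphic to an irreducible $G$-module $L$. For a $K_0$-stable graded subspace $W$ of $\mathfrak g$ let $\operatorname{ber}_W$ be the character of $K'$ (if it exists; it is then unique) whose restriction to $K'_0=K_0$ is $\det_{W_{\bar0}}\cdot\det_{W_{\bar1}}^{-1}$; for $W=\mathfrak k'$ this is the character by which $K'$ acts on the Berezinian $\operatorname{Ber}(\mathfrak k')$. For a character $\chi$ of $K'$ let $k[G]^{\chi}=\operatorname{Ind}_{K'}^G\chi$ be the $G$-module of functions $f$ on $G$ with $f(xh)=\chi(h)^{-1}f(x)$ for $h\in K'$. Let $I_G(L)$ be the injective hull of $L$ in the category of $G$-modules. Then: * the character $\operatorname{ber}_{\mathfrak p_{\bar 1}}$ of $K'$ exists, and $I_G(L)$ is isomorphic to a $G$-submodule of $k[G]^{\operatorname{ber}_{\mathfrak p_{\bar1}}}$; * if $\Lambda^{top}\mathfrak k_{\bar0}$ is a trivial $K_0$-module (for instance, if $K$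 is connected), then $I_G(L)$ is isomorphic to a $G$-submodule of $k[G]^{\operatorname{ber}_{\mathfrak k'}}$, and $k[G]^{\operatorname{ber}_{\mathfrak k'}}=k[G/K']$ when $\operatorname{Ber}(\mathfrak k')$ is trivial; * if $\Lambda^{top}\mathfrak p_{\bar1}$ is a trivial $K_0$-module, then $I_G(L)$ is isomorphic to a $G$-submodule of $k[G/K']$. -/

import Mathlib

open scoped TensorProduct

universe u

noncomputable section

/-- The degree `i` part of the tensor product of two `ℤ/2`-graded vector spaces. -/
def tensorGr {k : Type u} [Field k] {V W : Type u} [AddCommGroup V] [Module k V]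
    [AddCommGroup W] [Module k W] (𝒱 : ZMod 2 → Submodule k V) (𝒲 : ZMod 2 → Submodule k W)
    (i : ZMod 2) : Submodule k (V ⊗[k] W) :=
  ⨆ j : ZMod 2, LinearMap.range (TensorProduct.map (𝒱 j).subtype (𝒲 (i - j)).subtype)

/-- An affine algebraic supergroup `G` over `k`, given by its coordinate ring `k[G]`: a finitely
generated supercommutative Hopf superalgebra.  The comultiplication is multiplicative for the
product `(a ⊗ b)(a' ⊗ b') = (-1)^{|b||a'|} aa' ⊗ bb'` of the graded tensor product. -/
structure Supergroup (k : Type u) [Field k] where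
  Coord : Type u
  [ring : Ring Coord]
  [algebra : Algebra k Coord]
  [coalgebra : Coalgebra k Coord]
  gr : ZMod 2 → Submodule k Coord
  [graded : GradedAlgebra gr]
  supercomm : ∀ (i j : ZMod 2) (a b : Coord), a ∈ gr i → b ∈ gr j →
    a * b = ((-1 : ℤˣ) ^ (i * j)) • (b * a)
  finiteType : Algebra.FiniteType k Coord
  counit_odd : ∀ a ∈ gr 1, Coalgebra.counit (R := k) a = 0
  counit_one : Coalgebra.counit (R := k) (1 : Coord) = 1
  counit_mul : ∀ a b : Coord, Coalgebra.counit (R := k) (a * b) =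
    Coalgebra.counit (R := k) a * Coalgebra.counit (R := k) b
  comul_mem : ∀ (i : ZMod 2), ∀ a ∈ gr i, Coalgebra.comul (R := k) a ∈ tensorGr gr gr i
  comul_one : Coalgebra.comul (R := k) (1 : Coord) = 1 ⊗ₜ[k] 1
  comul_mul : ∀ a b : Coord,
    GradedTensorProduct.of k gr gr (Coalgebra.comul (R := k) (a * b)) =
      GradedTensorProduct.of k gr gr (Coalgebra.comul (R := k) a) *
        GradedTensorProduct.of k gr gr (Coalgebra.comul (R := k) b)
  antipode : Coord →ₗ[k] Coord
  antipode_mem : ∀ (i : ZMod 2), ∀ a ∈ gr i, antipode a ∈ gr i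
  antipode_left : ∀ a : Coord, LinearMap.mul' k Coord
    (TensorProduct.map antipode LinearMap.id (Coalgebra.comul (R := k) a)) =
      algebraMap k Coord (Coalgebra.counit (R := k) a)
  antipode_right : ∀ a : Coord, LinearMap.mul' k Coord
    (TensorProduct.map LinearMap.id antipode (Coalgebra.comul (R := k) a)) =
      algebraMap k Coord (Coalgebra.counit (R := k) a)

attribute [instance] Supergroup.ring Supergroup.algebra Supergroup.coalgebra Supergroup.graded

variable {k : Type u} [Field k]

/-- A morphism of supergroups `H → G`, given by the even Hopf algebra map `k[G] → k[H]`. -/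
structure SupergroupHom (H G : Supergroup k) where
  pullback : G.Coord →ₐ[k] H.Coord
  even : ∀ (i : ZMod 2), ∀ a ∈ G.gr i, pullback a ∈ H.gr i
  counit_pullback : ∀ a : G.Coord,
    Coalgebra.counit (R := k) (pullback a) = Coalgebra.counit (R := k) a
  comul_pullback : ∀ a : G.Coord, Coalgebra.comul (R := k) (pullback a) =
    TensorProduct.map pullback.toLinearMap pullback.toLinearMap (Coalgebra.comul (R := k) a)

/-- A closed subgroup of `G`: a supergroup `H` with a surjection `k[G] → k[H]`. -/
structure ClosedSubsupergroup (G : Supergroup k) where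
  grp : Supergroup k
  incl : SupergroupHom grp G
  surj : Function.Surjective incl.pullback

/-- A representation of `G`: a super vector space with an even left `k[G]`-coaction. -/
structure GModule (G : Supergroup k) where
  V : Type u
  [addCommGroup : AddCommGroup V]
  [module : Module k V]
  gr : ZMod 2 → Submodule k V
  isCompl : IsCompl (gr 0) (gr 1)
  coact : V →ₗ[k] G.Coord ⊗[k] V
  coact_mem : ∀ (i : ZMod 2), ∀ v ∈ gr i, coact v ∈ tensorGr G.gr gr i
  counit_coact : ∀ v : V,
    TensorProduct.lid k V
      (LinearMap.rTensor V (Coalgebra.counit (R := k) (A := G.Coord)) (coact v)) = v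
  coassoc : ∀ v : V,
    TensorProduct.assoc k G.Coord G.Coord V
      (LinearMap.rTensor V (Coalgebra.comul (R := k) (A := G.Coord)) (coact v)) =
      LinearMap.lTensor G.Coord coact (coact v)

attribute [instance] GModule.addCommGroup GModule.module

namespace GModule

variable {G : Supergroup k}

/-- (Even) homomorphisms of `G`-modules. -/
structure Hom (M N : GModule G) where
  toLin : M.V →ₗ[k] N.V
  even : ∀ (i : ZMod 2), ∀ v ∈ M.gr i, toLin v ∈ N.gr i
  equivariant : ∀ v : M.V, N.coact (toLin v) = LinearMap.lTensor G.Coord toLin (M.coact v)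

/-- `W` is a `G`-submodule (a graded subspace stable under the coaction). -/
def IsSubrep (M : GModule G) (W : Submodule k M.V) : Prop :=
  W ≤ (W ⊓ M.gr 0) ⊔ (W ⊓ M.gr 1) ∧
    ∀ w ∈ W, M.coact w ∈ LinearMap.range (LinearMap.lTensor G.Coord W.subtype)

/-- The `G`-submodule `⟨G · v⟩` generated by `v`. -/
def generated (M : GModule G) (v : M.V) : Submodule k M.V :=
  sInf {W | M.IsSubrep W ∧ v ∈ W}

/-- Irreducible `G`-modules. -/
def Irreducible (M : GModule G) : Prop :=
  Nontrivial M.V ∧ ∀ W : Submodule k M.V, M.IsSubrep W → W = ⊥ ∨ W = ⊤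

/-- Injective objects of the category of `G`-modules. -/
def Injective (I : GModule G) : Prop :=
  ∀ (M N : GModule G) (i : Hom M N) (f : Hom M I), Function.Injective i.toLin →
    ∃ g : Hom N I, ∀ v : M.V, g.toLin (i.toLin v) = f.toLin v

/-- `e : M → I` is an injective hull of `M`: an essential embedding in an injective module. -/
def IsInjectiveHull {M I : GModule G} (e : Hom M I) : Prop :=
  I.Injective ∧ Function.Injective e.toLin ∧
    ∀ W : Submodule k I.V, I.IsSubrep W → W ⊓ LinearMap.range e.toLin = ⊥ → W = ⊥

/-- `M` is isomorphic to a `G`-submodule of `N` contained in the subspace `W` of `N`. -/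
def EmbedsIn (M N : GModule G) (W : Submodule k N.V) : Prop :=
  ∃ φ : Hom M N, Function.Injective φ.toLin ∧ LinearMap.range φ.toLin ≤ W

/-- The trivial (even, one-dimensional) `G`-module `k`. -/
def trivial (G : Supergroup k) : GModule G where
  V := k
  gr := fun i => if i = 0 then ⊤ else ⊥
  isCompl := by simpa using isCompl_top_bot
  coact := TensorProduct.mk k G.Coord k 1
  coact_mem := by
    intro i v hv
    by_cases hi : i = 0
    · subst hi
      refine Submodule.mem_iSup_of_mem 0 ?_
      exact ⟨(⟨1, SetLike.GradedOne.one_mem⟩ : G.gr 0) ⊗ₜ[k] ⟨v, hv⟩, rfl⟩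
    · rw [if_neg hi] at hv
      rw [(Submodule.mem_bot k).1 hv, map_zero]
      exact Submodule.zero_mem _
  counit_coact := by
    intro v
    simp [G.counit_one]
  coassoc := by
    intro v
    simp [G.comul_one]

/-- `k[G]` with the action of `G` by left translation. -/
def regular (G : Supergroup k) : GModule G where
  V := G.Coord
  gr := G.gr
  isCompl := (DirectSum.Decomposition.isInternal G.gr).isCompl (i := 0) (j := 1) (by decide)
    (by
      ext x
      constructor
      · intro _
        fin_cases x
        · exact Or.inl rfl
        · exact Or.inr rfl
      · intro _
        exact Set.mem_univ x)
  coact := Coalgebra.comul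
  coact_mem := G.comul_mem
  counit_coact := by
    intro v
    simp
  coassoc := by
    intro v
    exact Coalgebra.coassoc_apply v

/-- Restriction of a `G`-module to a closed subgroup. -/
def restrict (M : GModule G) (H : ClosedSubsupergroup G) : GModule H.grp where
  V := M.V
  gr := M.gr
  isCompl := M.isCompl
  coact := LinearMap.rTensor M.V H.incl.pullback.toLinearMap ∘ₗ M.coact
  coact_mem := by
    intro i v hv
    have h := Submodule.mem_map_of_mem
      (f := LinearMap.rTensor M.V H.incl.pullback.toLinearMap) (M.coact_mem i v hv)
    unfold tensorGr at h ⊢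
    rw [Submodule.map_iSup] at h
    refine SetLike.le_def.1 (iSup_mono fun j => ?_) h
    rintro _ ⟨_, ⟨y, rfl⟩, rfl⟩
    induction y with
    | zero => simp
    | add a b ha hb =>
      rw [map_add, map_add]
      exact Submodule.add_mem _ ha hb
    | tmul a b =>
      exact ⟨(⟨H.incl.pullback a, H.incl.even j a a.2⟩ : H.grp.gr j) ⊗ₜ[k] b, by simp⟩
  counit_coact := by
    intro v
    conv_rhs => rw [← M.counit_coact v]
    rw [LinearMap.comp_apply, ← LinearMap.comp_apply, ← LinearMap.rTensor_comp]
    congr 3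
    ext a
    exact H.incl.counit_pullback a
  coassoc := by
    intro v
    have key : ∀ x : G.Coord ⊗[k] M.V,
        TensorProduct.assoc k H.grp.Coord H.grp.Coord M.V
          (LinearMap.rTensor M.V (Coalgebra.comul (R := k) (A := H.grp.Coord))
            (LinearMap.rTensor M.V H.incl.pullback.toLinearMap x)) =
        TensorProduct.map H.incl.pullback.toLinearMap
          (LinearMap.rTensor M.V H.incl.pullback.toLinearMap)
          (TensorProduct.assoc k G.Coord G.Coord M.V
            (LinearMap.rTensor M.V (Coalgebra.comul (R := k) (A := G.Coord)) x)) := by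
      intro x
      induction x with
      | zero => simp
      | add a b ha hb => simp only [map_add, ha, hb]
      | tmul a w =>
        simp only [LinearMap.rTensor_tmul, AlgHom.toLinearMap_apply, H.incl.comul_pullback]
        induction Coalgebra.comul (R := k) a with
        | zero => simp
        | add a b ha hb => simp only [map_add, TensorProduct.add_tmul, ha, hb]
        | tmul a b => simp
    rw [LinearMap.comp_apply, key, M.coassoc]
    generalize M.coact v = x
    induction x with
    | zero => simp
    | add a b ha hb => simp only [map_add, ha, hb]
    | tmul a w => simp

end GModule

namespace Supergroup

variable (G : Supergroup k)

/-- The convolution product of functionals on `k[G]`. -/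
def conv (u v : Module.Dual k G.Coord) : Module.Dual k G.Coord :=
  LinearMap.mul' k k ∘ₗ TensorProduct.map u v ∘ₗ Coalgebra.comul

/-- `f ↦ u(f₁) f₂`, the action of a functional on `k[G]` through left translations. -/
def leftAct (u : Module.Dual k G.Coord) : G.Coord →ₗ[k] G.Coord :=
  (TensorProduct.lid k G.Coord).toLinearMap ∘ₗ LinearMap.rTensor G.Coord u ∘ₗ Coalgebra.comul

/-- `f ↦ f₁ u(f₂)`, the action of a functional on `k[G]` through right translations. -/
def rightAct (u : Module.Dual k G.Coord) : G.Coord →ₗ[k] G.Coord :=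
  (TensorProduct.rid k G.Coord).toLinearMap ∘ₗ LinearMap.lTensor G.Coord u ∘ₗ Coalgebra.comul

/-- The closed points `G(k) = G₀(k)`. -/
abbrev Point := G.Coord →ₐ[k] k

/-- The inverse of a point, as a functional. -/
def pointInv (g : G.Point) : Module.Dual k G.Coord := g.toLinearMap ∘ₗ G.antipode

/-- The Lie superalgebra `𝔤 = T_e G` of `G`: the point derivations at the identity. -/
def lie : Submodule k (Module.Dual k G.Coord) where
  carrier := {u | ∀ a b : G.Coord, u (a * b) =
    u a * Coalgebra.counit (R := k) b + Coalgebra.counit (R := k) a * u b}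
  zero_mem' := by
    intro a b
    simp
  add_mem' := by
    intro u v hu hv a b
    rw [LinearMap.add_apply, hu a b, hv a b, LinearMap.add_apply, LinearMap.add_apply]
    ring
  smul_mem' := by
    intro c u hu a b
    rw [LinearMap.smul_apply, hu a b, LinearMap.smul_apply, LinearMap.smul_apply, smul_eq_mul,
      smul_eq_mul, smul_eq_mul]
    ring

/-- The even functionals on `k[G]`, those that vanish on odd functions. -/
def evenDual : Submodule k (Module.Dual k G.Coord) := (G.gr 1).dualAnnihilator

/-- The odd functionals on `k[G]`, those that vanish on even functions. -/
def oddDual : Submodule k (Module.Dual k G.Coord) := (G.gr 0).dualAnnihilator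

/-- The bracket `[h, u]` in the Lie superalgebra, for an even `h`. -/
def bracket (h u : Module.Dual k G.Coord) : Module.Dual k G.Coord := G.conv h u - G.conv u h

/-- The adjoint action `u ↦ g u g⁻¹` of a point. -/
def Ad (g : G.Point) : Module.Dual k G.Coord →ₗ[k] Module.Dual k G.Coord where
  toFun u := G.conv (G.conv g.toLinearMap u) (G.pointInv g)
  map_add' u v := by
    simp only [conv, TensorProduct.map_add_right, TensorProduct.map_add_left, LinearMap.add_comp,
      LinearMap.comp_add]
  map_smul' c u := by
    simp only [conv, TensorProduct.map_smul_right, TensorProduct.map_smul_left,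
      LinearMap.smul_comp, LinearMap.comp_smul, RingHom.id_apply]

/-- `g` acts on the subspace `W` of `T_e G` (which it preserves) with determinant `d`. -/
def HasAdDet (g : G.Point) (W : Submodule k (Module.Dual k G.Coord)) (d : k) : Prop :=
  ∃ h : ∀ u ∈ W, G.Ad g u ∈ W, LinearMap.det (M := W) ((G.Ad g).restrict h) = d

/-- `G` is connected: `k[G]` has no idempotents besides `0` and `1`. -/
def Connected : Prop := ∀ e : G.Coord, e * e = e → e = 0 ∨ e = 1

/-- `G` is unipotent: every nonzero representation has a nonzero invariant vector. -/
def Unipotent : Prop :=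
  ∀ M : GModule G, Nontrivial M.V → ∃ v : M.V, v ≠ 0 ∧ M.coact v = 1 ⊗ₜ[k] v

/-- `G` is quasireductive: `G₀` is connected reductive, that is, `G₀` is connected and every closed
unipotent subgroup of `G₀` that is normal in `G₀` is trivial.  (In characteristic zero unipotent
groups are connected and smooth.)  Closed subgroups of `G₀` are the closed subgroups `N` of `G` for
which `k[N]` is purely even; `f ↦ g(f₁) f₂ g⁻¹(f₃)` is conjugation by `g`. -/
def Quasireductive : Prop :=
  G.Connected ∧ ∀ N : ClosedSubsupergroup G, N.grp.gr 1 = ⊥ → N.grp.Unipotent →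
    (∀ (g : G.Point) (f : G.Coord), N.incl.pullback f = 0 →
      N.incl.pullback (G.leftAct g.toLinearMap (G.rightAct (G.pointInv g) f)) = 0) →
    ∀ f : G.Coord, N.incl.pullback f =
      algebraMap k N.grp.Coord (Coalgebra.counit (R := k) f)

/-- An element of `𝔤₀` is semisimple if it acts diagonalizably on `k[G]`. -/
def IsSemisimpleElt (x : Module.Dual k G.Coord) : Prop :=
  ⨆ μ : k, Module.End.eigenspace (G.rightAct x) μ = ⊤

end Supergroup

namespace ClosedSubsupergroup

variable {G : Supergroup k}

/-- The Lie superalgebra of a closed subgroup, inside that of `G`. -/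
def lie (H : ClosedSubsupergroup G) : Submodule k (Module.Dual k G.Coord) :=
  G.lie ⊓ (LinearMap.ker H.incl.pullback.toLinearMap).dualAnnihilator

/-- The points of `H`, viewed in `G`. -/
def pointIncl (H : ClosedSubsupergroup G) (g : H.grp.Point) : G.Point := g.comp H.incl.pullback

/-- The inclusion `H ⊆ H'` of closed subgroups. -/
def Le (H H' : ClosedSubsupergroup G) : Prop :=
  ∀ f : G.Coord, H'.incl.pullback f = 0 → H.incl.pullback f = 0

/-- The ideal of functions on `G` that vanish on the even part `H₀` of `H`. -/
def evenPartIdeal (H : ClosedSubsupergroup G) : Ideal G.Coord :=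
  Ideal.comap H.incl.pullback (Ideal.span (H.grp.gr 1 : Set H.grp.Coord))

/-- `k[G/H]`, the functions on `G` invariant under right translation by `H`. -/
def functionsOnQuotient (H : ClosedSubsupergroup G) : Submodule k G.Coord :=
  LinearMap.eqLocus
    (LinearMap.lTensor G.Coord H.incl.pullback.toLinearMap ∘ₗ Coalgebra.comul)
    ((TensorProduct.mk k G.Coord H.grp.Coord).flip 1)

/-- A character `H → 𝔾ₘ`: an even group-like element of `k[H]`. -/
structure Character (H : ClosedSubsupergroup G) where
  val : H.grp.Coord
  even : val ∈ H.grp.gr 0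
  groupLike : IsGroupLikeElem k val

/-- The trivial character. -/
def Character.IsTrivial {H : ClosedSubsupergroup G} (χ : H.Character) : Prop := χ.val = 1

/-- `χ = ber_W` is the Berezinian character of the `Ad`-stable graded subspace
`W = W₀ ⊕ W₁` of `𝔤`.  A character of a supergroup in characteristic zero is determined by its
restriction to the even part `H₀`, hence by its values at the points of `H`, and `ber_W` is the one
with `ber_W = det_{W₀} · det_{W₁}⁻¹` on `H₀`. -/
def Character.IsBer {H : ClosedSubsupergroup G} (χ : H.Character)
    (W : Submodule k (Module.Dual k G.Coord)) : Prop :=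
  ∀ g : H.grp.Point, ∃ d₀ d₁ : k,
    G.HasAdDet (H.pointIncl g) (W ⊓ G.evenDual) d₀ ∧
    G.HasAdDet (H.pointIncl g) (W ⊓ G.oddDual) d₁ ∧ g χ.val = d₀ * d₁⁻¹

/-- `H₀` acts trivially on the top exterior power of `W`. -/
def TopExteriorTrivial (H : ClosedSubsupergroup G) (W : Submodule k (Module.Dual k G.Coord)) : Prop :=
  ∀ g : H.grp.Point, G.HasAdDet (H.pointIncl g) W 1

/-- `k[G]^χ = Ind_H^G χ`: the functions `f` on `G` with `f(xh) = χ(h)⁻¹ f(x)`, which are the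
sections of the line bundle on `G/H` induced from `χ`. -/
def semiInvariants (H : ClosedSubsupergroup G) (χ : H.Character) : Submodule k G.Coord :=
  LinearMap.eqLocus
    (LinearMap.lTensor G.Coord H.incl.pullback.toLinearMap ∘ₗ Coalgebra.comul)
    ((TensorProduct.mk k G.Coord H.grp.Coord).flip (H.grp.antipode χ.val))

end ClosedSubsupergroup

section Symmetric

variable {G : Supergroup k}

/-- `θ` is an involution of the supergroup `G`. -/
def IsInvolution (θ : SupergroupHom G G) : Prop :=
  ∀ f : G.Coord, θ.pullback (θ.pullback f) = f

/-- The closed subgroup `H` is contained in the fixed subgroup `G^θ`. -/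
def FixedBy (θ : SupergroupHom G G) (H : ClosedSubsupergroup G) : Prop :=
  ∀ f : G.Coord, H.incl.pullback (θ.pullback f) = H.incl.pullback f

/-- `(G^θ)⁰ ⊆ K ⊆ G^θ`, where `(G^θ)⁰` is the largest connected closed subgroup of `G^θ`. -/
def IsSymmetricSubgroup (θ : SupergroupHom G G) (K : ClosedSubsupergroup G) : Prop :=
  FixedBy θ K ∧ ∀ H : ClosedSubsupergroup G, H.grp.Connected → FixedBy θ H → H.Le K

/-- The involution that `θ` induces on `𝔤`, extended to all functionals. -/
def lieInvolution (θ : SupergroupHom G G) :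
    Module.Dual k G.Coord →ₗ[k] Module.Dual k G.Coord :=
  Module.Dual.transpose (R := k) θ.pullback.toLinearMap

/-- `𝔨`, the `1`-eigenspace of `θ` on `𝔤`. -/
def lieK (θ : SupergroupHom G G) : Submodule k (Module.Dual k G.Coord) :=
  G.lie ⊓ Module.End.eigenspace (lieInvolution θ) 1

/-- `𝔭`, the `(-1)`-eigenspace of `θ` on `𝔤`. -/
def lieP (θ : SupergroupHom G G) : Submodule k (Module.Dual k G.Coord) :=
  G.lie ⊓ Module.End.eigenspace (lieInvolution θ) (-1)

/-- `𝔨₀`. -/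
def lieKEven (θ : SupergroupHom G G) : Submodule k (Module.Dual k G.Coord) :=
  lieK θ ⊓ G.evenDual

/-- `𝔭₁`. -/
def liePOdd (θ : SupergroupHom G G) : Submodule k (Module.Dual k G.Coord) :=
  lieP θ ⊓ G.oddDual

/-- `𝔨' = 𝔨₀ ⊕ 𝔭₁`. -/
def lieK' (θ : SupergroupHom G G) : Submodule k (Module.Dual k G.Coord) :=
  lieKEven θ ⊔ liePOdd θ

/-- `K'` is the closed subgroup of `G` with `K'₀ = K₀` and `Lie K' = 𝔨'`. -/
def IsDualSubgroup (θ : SupergroupHom G G) (K K' : ClosedSubsupergroup G) : Prop :=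
  K'.evenPartIdeal = K.evenPartIdeal ∧ K'.lie = lieK' θ

/-- `𝔞` is a subalgebra of `𝔭₀` that consists of semisimple elements. -/
def IsToralIn (θ : SupergroupHom G G) (𝔞 : Submodule k (Module.Dual k G.Coord)) : Prop :=
  𝔞 ≤ lieP θ ⊓ G.evenDual ∧ (∀ x ∈ 𝔞, ∀ y ∈ 𝔞, G.bracket x y ∈ 𝔞) ∧
    ∀ x ∈ 𝔞, G.IsSemisimpleElt x

/-- `𝔞` is a Cartan subspace of `𝔭₀`. -/
def IsCartanSubspace (θ : SupergroupHom G G) (𝔞 : Submodule k (Module.Dual k G.Coord)) : Prop :=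
  IsToralIn θ 𝔞 ∧ ∀ 𝔟, IsToralIn θ 𝔟 → 𝔞 ≤ 𝔟 → 𝔟 = 𝔞

/-- The weight space `𝔤_α` for the adjoint action of `𝔞`. -/
def weightSpace (𝔞 : Submodule k (Module.Dual k G.Coord)) (α : Module.Dual k 𝔞) :
    Submodule k (Module.Dual k G.Coord) where
  carrier := {u | u ∈ G.lie ∧ ∀ h : 𝔞, G.bracket h u = α h • u}
  zero_mem' := by
    refine ⟨Submodule.zero_mem _, fun h => ?_⟩
    simp [Supergroup.bracket, Supergroup.conv]
  add_mem' := by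
    rintro u v ⟨hu, hu'⟩ ⟨hv, hv'⟩
    refine ⟨Submodule.add_mem _ hu hv, fun h => ?_⟩
    rw [smul_add, ← hu' h, ← hv' h]
    simp only [Supergroup.bracket, Supergroup.conv, TensorProduct.map_add_right,
      TensorProduct.map_add_left, LinearMap.add_comp, LinearMap.comp_add]
    abel
  smul_mem' := by
    rintro c u ⟨hu, hu'⟩
    refine ⟨Submodule.smul_mem _ c hu, fun h => ?_⟩
    rw [smul_comm, ← hu' h]
    simp only [Supergroup.bracket, Supergroup.conv, TensorProduct.map_smul_right,
      TensorProduct.map_smul_left, LinearMap.smul_comp, LinearMap.comp_smul, smul_sub]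

/-- `α` is a restricted root. -/
def IsRestrictedRoot (𝔞 : Submodule k (Module.Dual k G.Coord)) (α : Module.Dual k 𝔞) : Prop :=
  α ≠ 0 ∧ weightSpace 𝔞 α ≠ ⊥

/-- A choice of positive restricted roots: the roots on which a given additive function, that
vanishes on no root, is positive. -/
def IsPositivity (𝔞 : Submodule k (Module.Dual k G.Coord)) (ψ : Module.Dual k 𝔞 →+ ℝ) : Prop :=
  ∀ α, IsRestrictedRoot 𝔞 α → ψ α ≠ 0

/-- `𝔫`, the sum of the root spaces of the positive restricted roots. -/
def iwasawaN (𝔞 : Submodule k (Module.Dual k G.Coord)) (ψ : Module.Dual k 𝔞 →+ ℝ) :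
    Submodule k (Module.Dual k G.Coord) :=
  ⨆ α : {α : Module.Dual k 𝔞 // IsRestrictedRoot 𝔞 α ∧ 0 < ψ α}, weightSpace 𝔞 α.1

/-- The Iwasawa decomposition `𝔤 = 𝔨 ⊕ 𝔞 ⊕ 𝔫`. -/
def IsIwasawa (θ : SupergroupHom G G) (𝔞 : Submodule k (Module.Dual k G.Coord))
    (ψ : Module.Dual k 𝔞 →+ ℝ) : Prop :=
  IsCartanSubspace θ 𝔞 ∧ IsPositivity 𝔞 ψ ∧
    iSupIndep ![lieK θ, 𝔞, iwasawaN 𝔞 ψ] ∧ lieK θ ⊔ 𝔞 ⊔ iwasawaN 𝔞 ψ = G.lie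

/-- `f = f_lam` is the regular function on `G/K` that is a (homogeneous) eigenfunction of `𝔞 ⊕ 𝔫`
of weight `lam`, normalized by `f(eK) = 1`. -/
def IsHighestWeightFunction (K : ClosedSubsupergroup G) (𝔞 : Submodule k (Module.Dual k G.Coord))
    (ψ : Module.Dual k 𝔞 →+ ℝ) (lam : Module.Dual k 𝔞) (f : G.Coord) : Prop :=
  f ∈ K.functionsOnQuotient ∧ (∃ i : ZMod 2, f ∈ G.gr i) ∧
    (∀ h : 𝔞, G.leftAct h f = lam h • f) ∧ (∀ u ∈ iwasawaN 𝔞 ψ, G.leftAct u f = 0) ∧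
    Coalgebra.counit (R := k) f = 1

end Symmetric

end

/-! Write `H` for `K'`. The copy of the injective hull `J` of the trivial `H`-module lies in the
submodule generated by the homogeneous vector `f`, so `J` is finite dimensional
(`finiteDimensional_generated`). The existence of a nonzero finite dimensional injective module
forces strong conditions on `H`, and these produce the character.

Since `J` is injective, `k → J` extends along the constants `k → k[H]` to a nonzero comodule map
`k[H] → J`. Its coordinates `η_m`, combined with the matrix coefficients `t_{mr}` of `J`, give the
supertrace functionals `a ↦ ∑ (-1)^{|m|} η_m(t_{mr} a)`. They are left invariant and not all zero
(`isLeftInvariant_strace`, `exists_strace_ne_zero`). So `k[H]` carries a nonzero invariant integral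
`Γ`.

Integrals are unique up to a scalar. Let `N = dim 𝔥₁` and let `ω` be the product of a left invariant
odd frame. An Euler operator shows that an integral vanishing on the `N`-th power of the odd ideal
is zero (`eq_zero_of_filt`). That power is `k[H] ω`, and `b ↦ Γ(b ω)` is an invariant functional on
the commutative Hopf algebra `k[H₀]`. In characteristic zero such a functional is zero as soon as it
vanishes at `1`, by a trace argument on idempotents (`IsLeftInvariant.apply_one_ne_zero`). Hence an
integral is determined by its value at `ω`.

By uniqueness, right translations act on `Γ` through a group-like element `χ`, the modular
character. Right translation by `g⁻¹` multiplies `ω` by `det Ad(g)` on `𝔥₁`, so `χ(g)` is the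
inverse of this determinant. As the odd part of `Lie K'` is `𝔭₁`, this says `χ = ber_{𝔭₁}`. The
functional `a ↦ Γ(χ a)`, composed with matrix coefficients, gives a nonzero semi-invariant
functional on `J` (`exists_semiInvariant`).

Finally `J` embeds in `⟨G·f⟩ ≅ L`, hence in the restriction of the injective hull `I` of `L`.
Injectivity of `J` gives an `H`-equivariant retraction of `I` onto `J`, along which the
semi-invariant functional extends to `I`. It does not vanish at the vector of `L` that corresponds
to `f`, because that vector generates an `H`-module containing `J`. Frobenius reciprocity turns it
into a `G`-map `I → k[G]^χ` that is nonzero on the irreducible module `L`, and an essential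
extension of `L` on which such a map is defined is embedded by it. The remaining assertions compare
`χ` with other characters; a character with value `1` at all points is trivial
(`eq_one_of_point_eq_one`). -/

noncomputable section

/-! ### Invariant functionals on commutative Hopf algebras in characteristic zero -/

section HopfIntegral

open Coalgebra WithConv
open LinearMap hiding add_apply smul_apply sum_apply

variable {k : Type*} [Field k]

/-- `b ↦ b₁ u(b₂)` on a coalgebra. -/
def coRight {C : Type*} [AddCommGroup C] [Module k C] [Coalgebra k C] (u : C →ₗ[k] k) :
    C →ₗ[k] C :=
  (TensorProduct.rid k C).toLinearMap ∘ₗ LinearMap.lTensor C u ∘ₗ Coalgebra.comul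

theorem coRight_repr {C : Type*} [AddCommGroup C] [Module k C] [Coalgebra k C] (u : C →ₗ[k] k)
    {b : C} {ι : Type*} (r : Repr k b ι) :
    coRight u b = ∑ i ∈ r.index, u (r.right i) • r.left i := by
  simp [coRight, ← r.eq, map_sum]

/-- Coassociativity: `u ∘ₗ coRight v` is the convolution of `u` and `v`, so convolution of
functionals corresponds to composition of operators. -/
theorem coRight_coRight {C : Type*} [AddCommGroup C] [Module k C] [Coalgebra k C]
    (u v : C →ₗ[k] k) (b : C) : coRight u (coRight v b) = coRight (u ∘ₗ coRight v) b := by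
  have key : ∀ x : C ⊗[k] C,
      TensorProduct.rid k C (lTensor C u (comul (TensorProduct.rid k C (lTensor C v x)))) =
        TensorProduct.rid k C (lTensor C (TensorProduct.lid k k).toLinearMap
          (lTensor C (TensorProduct.map u v)
            (TensorProduct.assoc k C C C (rTensor C comul x)))) := by
    intro x
    induction x with
    | zero => simp
    | add x y hx hy => simp only [map_add, hx, hy]
    | tmul a c =>
      simp only [lTensor_tmul, TensorProduct.rid_tmul, map_smul, rTensor_tmul]
      induction comul (R := k) a with
      | zero => simp
      | add x y hx hy => simp only [map_add, TensorProduct.add_tmul, smul_add, hx, hy]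
      | tmul p q => simp [smul_smul, mul_comm]
  have key2 : ∀ x : C ⊗[k] C,
      TensorProduct.rid k C (lTensor C (TensorProduct.lid k k).toLinearMap
          (lTensor C (TensorProduct.map u v) (lTensor C comul x))) =
        TensorProduct.rid k C (lTensor C (u ∘ₗ coRight v) x) := by
    intro x
    induction x with
    | zero => simp
    | add x y hx hy => simp only [map_add, hx, hy]
    | tmul a c =>
      simp only [lTensor_tmul, TensorProduct.rid_tmul, coRight, comp_apply]
      congr 1
      induction comul (R := k) c with
      | zero => simp
      | add x y hx hy => simp only [map_add, hx, hy]
      | tmul p q => simp [mul_comm]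
  change TensorProduct.rid k C (lTensor C u (comul (TensorProduct.rid k C (lTensor C v (comul b))))) = _
  rw [key, coassoc_apply, key2]
  rfl

variable {D : Type*} [CommRing D] [HopfAlgebra k D]

/-- A functional `F` with `b₁ F(b₂) = F(b) 1`. -/
def IsLeftInvariant {C : Type*} [Ring C] [Algebra k C] [Coalgebra k C] (F : C →ₗ[k] k) : Prop :=
  ∀ b : C, coRight F b = F b • (1 : C)

/-- `z ↦ b₁ F(z b₂)`. -/
theorem coRight_mul_eq_antipode {F : D →ₗ[k] k} (hF : IsLeftInvariant F) (z b : D)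
    {ι : Type*} (r : Repr k z ι) :
    coRight (F ∘ₗ LinearMap.mulLeft k z) b =
      ∑ i ∈ r.index, F (r.right i * b) • HopfAlgebra.antipode k (r.left i) := by
  let q := ℛ k b
  let X : D →ₗ[k] D := ∑ j ∈ q.index, (F ∘ₗ LinearMap.mulRight k (q.right j)).smulRight (q.left j)
  let Y : D →ₗ[k] D := (F ∘ₗ LinearMap.mulRight k b).smulRight 1
  have hX : ∀ z, X z = coRight (F ∘ₗ LinearMap.mulLeft k z) b := by
    intro z
    rw [coRight_repr _ q]
    simp [X]
  -- Invariance at `z * b`, read as an identity in `z`: `z₁ X(z₂) = F(zb) 1`. Convolving with the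
  -- antipode on the left then isolates `X`.
  have hY : toConv Y = toConv LinearMap.id * toConv X := by
    ext z
    have h := hF (z * b)
    have : Y z = F (z * b) • 1 := by simp [Y]
    change Y z = _
    rw [this, ← h, (ℛ k z).convMul_apply]
    simp only [coRight, comp_apply, Bialgebra.comul_mul]
    rw [← (ℛ k z).eq, ← q.eq, Finset.sum_mul_sum]
    simp [X, Finset.mul_sum]
  have hXY : toConv X = toConv (HopfAlgebra.antipode k) * toConv Y := by
    rw [hY, ← mul_assoc, antipode_mul_id, one_mul]
  have := congrArg (fun f : WithConv (D →ₗ[k] D) => f z) hXY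
  rw [← hX]
  change X z = _ at this
  rw [this, r.convMul_apply]
  simp [Y]

/-- By `coRight_mul_eq_antipode`, applying `F(z ·)` to `b₁ F(z' b₂)` gives `F(z S(z'₁)) F(z'₂ b)`.
So the functionals `F(z ·)` are closed under convolution. -/
theorem coRight_comp_mul_mul {F : D →ₗ[k] k} (hF : IsLeftInvariant F) (z z' : D) :
    ∃ z'' : D, (F ∘ₗ LinearMap.mulLeft k z) ∘ₗ coRight (F ∘ₗ LinearMap.mulLeft k z') =
      F ∘ₗ LinearMap.mulLeft k z'' := by
  refine ⟨∑ i ∈ (ℛ k z').index, F (z * HopfAlgebra.antipode k ((ℛ k z').left i)) •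
    (ℛ k z').right i, ?_⟩
  ext b
  simp only [comp_apply, coRight_mul_eq_antipode hF z' b (ℛ k z'), mulLeft_apply,
    map_sum, map_smul, smul_eq_mul, Finset.sum_mul, smul_mul_assoc]
  refine Finset.sum_congr rfl fun i _ => mul_comm _ _

/-- The constant term has to be absent: the identity is convolution with the counit, which need not
have the form `F(z ·)`. -/
theorem exists_coRight_aeval {F : D →ₗ[k] k} (hF : IsLeftInvariant F) (z : D)
    (p : Polynomial k) :
    ∃ z' : D, Polynomial.aeval (R := k) (A := Module.End k D)
      (coRight (F ∘ₗ LinearMap.mulLeft k z)) (Polynomial.X * p) =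
      coRight (F ∘ₗ LinearMap.mulLeft k z') := by
  have hadd : ∀ z z' : D, coRight (F ∘ₗ LinearMap.mulLeft k z) + coRight (F ∘ₗ LinearMap.mulLeft k z') =
      coRight (F ∘ₗ LinearMap.mulLeft k (z + z')) := by
    intro z z'
    ext b
    rw [LinearMap.add_apply, coRight_repr _ (ℛ k b), coRight_repr _ (ℛ k b), coRight_repr _ (ℛ k b),
      ← Finset.sum_add_distrib]
    simp [add_mul, add_smul]
  have hsmul : ∀ (c : k) (z : D), c • coRight (F ∘ₗ LinearMap.mulLeft k z) =
      coRight (F ∘ₗ LinearMap.mulLeft k (c • z)) := by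
    intro c z
    ext b
    rw [LinearMap.smul_apply, coRight_repr _ (ℛ k b), coRight_repr _ (ℛ k b), Finset.smul_sum]
    simp [smul_smul]
  induction p using Polynomial.induction_on with
  | C c =>
    refine ⟨c • z, ?_⟩
    rw [← hsmul, map_mul, Polynomial.aeval_X, Polynomial.aeval_C, Algebra.algebraMap_eq_smul_one,
      mul_smul_comm, mul_one]
  | add p q hp hq =>
    obtain ⟨a, ha⟩ := hp
    obtain ⟨b, hb⟩ := hq
    exact ⟨a + b, by rw [mul_add, map_add, ha, hb, hadd]⟩
  | monomial n c ih =>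
    obtain ⟨a, ha⟩ := ih
    obtain ⟨b, hb⟩ := coRight_comp_mul_mul hF a z
    refine ⟨b, ?_⟩
    rw [pow_succ, ← mul_assoc, ← mul_assoc, map_mul, mul_assoc, ha, Polynomial.aeval_X]
    ext x
    rw [Module.End.mul_apply, coRight_coRight, hb]

/-- The rank one operator `x ↦ f(x) v` has trace `f(v)`. As all `v i` lie in `W`, the trace can be
taken on the finite dimensional `W` although `V` may be infinite dimensional. -/
theorem trace_restrict_sum {V : Type*} [AddCommGroup V] [Module k V] {ι : Type*} (s : Finset ι)
    (f : ι → V →ₗ[k] k) (v : ι → V) (W : Submodule k V) [FiniteDimensional k W]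
    (hv : ∀ i ∈ s, v i ∈ W) (E : V →ₗ[k] V) (hE : ∀ x, E x = ∑ i ∈ s, f i x • v i)
    (hW : ∀ x ∈ W, E x ∈ W) :
    LinearMap.trace k W (E.restrict hW) = ∑ i ∈ s, f i (v i) := by
  have : E.restrict hW = ∑ i ∈ s.attach, (f i ∘ₗ W.subtype).smulRight ⟨v i, hv i i.2⟩ := by
    ext x
    simp only [coe_restrict_apply, hE, LinearMap.sum_apply, smulRight_apply, comp_apply,
      Submodule.subtype_apply, AddSubmonoidClass.coe_finsetSum, Submodule.coe_smul]
    exact (Finset.sum_attach s fun i => f i x • v i).symm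
  rw [this, map_sum]
  simp only [trace_smulRight, comp_apply, Submodule.subtype_apply]
  exact Finset.sum_attach s fun i => f i (v i)

/-- A finite-rank endomorphism that fixes a vector has a polynomial without constant term that is
idempotent and fixes the vector. -/
theorem exists_idempotent_aeval {V : Type*} [AddCommGroup V] [Module k V] (E : Module.End k V)
    (hE : FiniteDimensional k (LinearMap.range E)) (v : V) (hv : v ≠ 0) (hEv : E v = v) :
    ∃ p : Polynomial k, IsIdempotentElem (Polynomial.aeval E (Polynomial.X * p)) ∧
      Polynomial.aeval E (Polynomial.X * p) v = v := by
  open Polynomial in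
  have hW : ∀ x ∈ LinearMap.range E, E x ∈ LinearMap.range E := fun x _ => ⟨x, rfl⟩
  let T : Module.End k (LinearMap.range E) := E.restrict hW
  -- The extra factor `X` is needed because the minimal polynomial of the restriction kills `E` only
  -- on its range.
  let M : k[X] := X * minpoly k T
  have haev : ∀ (q : k[X]) (x : LinearMap.range E), aeval E q (x : V) = (aeval T q x : V) := by
    intro q
    induction q using Polynomial.induction_on with
    | C c => intro x; simp [Module.algebraMap_end_apply]
    | add p q hp hq => intro x; simp [hp, hq]
    | monomial n c ih =>
      intro x
      rw [pow_succ, ← mul_assoc, map_mul (aeval E) (C c * X ^ n), map_mul (aeval T) (C c * X ^ n),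
        Module.End.mul_apply, Module.End.mul_apply, aeval_X, aeval_X, ← ih]
      rfl
  have hM : aeval E M = 0 := by
    ext x
    have : aeval E M x = aeval E (minpoly k T) (E x) := by
      simp only [M, mul_comm X, map_mul, Module.End.mul_apply, aeval_X]
    rw [this]
    have h2 := haev (minpoly k T) ⟨E x, x, rfl⟩
    rw [minpoly.aeval] at h2
    simpa using h2
  have hevv : ∀ q : k[X], aeval E q v = q.eval 1 • v := by
    intro q
    have := Module.End.aeval_apply_of_hasEigenvector (f := E) (p := q) (μ := 1) (x := v)
      ⟨by simpa [Module.End.mem_eigenspace_iff] using hEv, hv⟩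
    exact this
  have hint : minpoly k T ≠ 0 := minpoly.ne_zero (Algebra.IsIntegral.isIntegral T)
  have hM0 : M ≠ 0 := mul_ne_zero X_ne_zero hint
  have hroot : M.IsRoot 1 := by
    have := hevv M
    rw [hM] at this
    simp only [LinearMap.zero_apply] at this
    exact (smul_eq_zero.1 this.symm).resolve_right hv
  -- Split `M = (X - 1)^m N` into coprime factors. In a Bézout identity `s (X - 1)^m + t N = 1` the
  -- term `t N` is idempotent modulo `M` and takes the value `1` at `1`. It has no constant term
  -- because `X` divides `M` and is prime to `X - 1`.
  obtain ⟨N, hN, hN1⟩ := exists_eq_pow_rootMultiplicity_mul_and_not_dvd M hM0 1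
  set m := rootMultiplicity 1 M
  have hm : m ≠ 0 := by
    have := (rootMultiplicity_pos hM0).2 hroot
    exact this.ne'
  have hcop : IsCoprime ((X - C 1) ^ m) N :=
    IsCoprime.pow_left ((irreducible_X_sub_C (1 : k)).coprime_iff_not_dvd.2 hN1)
  have hXN : X ∣ N := by
    have : X ∣ (X - C (1 : k)) ^ m * N := hN ▸ Dvd.intro _ rfl
    rcases prime_X.dvd_or_dvd this with h | h
    · have := prime_X.dvd_of_dvd_pow h
      rw [X_dvd_iff] at this
      simp at this
    · exact h
  obtain ⟨N', hN'⟩ := hXN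
  obtain ⟨s, t, hst⟩ := hcop
  refine ⟨t * N', ?_, ?_⟩
  · have h1 : X * (t * N') = t * N := by rw [hN']; ring
    rw [h1, IsIdempotentElem, ← map_mul]
    have h2 : t * N * (t * N) = t * N - s * t * M := by
      rw [hN]
      linear_combination (t * N) * hst
    rw [h2, map_sub, map_mul _ _ M, hM, mul_zero, sub_zero]
  · rw [hevv]
    have h1 : X * (t * N') = t * N := by rw [hN']; ring
    have h2 := congrArg (eval 1) hst
    rw [h1]
    simp only [eval_add, eval_mul, eval_pow, eval_sub, eval_X, eval_C, sub_self,
      zero_pow hm, mul_zero, zero_add, eval_one] at h2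
    rw [eval_mul, h2, one_smul]

theorem eq_zero_of_isIdempotentElem_of_trace_eq_zero [CharZero k] {V : Type*} [AddCommGroup V]
    [Module k V] [FiniteDimensional k V] {e : Module.End k V} (he : IsIdempotentElem e)
    (h : LinearMap.trace k V e = 0) : e = 0 :=
  LinearMap.IsIdempotentElem.eq_zero_of_trace_eq_zero he h

/-- A nonzero invariant functional on a commutative Hopf algebra in characteristic zero does not
vanish at `1`. -/
theorem IsLeftInvariant.apply_one_ne_zero [CharZero k] {F : D →ₗ[k] k}
    (hF : IsLeftInvariant F) (h0 : F ≠ 0) : F 1 ≠ 0 := by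
  classical
  obtain ⟨z₀, hz₀⟩ : ∃ z, F z ≠ 0 := by
    by_contra! h
    exact h0 (LinearMap.ext h)
  have hfr : ∀ z : D, ∃ (W : Submodule k D) (_ : FiniteDimensional k W),
      (∀ i ∈ (ℛ k z).index, HopfAlgebra.antipode k ((ℛ k z).left i) ∈ W) ∧
      ∀ x, coRight (F ∘ₗ LinearMap.mulLeft k z) x ∈ W := by
    intro z
    let W := Submodule.span k
      (((ℛ k z).index.image fun i => HopfAlgebra.antipode k ((ℛ k z).left i) : Finset D) : Set D)
    have hm : ∀ i ∈ (ℛ k z).index, HopfAlgebra.antipode k ((ℛ k z).left i) ∈ W := fun i hi =>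
      Submodule.subset_span (by
        rw [Finset.coe_image]
        exact ⟨i, hi, rfl⟩)
    refine ⟨W, FiniteDimensional.span_finset k _, hm, fun x => ?_⟩
    rw [coRight_mul_eq_antipode hF z x (ℛ k z)]
    exact Submodule.sum_mem _ fun i hi => Submodule.smul_mem _ _ (hm i hi)
  -- With `F z = 1` the operator `b ↦ b₁ F(z b₂)` fixes `1`. Its rank is finite, as its values lie
  -- in the span of the `S(z₁)`.
  set z := (F z₀)⁻¹ • z₀
  have hz : F z = 1 := by simp [z, hz₀]
  have hE1 : coRight (F ∘ₗ LinearMap.mulLeft k z) (1 : D) = 1 := by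
    simp [coRight, Bialgebra.comul_one, Algebra.TensorProduct.one_def, hz]
  have h10 : (1 : D) ≠ 0 := by
    intro h
    have : z = 0 := by rw [← mul_one z, h, mul_zero]
    rw [this, map_zero] at hz
    exact zero_ne_one hz
  obtain ⟨W, _, -, hW⟩ := hfr z
  have hfd : FiniteDimensional k (LinearMap.range (coRight (F ∘ₗ LinearMap.mulLeft k z))) :=
    Submodule.finiteDimensional_of_le (S₂ := W) (by rintro _ ⟨x, rfl⟩; exact hW x)
  obtain ⟨p, hp, hp1⟩ := exists_idempotent_aeval _ hfd 1 h10 hE1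
  obtain ⟨z', hz'⟩ := exists_coRight_aeval hF z p
  rw [hz'] at hp hp1
  obtain ⟨W', _, hm, hW'⟩ := hfr z'
  -- The idempotent has trace `∑ F(z'₂ S(z'₁))`, which by commutativity is `ε(z') F(1)`. If `F(1) =
  -- 0`, the idempotent has trace zero, hence is zero in characteristic zero, although it fixes `1`.
  have htr := trace_restrict_sum (ℛ k z').index
    (fun i => F ∘ₗ LinearMap.mulLeft k ((ℛ k z').right i))
    (fun i => HopfAlgebra.antipode k ((ℛ k z').left i)) W' hm
    (coRight (F ∘ₗ LinearMap.mulLeft k z'))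
    (fun x => by rw [coRight_mul_eq_antipode hF z' x (ℛ k z')]; rfl) (fun x _ => hW' x)
  intro hF1
  have hsum : ∑ i ∈ (ℛ k z').index, (F ∘ₗ LinearMap.mulLeft k ((ℛ k z').right i))
      (HopfAlgebra.antipode k ((ℛ k z').left i)) = 0 := by
    simp only [comp_apply, mulLeft_apply, ← map_sum]
    rw [Finset.sum_congr rfl fun i _ => mul_comm _ _, HopfAlgebra.sum_antipode_mul_eq_smul,
      map_smul, hF1, smul_zero]
  rw [hsum] at htr
  have hid : IsIdempotentElem ((coRight (F ∘ₗ LinearMap.mulLeft k z')).restrict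
      (fun x (_ : x ∈ W') => hW' x)) := by
    ext x
    exact congrArg (fun f : Module.End k D => f x) hp
  have := eq_zero_of_isIdempotentElem_of_trace_eq_zero hid htr
  have h1 : (1 : D) ∈ W' := hp1 ▸ hW' 1
  have h2 := congrArg (fun f : Module.End k W' => (f ⟨1, h1⟩ : D)) this
  exact h10 (hp1.symm.trans h2)

end HopfIntegral

variable {k : Type u} [Field k]

/-! ### Parity and the signed tensor product -/

namespace Supergroup

open Coalgebra WithConv

variable (H : Supergroup k)

/-- The projection of `k[H]` to its part of parity `i`. -/
def pr (i : ZMod 2) : H.Coord →ₗ[k] H.Coord := GradedAlgebra.proj H.gr i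

variable {H}

theorem pr_mem (i : ZMod 2) (a : H.Coord) : H.pr i a ∈ H.gr i :=
  ((DirectSum.decompose H.gr a) i).2

theorem pr_of_mem {i : ZMod 2} {a : H.Coord} (ha : a ∈ H.gr i) : H.pr i a = a := by
  rw [pr, GradedAlgebra.proj_apply]
  exact DirectSum.decompose_of_mem_same _ ha

theorem pr_of_mem_ne {i j : ZMod 2} {a : H.Coord} (ha : a ∈ H.gr j) (h : j ≠ i) :
    H.pr i a = 0 := by
  rw [pr, GradedAlgebra.proj_apply]
  exact DirectSum.decompose_of_mem_ne _ ha h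

theorem pr_zero_of_odd {a : H.Coord} (ha : a ∈ H.gr 1) : H.pr 0 a = 0 :=
  pr_of_mem_ne ha (by decide)

theorem pr_one_of_even {a : H.Coord} (ha : a ∈ H.gr 0) : H.pr 1 a = 0 :=
  pr_of_mem_ne ha (by decide)

theorem parity_cases (i : ZMod 2) : i = 0 ∨ i = 1 := by
  fin_cases i
  · exact Or.inl rfl
  · exact Or.inr rfl

theorem pr_add_pr (a : H.Coord) : H.pr 0 a + H.pr 1 a = a := by
  have htop : H.gr 0 ⊔ H.gr 1 = ⊤ := (GModule.regular H).isCompl.codisjoint.eq_top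
  have ha : a ∈ H.gr 0 ⊔ H.gr 1 := htop ▸ Submodule.mem_top
  obtain ⟨x, hx, y, hy, rfl⟩ := Submodule.mem_sup.1 ha
  rw [map_add, map_add, pr_of_mem hx, pr_of_mem hy, pr_zero_of_odd hy, pr_one_of_even hx, add_zero,
    zero_add]

theorem homogeneous_induction {p : H.Coord → Prop} (hadd : ∀ a b, p a → p b → p (a + b))
    (hom : ∀ (i : ZMod 2), ∀ a ∈ H.gr i, p a) (a : H.Coord) : p a := by
  rw [← pr_add_pr a]
  exact hadd _ _ (hom 0 _ (pr_mem 0 a)) (hom 1 _ (pr_mem 1 a))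

theorem tensor_induction {p : H.Coord ⊗[k] H.Coord → Prop} (hadd : ∀ x y, p x → p y → p (x + y))
    (hom : ∀ (i j : ZMod 2), ∀ a ∈ H.gr i, ∀ b ∈ H.gr j, p (a ⊗ₜ b)) (x : H.Coord ⊗[k] H.Coord) :
    p x := by
  induction x with
  | zero => simpa using hom 0 0 0 (zero_mem _) 0 (zero_mem _)
  | add x y hx hy => exact hadd _ _ hx hy
  | tmul a b =>
    refine homogeneous_induction (p := fun a => p (a ⊗ₜ b)) (fun x y hx hy => ?_) (fun i a ha => ?_) a
    · rw [TensorProduct.add_tmul]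
      exact hadd _ _ hx hy
    · refine homogeneous_induction (p := fun b => p (a ⊗ₜ b)) (fun x y hx hy => ?_)
        (fun j b hb => hom i j a ha b hb) b
      rw [TensorProduct.tmul_add]
      exact hadd _ _ hx hy

theorem tensorGr_induction {V W : Type u} [AddCommGroup V] [Module k V] [AddCommGroup W]
    [Module k W] {𝒱 : ZMod 2 → Submodule k V} {𝒲 : ZMod 2 → Submodule k W} {i : ZMod 2}
    {p : V ⊗[k] W → Prop} (hadd : ∀ x y, p x → p y → p (x + y))
    (hom : ∀ (j : ZMod 2), ∀ a ∈ 𝒱 j, ∀ b ∈ 𝒲 (i - j), p (a ⊗ₜ b)) (x : V ⊗[k] W)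
    (hx : x ∈ tensorGr 𝒱 𝒲 i) : p x := by
  have h0 : p 0 := by simpa using hom 0 0 (zero_mem _) 0 (zero_mem _)
  unfold tensorGr at hx
  induction hx using Submodule.iSup_induction' with
  | zero => exact h0
  | add x y _ _ hx hy => exact hadd _ _ hx hy
  | mem j x hx =>
    obtain ⟨y, rfl⟩ := hx
    induction y with
    | zero => simpa using h0
    | add x y hx hy => rw [map_add]; exact hadd _ _ hx hy
    | tmul a b => exact hom j a a.2 b b.2

variable (H) in
/-- The product of the graded tensor product `k[H] ⊗ k[H]`. -/
def star (x y : H.Coord ⊗[k] H.Coord) : H.Coord ⊗[k] H.Coord :=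
  (GradedTensorProduct.of k H.gr H.gr).symm
    (GradedTensorProduct.of k H.gr H.gr x * GradedTensorProduct.of k H.gr H.gr y)

theorem comul_mul_eq_star (a b : H.Coord) :
    comul (R := k) (a * b) = H.star (comul a) (comul b) := by
  rw [star, ← H.comul_mul]
  rfl

theorem star_add (x y z : H.Coord ⊗[k] H.Coord) : H.star x (y + z) = H.star x y + H.star x z := by
  simp only [star, map_add, mul_add]

theorem add_star (x y z : H.Coord ⊗[k] H.Coord) : H.star (x + y) z = H.star x z + H.star y z := by
  simp only [star, map_add, add_mul]

theorem star_tmul {i j : ZMod 2} (a : H.Coord) {b c : H.Coord} (hb : b ∈ H.gr i) (hc : c ∈ H.gr j)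
    (d : H.Coord) : H.star (a ⊗ₜ b) (c ⊗ₜ d) = ((-1 : ℤˣ) ^ (i * j)) • ((a * c) ⊗ₜ[k] (b * d)) :=
  congrArg (GradedTensorProduct.of k H.gr H.gr).symm
    (GradedTensorProduct.tmul_coe_mul_coe_tmul H.gr H.gr a ⟨b, hb⟩ ⟨c, hc⟩ d)

theorem star_tmul_even_left (a : H.Coord) {b : H.Coord} (c : H.Coord) (hb : b ∈ H.gr 0)
    (d : H.Coord) : H.star (a ⊗ₜ b) (c ⊗ₜ d) = (a * c) ⊗ₜ[k] (b * d) := by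
  refine homogeneous_induction
    (p := fun c => H.star (a ⊗ₜ b) (c ⊗ₜ d) = (a * c) ⊗ₜ[k] (b * d)) ?_ ?_ c
  · intro x y hx hy
    rw [TensorProduct.add_tmul, star_add, hx, hy, mul_add, TensorProduct.add_tmul]
  · intro i c hc
    rw [star_tmul a hb hc, zero_mul, uzpow_zero, one_smul]

theorem star_tmul_even_right (a b : H.Coord) {c : H.Coord} (hc : c ∈ H.gr 0)
    (d : H.Coord) : H.star (a ⊗ₜ b) (c ⊗ₜ d) = (a * c) ⊗ₜ[k] (b * d) := by
  refine homogeneous_induction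
    (p := fun b => H.star (a ⊗ₜ b) (c ⊗ₜ d) = (a * c) ⊗ₜ[k] (b * d)) ?_ ?_ b
  · intro x y hx hy
    rw [TensorProduct.tmul_add, add_star, hx, hy, add_mul, TensorProduct.tmul_add]
  · intro i b hb
    rw [star_tmul a hb hc, mul_zero, uzpow_zero, one_smul]

theorem star_tmul_odd (a : H.Coord) {b c : H.Coord} (hb : b ∈ H.gr 1) (hc : c ∈ H.gr 1)
    (d : H.Coord) : H.star (a ⊗ₜ b) (c ⊗ₜ d) = -((a * c) ⊗ₜ[k] (b * d)) := by
  rw [star_tmul a hb hc, one_mul, uzpow_one, Units.neg_smul, one_smul]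

theorem mul_comm_of_even_left {a : H.Coord} (ha : a ∈ H.gr 0) (b : H.Coord) : a * b = b * a := by
  refine homogeneous_induction (p := fun b => a * b = b * a) ?_ ?_ b
  · intro x y hx hy
    rw [mul_add, hx, hy, add_mul]
  · intro i b hb
    rw [H.supercomm 0 i a b ha hb, zero_mul, uzpow_zero, one_smul]

theorem mul_anticomm_of_odd {a b : H.Coord} (ha : a ∈ H.gr 1) (hb : b ∈ H.gr 1) :
    a * b = -(b * a) := by
  rw [H.supercomm 1 1 a b ha hb, one_mul, uzpow_one, Units.neg_smul, one_smul]

theorem mul_self_of_odd [CharZero k] {a : H.Coord} (ha : a ∈ H.gr 1) : a * a = 0 := by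
  have h := mul_anticomm_of_odd ha ha
  have h2 : (2 : k) • (a * a) = 0 := by
    rw [two_smul]
    nth_rewrite 1 [h]
    exact neg_add_cancel _
  exact (smul_eq_zero.1 h2).resolve_left two_ne_zero

theorem mul_mem {i j : ZMod 2} {a b : H.Coord} (ha : a ∈ H.gr i) (hb : b ∈ H.gr j) :
    a * b ∈ H.gr (i + j) :=
  SetLike.GradedMul.mul_mem ha hb

theorem one_mem : (1 : H.Coord) ∈ H.gr 0 := SetLike.GradedOne.one_mem

theorem counit_pr_zero (a : H.Coord) : counit (R := k) (H.pr 0 a) = counit (R := k) a := by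
  conv_rhs => rw [← pr_add_pr a, map_add, H.counit_odd _ (pr_mem 1 a), add_zero]

theorem point_odd [CharZero k] (g : H.Point) {a : H.Coord} (ha : a ∈ H.gr 1) : g a = 0 := by
  have h := congrArg g (mul_self_of_odd ha)
  rw [map_mul, map_zero] at h
  exact mul_self_eq_zero.1 h

/-! ### Multiplicativity of the comultiplication after killing the odd functions -/

section KillOdd

variable {B C : Type*} [Ring B] [Algebra k B] [Ring C] [Algebra k C]

/-- The sign in `(a ⊗ b)(c ⊗ d)` is nontrivial only if `b` and `c` are both odd, and then both sides
vanish because `q c = 0`. -/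
theorem map_star_of_left {q : H.Coord →ₐ[k] B} (hq : ∀ a ∈ H.gr 1, q a = 0) (r : H.Coord →ₐ[k] C)
    (x y : H.Coord ⊗[k] H.Coord) :
    TensorProduct.map q.toLinearMap r.toLinearMap (H.star x y) =
      TensorProduct.map q.toLinearMap r.toLinearMap x *
        TensorProduct.map q.toLinearMap r.toLinearMap y := by
  refine tensor_induction (p := fun x => TensorProduct.map q.toLinearMap r.toLinearMap (H.star x y) =
      TensorProduct.map q.toLinearMap r.toLinearMap x *
        TensorProduct.map q.toLinearMap r.toLinearMap y)
    (fun x x' hx hx' => by rw [add_star, map_add, hx, hx', map_add, add_mul]) ?_ x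
  intro i j a ha b hb
  refine tensor_induction (p := fun y => TensorProduct.map q.toLinearMap r.toLinearMap
      (H.star (a ⊗ₜ b) y) = TensorProduct.map q.toLinearMap r.toLinearMap (a ⊗ₜ b) *
        TensorProduct.map q.toLinearMap r.toLinearMap y)
    (fun y y' hy hy' => by rw [star_add, map_add, hy, hy', map_add, mul_add]) ?_ y
  intro i' j' c hc d hd
  rcases parity_cases i' with rfl | rfl
  · rw [star_tmul_even_right a b hc]
    simp
  · rcases parity_cases j with rfl | rfl
    · rw [star_tmul_even_left a c hb]
      simp
    · rw [star_tmul_odd a hb hc]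
      simp [hq c hc]

/-- As for `map_star_of_left`, except that the signed terms now vanish because `q b = 0`. -/
theorem map_star_of_right {q : H.Coord →ₐ[k] B} (hq : ∀ a ∈ H.gr 1, q a = 0) (r : H.Coord →ₐ[k] C)
    (x y : H.Coord ⊗[k] H.Coord) :
    TensorProduct.map r.toLinearMap q.toLinearMap (H.star x y) =
      TensorProduct.map r.toLinearMap q.toLinearMap x *
        TensorProduct.map r.toLinearMap q.toLinearMap y := by
  refine tensor_induction (p := fun x => TensorProduct.map r.toLinearMap q.toLinearMap (H.star x y) =
      TensorProduct.map r.toLinearMap q.toLinearMap x *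
        TensorProduct.map r.toLinearMap q.toLinearMap y)
    (fun x x' hx hx' => by rw [add_star, map_add, hx, hx', map_add, add_mul]) ?_ x
  intro i j a ha b hb
  refine tensor_induction (p := fun y => TensorProduct.map r.toLinearMap q.toLinearMap
      (H.star (a ⊗ₜ b) y) = TensorProduct.map r.toLinearMap q.toLinearMap (a ⊗ₜ b) *
        TensorProduct.map r.toLinearMap q.toLinearMap y)
    (fun y y' hy hy' => by rw [star_add, map_add, hy, hy', map_add, mul_add]) ?_ y
  intro i' j' c hc d hd
  rcases parity_cases i' with rfl | rfl
  · rw [star_tmul_even_right a b hc]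
    simp
  · rcases parity_cases j with rfl | rfl
    · rw [star_tmul_even_left a c hb]
      simp
    · rw [star_tmul_odd a hb hc]
      simp [hq b hb]

/-- `a ↦ q(a₁) ⊗ r(a₂)` is multiplicative if `q` kills the odd functions. -/
def comulHomLeft (q : H.Coord →ₐ[k] B) (hq : ∀ a ∈ H.gr 1, q a = 0) (r : H.Coord →ₐ[k] C) :
    H.Coord →ₐ[k] B ⊗[k] C :=
  AlgHom.ofLinearMap (TensorProduct.map q.toLinearMap r.toLinearMap ∘ₗ comul)
    (by simp [H.comul_one, Algebra.TensorProduct.one_def])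
    (fun a b => by
      rw [LinearMap.comp_apply, comul_mul_eq_star, map_star_of_left hq]
      rfl)

/-- `a ↦ r(a₁) ⊗ q(a₂)` is multiplicative if `q` kills the odd functions. -/
def comulHomRight (q : H.Coord →ₐ[k] B) (hq : ∀ a ∈ H.gr 1, q a = 0) (r : H.Coord →ₐ[k] C) :
    H.Coord →ₐ[k] C ⊗[k] B :=
  AlgHom.ofLinearMap (TensorProduct.map r.toLinearMap q.toLinearMap ∘ₗ comul)
    (by simp [H.comul_one, Algebra.TensorProduct.one_def])
    (fun a b => by
      rw [LinearMap.comp_apply, comul_mul_eq_star, map_star_of_right hq]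
      rfl)

theorem comulHomLeft_apply (q : H.Coord →ₐ[k] B) (hq : ∀ a ∈ H.gr 1, q a = 0)
    (r : H.Coord →ₐ[k] C) (a : H.Coord) :
    comulHomLeft q hq r a = TensorProduct.map q.toLinearMap r.toLinearMap (comul a) := rfl

end KillOdd

/-! ### The antipode -/

theorem antipode_conv_id : toConv H.antipode * toConv LinearMap.id = 1 := by
  ext a
  exact H.antipode_left a

theorem id_conv_antipode : toConv LinearMap.id * toConv H.antipode = 1 := by
  ext a
  exact H.antipode_right a

theorem algHom_antipode_conv {B : Type*} [Ring B] [Algebra k B] (q : H.Coord →ₐ[k] B) :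
    toConv (q.toLinearMap ∘ₗ H.antipode) * toConv q.toLinearMap = 1 := by
  have h := LinearMap.algHom_comp_convMul_distrib q (toConv H.antipode) (toConv LinearMap.id)
  rw [antipode_conv_id] at h
  apply WithConv.ofConv_injective
  refine Eq.trans h.symm ?_
  ext a
  simp [LinearMap.convOne_def]

theorem algHom_conv_antipode {B : Type*} [Ring B] [Algebra k B] (q : H.Coord →ₐ[k] B) :
    toConv q.toLinearMap * toConv (q.toLinearMap ∘ₗ H.antipode) = 1 := by
  have h := LinearMap.algHom_comp_convMul_distrib q (toConv LinearMap.id) (toConv H.antipode)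
  rw [id_conv_antipode] at h
  apply WithConv.ofConv_injective
  refine Eq.trans h.symm ?_
  ext a
  simp [LinearMap.convOne_def]

/-- The counit as an algebra homomorphism. -/
def counitHom (H : Supergroup k) : H.Point :=
  AlgHom.ofLinearMap counit H.counit_one H.counit_mul

theorem counit_antipode (a : H.Coord) :
    counit (R := k) (H.antipode a) = counit (R := k) a := by
  have h := algHom_antipode_conv (H.counitHom)
  have h1 : toConv (H.counitHom).toLinearMap = (1 : WithConv (H.Coord →ₗ[k] k)) := rfl
  rw [h1, mul_one] at h
  exact congrArg (fun f : WithConv (H.Coord →ₗ[k] k) => f a) h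

theorem antipode_one : H.antipode 1 = 1 := by
  have h := H.antipode_left 1
  rw [H.comul_one, H.counit_one, map_one] at h
  simpa using h

/-- The antipode is multiplicative modulo the odd functions. -/
theorem algHom_antipode_mul {B : Type*} [CommRing B] [Algebra k B] (q : H.Coord →ₐ[k] B)
    (hq : ∀ a ∈ H.gr 1, q a = 0) (a b : H.Coord) :
    q (H.antipode (a * b)) = q (H.antipode a) * q (H.antipode b) := by
  -- Uniqueness of inverses in the convolution algebra of maps `k[H] ⊗ k[H] → B`: `F` is a left
  -- inverse and `P` a right inverse of `N`. The tensor product carries its unsigned coalgebra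
  -- structure, which does no harm because `q` kills the odd functions.
  let F : H.Coord ⊗[k] H.Coord →ₗ[k] B := q.toLinearMap ∘ₗ H.antipode ∘ₗ LinearMap.mul' k H.Coord
  let N : H.Coord ⊗[k] H.Coord →ₗ[k] B := q.toLinearMap ∘ₗ LinearMap.mul' k H.Coord
  let P : H.Coord ⊗[k] H.Coord →ₗ[k] B := LinearMap.mul' k B ∘ₗ
    TensorProduct.map (q.toLinearMap ∘ₗ H.antipode) (q.toLinearMap ∘ₗ H.antipode)
  have hFN : toConv F * toConv N = 1 := by
    ext a b
    change LinearMap.mul' k B (TensorProduct.map F N (comul (a ⊗ₜ[k] b))) = _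
    have key : ∀ x y : H.Coord ⊗[k] H.Coord, LinearMap.mul' k B (TensorProduct.map F N
        (TensorProduct.tensorTensorTensorComm k H.Coord H.Coord H.Coord H.Coord (x ⊗ₜ y))) =
        LinearMap.mul' k B (TensorProduct.map (q.toLinearMap ∘ₗ H.antipode) q.toLinearMap
          (H.star x y)) := by
      intro x y
      refine tensor_induction (p := fun x => LinearMap.mul' k B (TensorProduct.map F N
        (TensorProduct.tensorTensorTensorComm k H.Coord H.Coord H.Coord H.Coord (x ⊗ₜ y))) =
        LinearMap.mul' k B (TensorProduct.map (q.toLinearMap ∘ₗ H.antipode) q.toLinearMap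
          (H.star x y))) (fun x x' hx hx' => by
            rw [TensorProduct.add_tmul, map_add, map_add, map_add, hx, hx', add_star, map_add,
              map_add]) ?_ x
      intro i j a ha b hb
      refine tensor_induction (p := fun y => LinearMap.mul' k B (TensorProduct.map F N
        (TensorProduct.tensorTensorTensorComm k H.Coord H.Coord H.Coord H.Coord
          ((a ⊗ₜ b) ⊗ₜ y))) =
        LinearMap.mul' k B (TensorProduct.map (q.toLinearMap ∘ₗ H.antipode) q.toLinearMap
          (H.star (a ⊗ₜ b) y))) (fun x x' hx hx' => by
            rw [TensorProduct.tmul_add, map_add, map_add, map_add, hx, hx', star_add, map_add,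
              map_add]) ?_ y
      intro i' j' c hc d hd
      rcases parity_cases j with rfl | rfl
      · rw [star_tmul_even_left a c hb]
        simp [F, N]
      · rcases parity_cases i' with rfl | rfl
        · rw [star_tmul_even_right a b hc]
          simp [F, N]
        · rw [star_tmul_odd a hb hc]
          simp [F, N, hq b hb]
    have h1 : comul (R := k) (a ⊗ₜ[k] b) = TensorProduct.tensorTensorTensorComm k H.Coord H.Coord
        H.Coord H.Coord (comul (R := k) a ⊗ₜ comul (R := k) b) := rfl
    rw [h1, key, ← comul_mul_eq_star]
    have h2 := congrArg (fun f : WithConv (H.Coord →ₗ[k] B) => f (a * b)) (algHom_antipode_conv q)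
    refine Eq.trans h2 ?_
    simp [H.counit_mul, mul_comm]
  have hNP : toConv N * toConv P = 1 := by
    ext a b
    change LinearMap.mul' k B (TensorProduct.map N P (comul (a ⊗ₜ[k] b))) = _
    have h1 : comul (R := k) (a ⊗ₜ[k] b) = TensorProduct.tensorTensorTensorComm k H.Coord H.Coord
        H.Coord H.Coord (comul (R := k) a ⊗ₜ comul (R := k) b) := rfl
    have key : ∀ x y : H.Coord ⊗[k] H.Coord, LinearMap.mul' k B (TensorProduct.map N P
        (TensorProduct.tensorTensorTensorComm k H.Coord H.Coord H.Coord H.Coord (x ⊗ₜ y))) =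
        LinearMap.mul' k B (TensorProduct.map q.toLinearMap (q.toLinearMap ∘ₗ H.antipode) x) *
        LinearMap.mul' k B (TensorProduct.map q.toLinearMap (q.toLinearMap ∘ₗ H.antipode) y) := by
      intro x y
      induction x with
      | zero => simp
      | add x x' hx hx' => simp only [TensorProduct.add_tmul, map_add, hx, hx', add_mul]
      | tmul a b =>
        induction y with
        | zero => simp
        | add x x' hx hx' => simp only [TensorProduct.tmul_add, map_add, hx, hx', mul_add]
        | tmul c d =>
          simp [N, P]
          ring
    rw [h1, key]
    have h2 : ∀ a, LinearMap.mul' k B (TensorProduct.map q.toLinearMap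
        (q.toLinearMap ∘ₗ H.antipode) (comul a)) = algebraMap k B (counit a) := fun a =>
      congrArg (fun f : WithConv (H.Coord →ₗ[k] B) => f a) (algHom_conv_antipode q)
    rw [h2, h2]
    simp [mul_comm]
  have h := left_inv_eq_right_inv hFN hNP
  have := congrArg (fun f : WithConv (H.Coord ⊗[k] H.Coord →ₗ[k] B) => f (a ⊗ₜ b)) h
  change F (a ⊗ₜ b) = P (a ⊗ₜ b) at this
  simpa [F, P] using this

end Supergroup

/-! ### The even part `H₀` as a commutative Hopf algebra -/

namespace Supergroup

open Coalgebra WithConv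

variable (H : Supergroup k)

/-- The ideal generated by the odd functions. -/
def oddIdeal : Ideal H.Coord := Ideal.span (H.gr 1 : Set H.Coord)

variable {H}

theorem mem_oddIdeal_of_odd {a : H.Coord} (ha : a ∈ H.gr 1) : a ∈ H.oddIdeal :=
  Ideal.subset_span ha

instance : H.oddIdeal.IsTwoSided where
  mul_mem_of_left {a} b ha := by
    unfold oddIdeal at ha ⊢
    induction ha using Submodule.span_induction with
    | zero => rw [zero_mul]; exact zero_mem _
    | add x y _ _ hx hy => rw [add_mul]; exact add_mem hx hy
    | smul c x _ hx =>
      rw [smul_eq_mul, mul_assoc]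
      exact Ideal.mul_mem_left _ _ hx
    | mem x hx =>
      refine homogeneous_induction (p := fun b => x * b ∈ Ideal.span (H.gr 1 : Set H.Coord))
        (fun a b ha hb => by rw [mul_add]; exact add_mem ha hb) ?_ b
      intro i b hb
      rcases parity_cases i with rfl | rfl
      · rw [← mul_comm_of_even_left hb]
        exact Ideal.mul_mem_left _ _ (Ideal.subset_span hx)
      · exact Ideal.mul_mem_left _ _ (Ideal.subset_span hb)

variable (H) in
/-- The coordinate ring of the even part `H₀`. -/
def EvenRing : Type u := H.Coord ⧸ H.oddIdeal

instance : Ring H.EvenRing := inferInstanceAs (Ring (H.Coord ⧸ H.oddIdeal))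

instance : Algebra k H.EvenRing := inferInstanceAs (Algebra k (H.Coord ⧸ H.oddIdeal))

variable (H) in
/-- The restriction of functions to `H₀`. -/
def evenMk : H.Coord →ₐ[k] H.EvenRing := Ideal.Quotient.mkₐ k H.oddIdeal

theorem evenMk_surjective : Function.Surjective H.evenMk := Ideal.Quotient.mkₐ_surjective k _

theorem evenMk_eq_zero {a : H.Coord} : H.evenMk a = 0 ↔ a ∈ H.oddIdeal :=
  Ideal.Quotient.eq_zero_iff_mem

theorem evenMk_odd : ∀ a ∈ H.gr 1, H.evenMk a = 0 := fun _ ha =>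
  evenMk_eq_zero.2 (mem_oddIdeal_of_odd ha)

theorem evenMk_pr_zero (a : H.Coord) : H.evenMk (H.pr 0 a) = H.evenMk a := by
  conv_rhs => rw [← pr_add_pr a, map_add, evenMk_odd _ (pr_mem 1 a), add_zero]

instance : CommRing H.EvenRing :=
  { (inferInstance : Ring H.EvenRing) with
    mul_comm := fun x y => by
      obtain ⟨a, rfl⟩ := evenMk_surjective x
      obtain ⟨b, rfl⟩ := evenMk_surjective y
      rw [← evenMk_pr_zero a, ← map_mul, ← map_mul, mul_comm_of_even_left (pr_mem 0 a)] }

variable {B : Type*} [Ring B] [Algebra k B]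

/-- An algebra homomorphism that kills the odd functions factors through `k[H₀]`. -/
def evenLift (q : H.Coord →ₐ[k] B) (hq : ∀ a ∈ H.gr 1, q a = 0) : H.EvenRing →ₐ[k] B :=
  Ideal.Quotient.liftₐ H.oddIdeal q (fun a ha => by
    have : H.oddIdeal ≤ RingHom.ker q.toRingHom := Ideal.span_le.2 hq
    exact this ha)

theorem evenLift_evenMk (q : H.Coord →ₐ[k] B) (hq : ∀ a ∈ H.gr 1, q a = 0) (a : H.Coord) :
    evenLift q hq (H.evenMk a) = q a := rfl

/-- Every term of the comultiplication of an odd function has an odd tensor factor. This is what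
lets the comultiplication descend to `k[H₀]`. -/
theorem evenMk_comul_odd : ∀ a ∈ H.gr 1,
    comulHomLeft H.evenMk evenMk_odd H.evenMk a = 0 := by
  intro a ha
  rw [comulHomLeft_apply]
  refine tensorGr_induction (p := fun x => TensorProduct.map H.evenMk.toLinearMap
    H.evenMk.toLinearMap x = 0) (fun x y hx hy => by rw [map_add, hx, hy, add_zero]) ?_ _
    (H.comul_mem 1 a ha)
  intro j a ha b hb
  rcases parity_cases j with rfl | rfl
  · simp [evenMk_odd b (by simpa using hb)]
  · simp [evenMk_odd a ha]

/-- The antipode, as an algebra homomorphism `k[H] → k[H₀]`. -/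
def evenAntipode (H : Supergroup k) : H.Coord →ₐ[k] H.EvenRing :=
  AlgHom.ofLinearMap (H.evenMk.toLinearMap ∘ₗ H.antipode)
    (by simp [antipode_one]) (algHom_antipode_mul H.evenMk evenMk_odd)

theorem evenAntipode_odd : ∀ a ∈ H.gr 1, H.evenAntipode a = 0 := fun a ha =>
  evenMk_odd _ (H.antipode_mem 1 a ha)

instance : Bialgebra k H.EvenRing :=
  Bialgebra.ofAlgHom
    (evenLift (comulHomLeft H.evenMk evenMk_odd H.evenMk) evenMk_comul_odd)
    (evenLift H.counitHom H.counit_odd)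
    (by
      ext x
      obtain ⟨a, rfl⟩ := evenMk_surjective x
      have h := congrArg (TensorProduct.map H.evenMk.toLinearMap
        (TensorProduct.map H.evenMk.toLinearMap H.evenMk.toLinearMap)) (coassoc_apply (R := k) a)
      have h1 : ∀ x : H.Coord ⊗[k] H.Coord, TensorProduct.map H.evenMk.toLinearMap
          (TensorProduct.map H.evenMk.toLinearMap H.evenMk.toLinearMap)
          (TensorProduct.assoc k _ _ _ (comul.rTensor H.Coord x)) =
          Algebra.TensorProduct.assoc k k k _ _ _ (Algebra.TensorProduct.map
            (evenLift (comulHomLeft H.evenMk evenMk_odd H.evenMk) evenMk_comul_odd) (.id k _)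
            (TensorProduct.map H.evenMk.toLinearMap H.evenMk.toLinearMap x)) := by
        intro x
        induction x with
        | zero => simp
        | add x y hx hy => simp only [map_add, hx, hy]
        | tmul a b =>
          simp only [LinearMap.rTensor_tmul, TensorProduct.map_tmul, AlgHom.toLinearMap_apply,
            Algebra.TensorProduct.map_tmul, evenLift_evenMk, comulHomLeft_apply]
          induction comul (R := k) a with
          | zero => simp
          | add x y hx hy => simp only [map_add, TensorProduct.add_tmul, hx, hy]
          | tmul p q => simp
      have h2 : ∀ x : H.Coord ⊗[k] H.Coord, TensorProduct.map H.evenMk.toLinearMap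
          (TensorProduct.map H.evenMk.toLinearMap H.evenMk.toLinearMap)
          (comul.lTensor H.Coord x) =
          (Algebra.TensorProduct.map (.id k _)
            (evenLift (comulHomLeft H.evenMk evenMk_odd H.evenMk) evenMk_comul_odd)
            (TensorProduct.map H.evenMk.toLinearMap H.evenMk.toLinearMap x)) := by
        intro x
        induction x with
        | zero => simp
        | add x y hx hy => simp only [map_add, hx, hy]
        | tmul a b => simp [evenLift_evenMk, comulHomLeft_apply]
      rw [h1, h2] at h
      exact h)
    (by
      ext x
      obtain ⟨a, rfl⟩ := evenMk_surjective x
      have h := congrArg (TensorProduct.map LinearMap.id H.evenMk.toLinearMap)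
        (rTensor_counit_comul (R := k) a)
      have h1 : ∀ x : H.Coord ⊗[k] H.Coord, TensorProduct.map LinearMap.id H.evenMk.toLinearMap
          (counit.rTensor H.Coord x) = Algebra.TensorProduct.map
            (evenLift H.counitHom H.counit_odd) (.id k _)
            (TensorProduct.map H.evenMk.toLinearMap H.evenMk.toLinearMap x) := by
        intro x
        induction x with
        | zero => simp
        | add x y hx hy => simp only [map_add, hx, hy]
        | tmul a b =>
          simp
          rfl
      rw [h1] at h
      exact h)
    (by
      ext x
      obtain ⟨a, rfl⟩ := evenMk_surjective x
      have h := congrArg (TensorProduct.map H.evenMk.toLinearMap LinearMap.id)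
        (lTensor_counit_comul (R := k) a)
      have h1 : ∀ x : H.Coord ⊗[k] H.Coord, TensorProduct.map H.evenMk.toLinearMap LinearMap.id
          (counit.lTensor H.Coord x) = Algebra.TensorProduct.map (.id k _)
            (evenLift H.counitHom H.counit_odd)
            (TensorProduct.map H.evenMk.toLinearMap H.evenMk.toLinearMap x) := by
        intro x
        induction x with
        | zero => simp
        | add x y hx hy => simp only [map_add, hx, hy]
        | tmul a b =>
          simp
          rfl
      rw [h1] at h
      exact h)

theorem comul_evenMk (a : H.Coord) : comul (R := k) (H.evenMk a) =
    TensorProduct.map H.evenMk.toLinearMap H.evenMk.toLinearMap (comul a) := rfl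

instance : HopfAlgebra k H.EvenRing where
  antipode := (evenLift H.evenAntipode evenAntipode_odd).toLinearMap
  mul_antipode_rTensor_comul := by
    ext x
    obtain ⟨a, rfl⟩ := evenMk_surjective x
    have h := congrArg (fun f : WithConv (H.Coord →ₗ[k] H.EvenRing) => f a)
      (algHom_antipode_conv H.evenMk)
    have h1 : ∀ x : H.Coord ⊗[k] H.Coord, (LinearMap.rTensor H.EvenRing
        (evenLift H.evenAntipode evenAntipode_odd).toLinearMap)
        (TensorProduct.map H.evenMk.toLinearMap H.evenMk.toLinearMap x) =
        TensorProduct.map (H.evenMk.toLinearMap ∘ₗ H.antipode) H.evenMk.toLinearMap x := by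
      intro x
      induction x with
      | zero => simp
      | add x y hx hy => simp only [map_add, hx, hy]
      | tmul a b => rfl
    simp only [LinearMap.comp_apply, comul_evenMk, h1]
    exact h
  mul_antipode_lTensor_comul := by
    ext x
    obtain ⟨a, rfl⟩ := evenMk_surjective x
    have h := congrArg (fun f : WithConv (H.Coord →ₗ[k] H.EvenRing) => f a)
      (algHom_conv_antipode H.evenMk)
    have h1 : ∀ x : H.Coord ⊗[k] H.Coord, (LinearMap.lTensor H.EvenRing
        (evenLift H.evenAntipode evenAntipode_odd).toLinearMap)
        (TensorProduct.map H.evenMk.toLinearMap H.evenMk.toLinearMap x) =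
        TensorProduct.map H.evenMk.toLinearMap (H.evenMk.toLinearMap ∘ₗ H.antipode) x := by
      intro x
      induction x with
      | zero => simp
      | add x y hx hy => simp only [map_add, hx, hy]
      | tmul a b => rfl
    simp only [LinearMap.comp_apply, comul_evenMk, h1]
    exact h

end Supergroup

/-! ### Powers of the odd ideal `I` and their nilpotency -/

namespace Supergroup

open Coalgebra WithConv

variable (H : Supergroup k)

/-- The powers of the ideal generated by the odd functions. -/
def filt (n : ℕ) : Submodule k H.Coord := ⊤ * H.gr 1 ^ n

variable {H}

theorem mul_mono_right {M P Q : Submodule k H.Coord} (h : P ≤ Q) : M * P ≤ M * Q :=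
  mul_le_mul' le_rfl h

theorem mul_mono_left {M P Q : Submodule k H.Coord} (h : P ≤ Q) : P * M ≤ Q * M :=
  mul_le_mul' h le_rfl

theorem filt_zero : H.filt 0 = ⊤ := by rw [filt, pow_zero, mul_one]

theorem filt_succ (n : ℕ) : H.filt (n + 1) = H.filt n * H.gr 1 := by
  rw [filt, filt, pow_succ, mul_assoc]

theorem top_mul_top : (⊤ : Submodule k H.Coord) * ⊤ = ⊤ :=
  top_le_iff.1 fun x _ => by
    rw [← mul_one x]
    exact Submodule.mul_mem_mul Submodule.mem_top Submodule.mem_top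

/-- Odd elements commute with homogeneous functions up to sign, so factors from `k[H]` can be moved
to the left. All manipulations of powers of `I` rest on this. -/
theorem mul_top_le_of_odd {P : Submodule k H.Coord} (hP : P ≤ H.gr 1) : P * ⊤ ≤ ⊤ * P := by
  rw [Submodule.mul_le]
  intro x hx b _
  refine homogeneous_induction (p := fun b => x * b ∈ ⊤ * P)
    (fun a b ha hb => by rw [mul_add]; exact add_mem ha hb) ?_ b
  intro i b hb
  rcases parity_cases i with rfl | rfl
  · rw [← mul_comm_of_even_left hb]
    exact Submodule.mul_mem_mul Submodule.mem_top hx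
  · rw [mul_anticomm_of_odd (hP hx) hb, ← neg_mul]
    exact Submodule.mul_mem_mul Submodule.mem_top hx

theorem pow_mul_top_le_of_odd {P : Submodule k H.Coord} (hP : P ≤ H.gr 1) (n : ℕ) :
    P ^ n * ⊤ ≤ ⊤ * P ^ n := by
  induction n with
  | zero => simp
  | succ n ih =>
    calc P ^ (n + 1) * ⊤ = P ^ n * (P * ⊤) := by rw [pow_succ, mul_assoc]
      _ ≤ P ^ n * (⊤ * P) := mul_mono_right (mul_top_le_of_odd hP)
      _ = P ^ n * ⊤ * P := (mul_assoc _ _ _).symm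
      _ ≤ ⊤ * P ^ n * P := mul_mono_left ih
      _ = ⊤ * P ^ (n + 1) := by rw [pow_succ, mul_assoc]

theorem filt_mul_filt (m n : ℕ) : H.filt m * H.filt n ≤ H.filt (m + n) := by
  calc ⊤ * H.gr 1 ^ m * (⊤ * H.gr 1 ^ n) = ⊤ * (H.gr 1 ^ m * ⊤) * H.gr 1 ^ n := by
        simp only [mul_assoc]
    _ ≤ ⊤ * (⊤ * H.gr 1 ^ m) * H.gr 1 ^ n :=
        mul_mono_left (mul_mono_right (pow_mul_top_le_of_odd le_rfl m))
    _ = H.filt (m + n) := by rw [← mul_assoc ⊤ ⊤, top_mul_top, mul_assoc, ← pow_add, filt]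

theorem mul_mem_filt {m n : ℕ} {a b : H.Coord} (ha : a ∈ H.filt m) (hb : b ∈ H.filt n) :
    a * b ∈ H.filt (m + n) :=
  filt_mul_filt m n (Submodule.mul_mem_mul ha hb)

theorem mem_filt_zero (a : H.Coord) : a ∈ H.filt 0 := by
  rw [filt_zero]
  exact Submodule.mem_top

theorem filt_mul_left {n : ℕ} (a : H.Coord) {b : H.Coord} (hb : b ∈ H.filt n) :
    a * b ∈ H.filt n := by
  simpa using mul_mem_filt (mem_filt_zero a) hb

theorem filt_mul_right {n : ℕ} {a : H.Coord} (ha : a ∈ H.filt n) (b : H.Coord) :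
    a * b ∈ H.filt n := by
  simpa using mul_mem_filt ha (mem_filt_zero b)

theorem filt_succ_le (n : ℕ) : H.filt (n + 1) ≤ H.filt n := by
  have := filt_mul_filt (H := H) n 1
  rw [filt_succ]
  rw [Submodule.mul_le]
  intro a ha b _
  exact filt_mul_right ha b

theorem filt_antitone {m n : ℕ} (h : m ≤ n) : H.filt n ≤ H.filt m :=
  antitone_nat_of_succ_le filt_succ_le h

theorem odd_mem_filt {a : H.Coord} (ha : a ∈ H.gr 1) : a ∈ H.filt 1 := by
  rw [filt_succ, filt_zero, ← one_mul a]
  exact Submodule.mul_mem_mul Submodule.mem_top ha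

theorem mem_filt_one {a : H.Coord} : a ∈ H.filt 1 ↔ a ∈ H.oddIdeal := by
  constructor
  · intro h
    have : H.filt 1 ≤ H.oddIdeal.restrictScalars k := by
      rw [filt_succ, Submodule.mul_le]
      intro a _ b hb
      exact Ideal.mul_mem_left _ _ (mem_oddIdeal_of_odd hb)
    exact this h
  · intro h
    unfold oddIdeal at h
    induction h using Submodule.span_induction with
    | zero => exact zero_mem _
    | add x y _ _ hx hy => exact add_mem hx hy
    | smul c x _ hx => exact filt_mul_left c hx
    | mem x hx => exact odd_mem_filt hx

theorem mem_filt_one_iff {a : H.Coord} : a ∈ H.filt 1 ↔ H.evenMk a = 0 :=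
  mem_filt_one.trans evenMk_eq_zero.symm

theorem mul_self_span_singleton [CharZero k] {x : H.Coord} (hx : x ∈ H.gr 1) :
    (⊤ * Submodule.span k {x}) * (⊤ * Submodule.span k {x}) = ⊥ := by
  have hP : Submodule.span k {x} ≤ H.gr 1 := by simpa using hx
  rw [eq_bot_iff]
  calc (⊤ * Submodule.span k {x}) * (⊤ * Submodule.span k {x})
      = ⊤ * (Submodule.span k {x} * ⊤) * Submodule.span k {x} := by simp only [mul_assoc]
    _ ≤ ⊤ * (⊤ * Submodule.span k {x}) * Submodule.span k {x} :=
        mul_mono_left (mul_mono_right (mul_top_le_of_odd hP))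
    _ ≤ ⊥ := by
        rw [mul_assoc, mul_assoc, Submodule.span_mul_span]
        simp [mul_self_of_odd hx]

theorem mul_comm_top_mul_span {P Q : Submodule k H.Coord} (hP : P ≤ H.gr 1) (hQ : Q ≤ H.gr 1) :
    (⊤ * P) * (⊤ * Q) ≤ (⊤ * Q) * (⊤ * P) := by
  have h1 : P * Q ≤ Q * P := by
    rw [Submodule.mul_le]
    intro a ha b hb
    rw [mul_anticomm_of_odd (hP ha) (hQ hb)]
    exact neg_mem (Submodule.mul_mem_mul hb ha)
  calc (⊤ * P) * (⊤ * Q) = ⊤ * (P * ⊤) * Q := by simp only [mul_assoc]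
    _ ≤ ⊤ * (⊤ * P) * Q :=
        mul_mono_left (mul_mono_right (mul_top_le_of_odd hP))
    _ = ⊤ * (P * Q) := by rw [← mul_assoc, top_mul_top, mul_assoc]
    _ ≤ ⊤ * (Q * P) := mul_mono_right h1
    _ ≤ (⊤ * Q) * (⊤ * P) := by
        rw [← mul_assoc]
        refine mul_mono_right fun x hx => ?_
        rw [← one_mul x]
        exact Submodule.mul_mem_mul Submodule.mem_top hx

/-- An ideal generated by `n` odd elements has vanishing `(n + 1)`-st power. -/
theorem pow_top_mul_span_eq_bot [CharZero k] (t : Finset H.Coord) (ht : ∀ x ∈ t, x ∈ H.gr 1) :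
    (⊤ * Submodule.span k (t : Set H.Coord)) ^ (t.card + 1) = ⊥ := by
  classical
  induction t using Finset.induction_on with
  | empty => simp
  | insert x t hx ih =>
    have htx : Submodule.span k (t : Set H.Coord) ≤ H.gr 1 :=
      Submodule.span_le.2 fun y hy => ht y (Finset.mem_insert_of_mem hy)
    have hx1 : Submodule.span k {x} ≤ H.gr 1 := by simpa using ht x (Finset.mem_insert_self _ _)
    have ih := ih fun y hy => ht y (Finset.mem_insert_of_mem hy)
    set P := (⊤ : Submodule k H.Coord) * Submodule.span k (t : Set H.Coord)
    set Q := (⊤ : Submodule k H.Coord) * Submodule.span k {x} with hQ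
    have hQQ : Q * Q = ⊥ := mul_self_span_singleton (ht x (Finset.mem_insert_self _ _))
    have hcomm : Commute Q P := le_antisymm (mul_comm_top_mul_span hx1 htx)
      (mul_comm_top_mul_span htx hx1)
    have hsum : (⊤ : Submodule k H.Coord) * Submodule.span k ((insert x t : Finset H.Coord) : Set H.Coord) =
        Q + P := by
      rw [Finset.coe_insert, Submodule.span_insert, Submodule.mul_sup]
      rfl
    rw [hsum, Finset.card_insert_of_notMem hx, hcomm.add_pow]
    -- In a binomial term `Q^i P^(t.card + 2 - i)`, either `i ≥ 2` and `Q * Q = ⊥` applies, or at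
    -- least `t.card + 1` factors `P` remain.
    refine Finset.sum_eq_zero fun i hi => ?_
    rcases Nat.lt_or_ge i 2 with h | h
    · have : t.card + 1 + 1 - i = t.card + 1 + (1 - i) := by omega
      rw [this, pow_add, ih, Submodule.bot_mul, Submodule.mul_bot, ← Submodule.zero_eq_bot,
        zero_mul]
    · obtain ⟨j, rfl⟩ := Nat.exists_eq_add_of_le h
      rw [pow_add, pow_two, hQQ, Submodule.bot_mul, Submodule.bot_mul, ← Submodule.zero_eq_bot,
        zero_mul]

/-- The exponent `0` is excluded because the zeroth power of a submodule is `k · 1`, whereas `H.filt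
0` is everything. -/
theorem filt_le_pow {n : ℕ} {P : Submodule k H.Coord} (h : H.gr 1 ≤ ⊤ * P) (hn : n ≠ 0) :
    H.filt n ≤ (⊤ * P) ^ n := by
  obtain ⟨m, rfl⟩ := Nat.exists_eq_succ_of_ne_zero hn
  have h1 : ⊤ * H.gr 1 ≤ ⊤ * P := by
    calc ⊤ * H.gr 1 ≤ ⊤ * (⊤ * P) := mul_mono_right h
      _ = ⊤ * P := by rw [← mul_assoc, top_mul_top]
  rw [filt, pow_succ', pow_succ', ← mul_assoc]
  exact mul_le_mul' h1 (pow_le_pow_left' h m)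

theorem pr_one_mul (a b : H.Coord) :
    H.pr 1 (a * b) = H.pr 0 a * H.pr 1 b + H.pr 1 a * H.pr 0 b := by
  have h00 : H.pr 0 a * H.pr 0 b ∈ H.gr 0 := mul_mem (pr_mem 0 a) (pr_mem 0 b)
  have h01 : H.pr 0 a * H.pr 1 b ∈ H.gr 1 := mul_mem (pr_mem 0 a) (pr_mem 1 b)
  have h10 : H.pr 1 a * H.pr 0 b ∈ H.gr 1 := mul_mem (pr_mem 1 a) (pr_mem 0 b)
  have h11 : H.pr 1 a * H.pr 1 b ∈ H.gr 0 := mul_mem (pr_mem 1 a) (pr_mem 1 b)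
  conv_lhs => rw [← pr_add_pr a, ← pr_add_pr b, add_mul, mul_add, mul_add]
  rw [map_add, map_add, map_add, pr_one_of_even h00, pr_of_mem h01, pr_of_mem h10,
    pr_one_of_even h11, zero_add, add_zero]

theorem pr_zero_mul (a b : H.Coord) :
    H.pr 0 (a * b) = H.pr 0 a * H.pr 0 b + H.pr 1 a * H.pr 1 b := by
  have h00 : H.pr 0 a * H.pr 0 b ∈ H.gr 0 := mul_mem (pr_mem 0 a) (pr_mem 0 b)
  have h01 : H.pr 0 a * H.pr 1 b ∈ H.gr 1 := mul_mem (pr_mem 0 a) (pr_mem 1 b)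
  have h10 : H.pr 1 a * H.pr 0 b ∈ H.gr 1 := mul_mem (pr_mem 1 a) (pr_mem 0 b)
  have h11 : H.pr 1 a * H.pr 1 b ∈ H.gr 0 := mul_mem (pr_mem 1 a) (pr_mem 1 b)
  conv_lhs => rw [← pr_add_pr a, ← pr_add_pr b, add_mul, mul_add, mul_add]
  rw [map_add, map_add, map_add, pr_of_mem h00, pr_zero_of_odd h01, pr_zero_of_odd h10,
    pr_of_mem h11, zero_add, add_zero]

/-- By the product rule for `pr 1`, the odd parts of finitely many algebra generators generate all
odd functions as an ideal. Finitely many odd elements generate a nilpotent ideal. -/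
theorem exists_filt_eq_bot [CharZero k] (H : Supergroup k) : ∃ n, H.filt n = ⊥ := by
  classical
  obtain ⟨s, hs⟩ := H.finiteType.out
  let t : Finset H.Coord := s.image (H.pr 1)
  have ht : ∀ x ∈ t, x ∈ H.gr 1 := by
    intro x hx
    obtain ⟨y, _, rfl⟩ := Finset.mem_image.1 hx
    exact pr_mem 1 y
  have hspan : Submodule.span k (t : Set H.Coord) ≤ H.gr 1 := Submodule.span_le.2 ht
  have hl : ∀ (a : H.Coord), ∀ b ∈ ⊤ * Submodule.span k (t : Set H.Coord),
      a * b ∈ ⊤ * Submodule.span k (t : Set H.Coord) := by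
    intro a b hb
    have := Submodule.mul_mem_mul (Submodule.mem_top (x := a)) hb
    rwa [← mul_assoc, top_mul_top] at this
  have hr : ∀ (a : H.Coord), ∀ b ∈ ⊤ * Submodule.span k (t : Set H.Coord),
      b * a ∈ ⊤ * Submodule.span k (t : Set H.Coord) := by
    intro a b hb
    have := Submodule.mul_mem_mul hb (Submodule.mem_top (x := a))
    rw [mul_assoc] at this
    have h2 := mul_mono_right (M := ⊤) (mul_top_le_of_odd hspan) this
    rwa [← mul_assoc, top_mul_top] at h2
  have key : ∀ a : H.Coord, H.pr 1 a ∈ ⊤ * Submodule.span k (t : Set H.Coord) := by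
    intro a
    have ha : a ∈ Algebra.adjoin k (s : Set H.Coord) := hs ▸ Algebra.mem_top
    induction ha using Algebra.adjoin_induction with
    | mem x hx =>
      rw [← one_mul (H.pr 1 x)]
      exact Submodule.mul_mem_mul Submodule.mem_top
        (Submodule.subset_span (Finset.mem_coe.2 (Finset.mem_image_of_mem _ hx)))
    | algebraMap r =>
      rw [Algebra.algebraMap_eq_smul_one, map_smul, pr_one_of_even one_mem, smul_zero]
      exact zero_mem _
    | add x y _ _ hx hy => rw [map_add]; exact add_mem hx hy
    | mul x y _ _ hx hy =>
      rw [pr_one_mul]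
      exact add_mem (hl _ _ hy) (hr _ _ hx)
  refine ⟨t.card + 1, eq_bot_iff.2 ((filt_le_pow (P := Submodule.span k (t : Set H.Coord))
    (fun a ha => ?_) (Nat.succ_ne_zero _)).trans (pow_top_mul_span_eq_bot t ht).le)⟩
  simpa [pr_of_mem ha] using key a

end Supergroup

/-! ### Invariant odd forms modulo `I²` -/

namespace Supergroup

open Coalgebra WithConv

variable (H : Supergroup k)

/-- The odd part of the Lie superalgebra. -/
def oddLie : Submodule k (Module.Dual k H.Coord) := H.lie ⊓ H.oddDual

/-- `x ↦ S(x₁) x₂` with `x₁` even and `x₂` odd: the left invariant odd forms. -/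
def leftForm : H.Coord →ₗ[k] H.Coord :=
  LinearMap.mul' k H.Coord ∘ₗ TensorProduct.map (H.antipode ∘ₗ H.pr 0) (H.pr 1) ∘ₗ comul

/-- `x ↦ x₁ S(x₂)` with `x₁` odd and `x₂` even: the right invariant odd forms. -/
def rightForm : H.Coord →ₗ[k] H.Coord :=
  LinearMap.mul' k H.Coord ∘ₗ TensorProduct.map (H.pr 1) (H.antipode ∘ₗ H.pr 0) ∘ₗ comul

variable {H}

theorem oddLie_even {y : Module.Dual k H.Coord} (hy : y ∈ H.oddLie) {a : H.Coord}
    (ha : a ∈ H.gr 0) : y a = 0 :=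
  (Submodule.mem_dualAnnihilator y).1 hy.2 a ha

theorem oddLie_pr_one {y : Module.Dual k H.Coord} (hy : y ∈ H.oddLie) (a : H.Coord) :
    y (H.pr 1 a) = y a := by
  conv_rhs => rw [← pr_add_pr a, map_add, oddLie_even hy (pr_mem 0 a), zero_add]

theorem oddLie_mul {y : Module.Dual k H.Coord} (hy : y ∈ H.oddLie) (a b : H.Coord) :
    y (a * b) = y a * counit (R := k) b + counit (R := k) a * y b :=
  hy.1 a b

theorem oddLie_one {y : Module.Dual k H.Coord} (hy : y ∈ H.oddLie) : y 1 = 0 :=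
  oddLie_even hy one_mem

theorem antipode_pr_mem (i : ZMod 2) (a : H.Coord) : H.antipode (H.pr i a) ∈ H.gr i :=
  H.antipode_mem i _ (pr_mem i a)

theorem mul'_map_mem {f g : H.Coord →ₗ[k] H.Coord} {M N : Submodule k H.Coord}
    (hf : ∀ x, f x ∈ M) (hg : ∀ x, g x ∈ N) (x : H.Coord ⊗[k] H.Coord) :
    LinearMap.mul' k H.Coord (TensorProduct.map f g x) ∈ M * N := by
  induction x with
  | zero => simp
  | add x y hx hy => rw [map_add, map_add]; exact add_mem hx hy
  | tmul a b =>
    rw [TensorProduct.map_tmul, LinearMap.mul'_apply]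
    exact Submodule.mul_mem_mul (hf a) (hg b)

theorem gr_zero_mul_gr_one : H.gr 0 * H.gr 1 ≤ H.gr 1 := by
  rw [Submodule.mul_le]
  intro a ha b hb
  exact mul_mem ha hb

theorem gr_one_mul_gr_zero : H.gr 1 * H.gr 0 ≤ H.gr 1 := by
  rw [Submodule.mul_le]
  intro a ha b hb
  exact mul_mem ha hb

theorem leftForm_mem (x : H.Coord) : H.leftForm x ∈ H.gr 1 :=
  gr_zero_mul_gr_one (mul'_map_mem (antipode_pr_mem 0) (pr_mem 1) _)

theorem rightForm_mem (x : H.Coord) : H.rightForm x ∈ H.gr 1 :=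
  gr_one_mul_gr_zero (mul'_map_mem (pr_mem 1) (antipode_pr_mem 0) _)

theorem leftForm_even {x : H.Coord} (hx : x ∈ H.gr 0) : H.leftForm x = 0 := by
  refine tensorGr_induction (p := fun x => LinearMap.mul' k H.Coord
    (TensorProduct.map (H.antipode ∘ₗ H.pr 0) (H.pr 1) x) = 0)
    (fun x y hx hy => by rw [map_add, map_add, hx, hy, add_zero]) ?_ _ (H.comul_mem 0 x hx)
  intro j a ha b hb
  rcases parity_cases j with rfl | rfl
  · simp [pr_one_of_even (a := b) (by simpa using hb)]
  · simp [pr_zero_of_odd ha]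

theorem rightForm_even {x : H.Coord} (hx : x ∈ H.gr 0) : H.rightForm x = 0 := by
  refine tensorGr_induction (p := fun x => LinearMap.mul' k H.Coord
    (TensorProduct.map (H.pr 1) (H.antipode ∘ₗ H.pr 0) x) = 0)
    (fun x y hx hy => by rw [map_add, map_add, hx, hy, add_zero]) ?_ _ (H.comul_mem 0 x hx)
  intro j a ha b hb
  rcases parity_cases j with rfl | rfl
  · simp [pr_one_of_even ha]
  · have hb' : b ∈ H.gr 1 := by
      have : (0 : ZMod 2) - 1 = 1 := by decide
      rwa [this] at hb
    simp [pr_zero_of_odd hb']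

theorem antipode_comp_pr_zero : H.antipode ∘ₗ H.pr 0 = H.antipode - H.antipode ∘ₗ H.pr 1 := by
  ext x
  rw [LinearMap.sub_apply, LinearMap.comp_apply, LinearMap.comp_apply, ← map_sub]
  congr 1
  rw [eq_sub_iff_add_eq, pr_add_pr]

theorem top_mul_filt_le (n : ℕ) : ⊤ * H.filt n ≤ H.filt n := by
  rw [Submodule.mul_le]
  intro a _ b hb
  exact filt_mul_left a hb

theorem filt_mul_top_le (n : ℕ) : H.filt n * ⊤ ≤ H.filt n := by
  rw [Submodule.mul_le]
  intro a ha b _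
  exact filt_mul_right ha b

theorem gr_one_mul_gr_one_le : H.gr 1 * H.gr 1 ≤ H.filt 2 := by
  rw [filt_succ]
  exact mul_mono_left fun a ha => odd_mem_filt ha

/-- Modulo `I²`, every odd function is a combination `x₁ λ(x₂)` of left invariant forms. -/
theorem id_conv_leftForm (x : H.Coord) :
    LinearMap.mul' k H.Coord (TensorProduct.map LinearMap.id H.leftForm (comul x)) - H.pr 1 x ∈
      H.filt 2 := by
  have h1 : toConv H.leftForm = toConv (H.antipode ∘ₗ H.pr 0) * toConv (H.pr 1) := rfl
  -- Substitute `S ∘ pr₀ = S - S ∘ pr₁`. The first summand cancels against the identity under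
  -- convolution, and the second contributes products of two odd functions.
  have h2 : toConv LinearMap.id * toConv H.leftForm = toConv (H.pr 1) -
      toConv LinearMap.id * (toConv (H.antipode ∘ₗ H.pr 1) * toConv (H.pr 1)) := by
    rw [h1, antipode_comp_pr_zero, toConv_sub, sub_mul, mul_sub, ← mul_assoc, id_conv_antipode,
      one_mul]
  have h3 := congrArg (fun f : WithConv (H.Coord →ₗ[k] H.Coord) => f x) h2
  change LinearMap.mul' k H.Coord (TensorProduct.map LinearMap.id H.leftForm (comul x)) =
    H.pr 1 x - LinearMap.mul' k H.Coord (TensorProduct.map LinearMap.id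
      (LinearMap.mul' k H.Coord ∘ₗ TensorProduct.map (H.antipode ∘ₗ H.pr 1) (H.pr 1) ∘ₗ comul)
      (comul x)) at h3
  rw [h3, sub_sub_cancel_left]
  refine neg_mem (top_mul_filt_le 2 (mul'_map_mem (fun _ => Submodule.mem_top) (fun z => ?_) _))
  exact gr_one_mul_gr_one_le (mul'_map_mem (antipode_pr_mem 1) (pr_mem 1) _)

theorem rightForm_conv_id (x : H.Coord) :
    LinearMap.mul' k H.Coord (TensorProduct.map H.rightForm LinearMap.id (comul x)) - H.pr 1 x ∈
      H.filt 2 := by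
  have h1 : toConv H.rightForm = toConv (H.pr 1) * toConv (H.antipode ∘ₗ H.pr 0) := rfl
  have h2 : toConv H.rightForm * toConv LinearMap.id = toConv (H.pr 1) -
      (toConv (H.pr 1) * toConv (H.antipode ∘ₗ H.pr 1)) * toConv LinearMap.id := by
    rw [h1, antipode_comp_pr_zero, toConv_sub, mul_sub, sub_mul, mul_assoc, antipode_conv_id,
      mul_one]
  have h3 := congrArg (fun f : WithConv (H.Coord →ₗ[k] H.Coord) => f x) h2
  change LinearMap.mul' k H.Coord (TensorProduct.map H.rightForm LinearMap.id (comul x)) =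
    H.pr 1 x - LinearMap.mul' k H.Coord (TensorProduct.map
      (LinearMap.mul' k H.Coord ∘ₗ TensorProduct.map (H.pr 1) (H.antipode ∘ₗ H.pr 1) ∘ₗ comul)
      LinearMap.id (comul x)) at h3
  rw [h3, sub_sub_cancel_left]
  refine neg_mem (filt_mul_top_le 2 (mul'_map_mem (fun z => ?_) (fun _ => Submodule.mem_top) _))
  exact gr_one_mul_gr_one_le (mul'_map_mem (pr_mem 1) (antipode_pr_mem 1) _)

/-- Multiplicativity of the antipode modulo `I` is enough below, where the remaining factor is odd
and errors in `I²` are discarded. -/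
theorem antipode_mul_sub_mem (p r : H.Coord) :
    H.antipode (p * r) - H.antipode p * H.antipode r ∈ H.filt 1 := by
  rw [mem_filt_one_iff, map_sub, map_mul H.evenMk, sub_eq_zero]
  exact algHom_antipode_mul H.evenMk evenMk_odd p r

/-- The invariant forms are derivations modulo `I²`. -/
theorem form_mul_mem (p q r s : H.Coord) :
    H.antipode (H.pr 0 (p * r)) * H.pr 1 (q * s) -
      ((H.antipode (H.pr 0 p) * H.pr 0 q) * (H.antipode (H.pr 0 r) * H.pr 1 s) +
        (H.antipode (H.pr 0 p) * H.pr 1 q) * (H.antipode (H.pr 0 r) * H.pr 0 s)) ∈ H.filt 2 := by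
  have e : (H.antipode (H.pr 0 p) * H.pr 0 q) * (H.antipode (H.pr 0 r) * H.pr 1 s) +
        (H.antipode (H.pr 0 p) * H.pr 1 q) * (H.antipode (H.pr 0 r) * H.pr 0 s) =
      (H.antipode (H.pr 0 p) * H.antipode (H.pr 0 r)) * H.pr 1 (q * s) := by
    rw [pr_one_mul, mul_add]
    have hc := fun x => mul_comm_of_even_left (antipode_pr_mem 0 r) x
    congr 1
    · rw [mul_assoc, mul_assoc, ← mul_assoc (H.pr 0 q), ← hc (H.pr 0 q), mul_assoc]
    · rw [mul_assoc, mul_assoc, ← mul_assoc (H.pr 1 q), ← hc (H.pr 1 q), mul_assoc]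
  rw [e, ← sub_mul]
  refine mul_mem_filt (m := 1) (n := 1) ?_ (odd_mem_filt (pr_mem 1 _))
  have hodd : ∀ a ∈ H.gr 1, ∀ b ∈ H.gr 1, H.antipode (a * b) ∈ H.filt 1 := by
    intro a ha b hb
    have h := antipode_mul_sub_mem a b
    have h2 : H.antipode a * H.antipode b ∈ H.filt 1 :=
      filt_mul_right (odd_mem_filt (H.antipode_mem 1 a ha)) _
    simpa using add_mem h h2
  rw [pr_zero_mul, map_add, add_sub_right_comm]
  exact add_mem (antipode_mul_sub_mem _ _) (hodd _ (pr_mem 1 p) _ (pr_mem 1 r))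

/-- For odd `r` the even part of `p * r` is a product of two odd functions, so its antipode is
already in `I`. This makes the terms with a Koszul sign negligible. -/
theorem form_mul_odd {p q r s : H.Coord} (hr : r ∈ H.gr 1) :
    H.antipode (H.pr 0 (p * r)) * H.pr 1 (q * s) ∈ H.filt 2 := by
  refine mul_mem_filt (m := 1) (n := 1) ?_ (odd_mem_filt (pr_mem 1 _))
  rw [pr_zero_mul, pr_zero_of_odd hr, mul_zero, zero_add]
  have h := antipode_mul_sub_mem (H.pr 1 p) (H.pr 1 r)
  have h2 : H.antipode (H.pr 1 p) * H.antipode (H.pr 1 r) ∈ H.filt 1 :=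
    filt_mul_right (odd_mem_filt (antipode_pr_mem 1 p)) _
  simpa using add_mem h h2

/-- The product rule `form_mul_mem`, extended to tensors so that it can be applied to `Δ(a)` and
`Δ(b)`. If the two middle factors are both odd, the terms of the product rule vanish and the signed
left-hand term lies in `I²` by itself. -/
theorem leftForm_star_mem (x y : H.Coord ⊗[k] H.Coord) :
    LinearMap.mul' k H.Coord (TensorProduct.map (H.antipode ∘ₗ H.pr 0) (H.pr 1) (H.star x y)) -
      (LinearMap.mul' k H.Coord (TensorProduct.map (H.antipode ∘ₗ H.pr 0) (H.pr 0) x) *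
        LinearMap.mul' k H.Coord (TensorProduct.map (H.antipode ∘ₗ H.pr 0) (H.pr 1) y) +
      LinearMap.mul' k H.Coord (TensorProduct.map (H.antipode ∘ₗ H.pr 0) (H.pr 1) x) *
        LinearMap.mul' k H.Coord (TensorProduct.map (H.antipode ∘ₗ H.pr 0) (H.pr 0) y)) ∈
      H.filt 2 := by
  set Ψ := LinearMap.mul' k H.Coord ∘ₗ TensorProduct.map (H.antipode ∘ₗ H.pr 0) (H.pr 1) with hΨ
  set K := LinearMap.mul' k H.Coord ∘ₗ TensorProduct.map (H.antipode ∘ₗ H.pr 0) (H.pr 0) with hK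
  change Ψ (H.star x y) - (K x * Ψ y + Ψ x * K y) ∈ H.filt 2
  refine tensor_induction (p := fun x => Ψ (H.star x y) - (K x * Ψ y + Ψ x * K y) ∈ H.filt 2)
    (fun x x' hx hx' => ?_) ?_ x
  · have e : Ψ (H.star (x + x') y) - (K (x + x') * Ψ y + Ψ (x + x') * K y) =
        (Ψ (H.star x y) - (K x * Ψ y + Ψ x * K y)) +
          (Ψ (H.star x' y) - (K x' * Ψ y + Ψ x' * K y)) := by
      rw [add_star, map_add, map_add, map_add, add_mul, add_mul]
      abel
    rw [e]
    exact add_mem hx hx'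
  intro i j p hp q hq
  refine tensor_induction (p := fun y => Ψ (H.star (p ⊗ₜ q) y) -
    (K (p ⊗ₜ q) * Ψ y + Ψ (p ⊗ₜ q) * K y) ∈ H.filt 2) (fun y y' hy hy' => ?_) ?_ y
  · have e : Ψ (H.star (p ⊗ₜ q) (y + y')) - (K (p ⊗ₜ q) * Ψ (y + y') + Ψ (p ⊗ₜ q) * K (y + y')) =
        (Ψ (H.star (p ⊗ₜ q) y) - (K (p ⊗ₜ q) * Ψ y + Ψ (p ⊗ₜ q) * K y)) +
          (Ψ (H.star (p ⊗ₜ q) y') - (K (p ⊗ₜ q) * Ψ y' + Ψ (p ⊗ₜ q) * K y')) := by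
      rw [star_add, map_add, map_add, map_add, mul_add, mul_add]
      abel
    rw [e]
    exact add_mem hy hy'
  intro i' j' r hr s hs
  rcases parity_cases i' with rfl | rfl
  · rw [star_tmul_even_right p q hr]
    simpa [Ψ, K] using form_mul_mem p q r s
  · rcases parity_cases j with rfl | rfl
    · rw [star_tmul_even_left p r hq]
      simpa [Ψ, K] using form_mul_mem p q r s
    · rw [star_tmul_odd p hq hr]
      have h0 : H.pr 0 r = 0 := pr_zero_of_odd hr
      have := form_mul_odd (p := p) (q := q) (s := s) hr
      simpa [Ψ, K, h0] using this

theorem rightForm_star_mem (x y : H.Coord ⊗[k] H.Coord) :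
    LinearMap.mul' k H.Coord (TensorProduct.map (H.pr 1) (H.antipode ∘ₗ H.pr 0) (H.star x y)) -
      (LinearMap.mul' k H.Coord (TensorProduct.map (H.pr 0) (H.antipode ∘ₗ H.pr 0) x) *
        LinearMap.mul' k H.Coord (TensorProduct.map (H.pr 1) (H.antipode ∘ₗ H.pr 0) y) +
      LinearMap.mul' k H.Coord (TensorProduct.map (H.pr 1) (H.antipode ∘ₗ H.pr 0) x) *
        LinearMap.mul' k H.Coord (TensorProduct.map (H.pr 0) (H.antipode ∘ₗ H.pr 0) y)) ∈
      H.filt 2 := by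
  set Ψ := LinearMap.mul' k H.Coord ∘ₗ TensorProduct.map (H.pr 1) (H.antipode ∘ₗ H.pr 0) with hΨ
  set K := LinearMap.mul' k H.Coord ∘ₗ TensorProduct.map (H.pr 0) (H.antipode ∘ₗ H.pr 0) with hK
  change Ψ (H.star x y) - (K x * Ψ y + Ψ x * K y) ∈ H.filt 2
  refine tensor_induction (p := fun x => Ψ (H.star x y) - (K x * Ψ y + Ψ x * K y) ∈ H.filt 2)
    (fun x x' hx hx' => ?_) ?_ x
  · have e : Ψ (H.star (x + x') y) - (K (x + x') * Ψ y + Ψ (x + x') * K y) =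
        (Ψ (H.star x y) - (K x * Ψ y + Ψ x * K y)) +
          (Ψ (H.star x' y) - (K x' * Ψ y + Ψ x' * K y)) := by
      rw [add_star, map_add, map_add, map_add, add_mul, add_mul]
      abel
    rw [e]
    exact add_mem hx hx'
  intro i j p hp q hq
  refine tensor_induction (p := fun y => Ψ (H.star (p ⊗ₜ q) y) -
    (K (p ⊗ₜ q) * Ψ y + Ψ (p ⊗ₜ q) * K y) ∈ H.filt 2) (fun y y' hy hy' => ?_) ?_ y
  · have e : Ψ (H.star (p ⊗ₜ q) (y + y')) - (K (p ⊗ₜ q) * Ψ (y + y') + Ψ (p ⊗ₜ q) * K (y + y')) =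
        (Ψ (H.star (p ⊗ₜ q) y) - (K (p ⊗ₜ q) * Ψ y + Ψ (p ⊗ₜ q) * K y)) +
          (Ψ (H.star (p ⊗ₜ q) y') - (K (p ⊗ₜ q) * Ψ y' + Ψ (p ⊗ₜ q) * K y')) := by
      rw [star_add, map_add, map_add, map_add, mul_add, mul_add]
      abel
    rw [e]
    exact add_mem hy hy'
  intro i' j' r hr s hs
  have hΨt : ∀ a b, Ψ (a ⊗ₜ b) = H.antipode (H.pr 0 b) * H.pr 1 a := fun a b =>
    (mul_comm_of_even_left (antipode_pr_mem 0 b) _).symm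
  have hKt : ∀ a b, K (a ⊗ₜ b) = H.antipode (H.pr 0 b) * H.pr 0 a := fun a b =>
    (mul_comm_of_even_left (antipode_pr_mem 0 b) _).symm
  rcases parity_cases i' with rfl | rfl
  · rw [star_tmul_even_right p q hr]
    simpa only [hΨt, hKt] using form_mul_mem q p s r
  · rcases parity_cases j with rfl | rfl
    · rw [star_tmul_even_left p r hq]
      simpa only [hΨt, hKt] using form_mul_mem q p s r
    · rw [star_tmul_odd p hq hr, map_neg]
      have h1 : Ψ ((p * r) ⊗ₜ (q * s)) ∈ H.filt 2 := by
        rw [hΨt]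
        refine mul_mem_filt (m := 1) (n := 1) ?_ (odd_mem_filt (pr_mem 1 _))
        rw [pr_zero_mul, pr_zero_of_odd hq, zero_mul, zero_add]
        have h := antipode_mul_sub_mem (H.pr 1 q) (H.pr 1 s)
        have h2 : H.antipode (H.pr 1 q) * H.antipode (H.pr 1 s) ∈ H.filt 1 :=
          filt_mul_right (odd_mem_filt (antipode_pr_mem 1 q)) _
        simpa using add_mem h h2
      have h0 : H.pr 0 q = 0 := pr_zero_of_odd hq
      rw [hΨt p q, hKt p q, h0]
      simpa using h1

end Supergroup

/-! ### Cotangent vectors at the identity and invariant frames -/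

namespace Supergroup

open Coalgebra WithConv

set_option maxSynthPendingDepth 3

variable {H : Supergroup k}

theorem evenMk_antipode_pr_zero :
    H.evenMk.toLinearMap ∘ₗ H.antipode ∘ₗ H.pr 0 = H.evenMk.toLinearMap ∘ₗ H.antipode := by
  ext x
  simp only [LinearMap.comp_apply, AlgHom.toLinearMap_apply]
  conv_rhs => rw [← pr_add_pr x, map_add, map_add, evenMk_odd _ (antipode_pr_mem 1 x), add_zero]

theorem evenMk_comp_pr_zero : H.evenMk.toLinearMap ∘ₗ H.pr 0 = H.evenMk.toLinearMap :=
  LinearMap.ext evenMk_pr_zero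

theorem evenMk_mul'_map (f g : H.Coord →ₗ[k] H.Coord) (x : H.Coord ⊗[k] H.Coord) :
    H.evenMk (LinearMap.mul' k H.Coord (TensorProduct.map f g x)) =
      LinearMap.mul' k H.EvenRing (TensorProduct.map (H.evenMk.toLinearMap ∘ₗ f)
        (H.evenMk.toLinearMap ∘ₗ g) x) := by
  induction x with
  | zero => simp
  | add x y hx hy => simp only [map_add, hx, hy]
  | tmul a b => simp

/-- In the product rule the form of the even function `b` is zero, and `S(b₁) b₂ ≡ ε(b)` modulo `I`.
Thus modulo `I²` the form depends only on the odd cotangent vector at the identity. -/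
theorem leftForm_mul_even {b : H.Coord} (hb : b ∈ H.gr 0) (x : H.Coord) :
    H.leftForm (b * x) - counit (R := k) b • H.leftForm x ∈ H.filt 2 := by
  have h := leftForm_star_mem (H := H) (comul b) (comul x)
  rw [← comul_mul_eq_star] at h
  set K := LinearMap.mul' k H.Coord (TensorProduct.map (H.antipode ∘ₗ H.pr 0) (H.pr 0) (comul b))
  have h0 : LinearMap.mul' k H.Coord
      (TensorProduct.map (H.antipode ∘ₗ H.pr 0) (H.pr 1) (comul b)) = 0 := leftForm_even hb
  rw [h0, zero_mul, add_zero] at h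
  have h1 : K - algebraMap k _ (counit b) ∈ H.filt 1 := by
    rw [mem_filt_one_iff, map_sub, evenMk_mul'_map, evenMk_antipode_pr_zero, evenMk_comp_pr_zero,
      sub_eq_zero]
    exact (congrArg (fun f : WithConv (H.Coord →ₗ[k] H.EvenRing) => f b)
      (algHom_antipode_conv H.evenMk)).trans (H.evenMk.commutes _).symm
  have h2 := mul_mem_filt h1 (odd_mem_filt (leftForm_mem x))
  rw [sub_mul, ← Algebra.smul_def] at h2
  have h3 := add_mem h h2
  change H.leftForm (b * x) - K * H.leftForm x +
    (K * H.leftForm x - counit (R := k) b • H.leftForm x) ∈ _ at h3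
  rwa [sub_add_sub_cancel] at h3

theorem rightForm_mul_even {b : H.Coord} (hb : b ∈ H.gr 0) (x : H.Coord) :
    H.rightForm (b * x) - counit (R := k) b • H.rightForm x ∈ H.filt 2 := by
  have h := rightForm_star_mem (H := H) (comul b) (comul x)
  rw [← comul_mul_eq_star] at h
  set K := LinearMap.mul' k H.Coord (TensorProduct.map (H.pr 0) (H.antipode ∘ₗ H.pr 0) (comul b))
  have h0 : LinearMap.mul' k H.Coord
      (TensorProduct.map (H.pr 1) (H.antipode ∘ₗ H.pr 0) (comul b)) = 0 := rightForm_even hb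
  rw [h0, zero_mul, add_zero] at h
  have h1 : K - algebraMap k _ (counit b) ∈ H.filt 1 := by
    rw [mem_filt_one_iff, map_sub, evenMk_mul'_map, evenMk_antipode_pr_zero, evenMk_comp_pr_zero,
      sub_eq_zero]
    exact (congrArg (fun f : WithConv (H.Coord →ₗ[k] H.EvenRing) => f b)
      (algHom_conv_antipode H.evenMk)).trans (H.evenMk.commutes _).symm
  have h2 := mul_mem_filt h1 (odd_mem_filt (rightForm_mem x))
  rw [sub_mul, ← Algebra.smul_def] at h2
  have h3 := add_mem h h2
  change H.rightForm (b * x) - K * H.rightForm x +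
    (K * H.rightForm x - counit (R := k) b • H.rightForm x) ∈ _ at h3
  rwa [sub_add_sub_cancel] at h3

/-- Odd functions on which `𝔥₁` vanishes lie in the product of the augmentation ideal of `k[H]₀`
and `k[H]₁`. -/
theorem mem_of_oddLie_eq_zero {F : H.Coord →ₗ[k] H.Coord} {P : Submodule k H.Coord}
    (hF0 : ∀ b ∈ H.gr 0, F b = 0)
    (hF : ∀ b ∈ H.gr 0, ∀ x, F (b * x) - counit (R := k) b • F x ∈ P)
    {x : H.Coord} (hx : ∀ y ∈ H.oddLie, y x = 0) : F x ∈ P := by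
  by_contra hcon
  -- A functional that vanishes on `P` but not at `F x`. The assumptions on `F` make `u ∘ₗ F` an odd
  -- point derivation at the identity, so it must vanish at `x`.
  obtain ⟨u, hu, huP⟩ := Submodule.exists_le_ker_of_notMem hcon
  refine hu ?_
  have hmem : u ∘ₗ F ∈ H.oddLie := by
    refine ⟨fun a b => ?_, (Submodule.mem_dualAnnihilator _).2 fun b hb => ?_⟩
    · have key : ∀ p ∈ H.gr 0, ∀ q, u (F (p * q)) = counit (R := k) p * u (F q) := by
        intro p hp q
        have := huP (hF p hp q)
        rw [LinearMap.mem_ker, map_sub, sub_eq_zero, map_smul] at this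
        exact this
      have hpr : ∀ a, u (F a) = u (F (H.pr 1 a)) := by
        intro a
        conv_lhs => rw [← pr_add_pr a, map_add, hF0 _ (pr_mem 0 a), zero_add]
      simp only [LinearMap.comp_apply]
      rw [hpr (a * b), pr_one_mul, ← mul_comm_of_even_left (pr_mem 0 b), map_add, map_add,
        key _ (pr_mem 0 a), key _ (pr_mem 0 b), counit_pr_zero, counit_pr_zero, ← hpr, ← hpr]
      ring
    · rw [LinearMap.comp_apply, hF0 b hb, map_zero]
  exact hx _ hmem

/-- A point derivation is determined by its values on a finite set of algebra generators. -/
instance : FiniteDimensional k H.oddLie := by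
  obtain ⟨s, hs⟩ := H.finiteType.out
  let r : H.oddLie →ₗ[k] (s → k) :=
    LinearMap.pi fun x => (LinearMap.applyₗ (R := k) (x : H.Coord)) ∘ₗ H.oddLie.subtype
  refine FiniteDimensional.of_injective r ((injective_iff_map_eq_zero r).2 ?_)
  rintro ⟨y, hy⟩ h0
  have key : ∀ a, y a = 0 := by
    intro a
    have ha : a ∈ Algebra.adjoin k (s : Set H.Coord) := hs ▸ Algebra.mem_top
    induction ha using Algebra.adjoin_induction with
    | mem x hx => exact congrFun h0 ⟨x, hx⟩
    | algebraMap c =>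
      rw [Algebra.algebraMap_eq_smul_one, map_smul, oddLie_one hy, smul_zero]
    | add a b _ _ ha hb => rw [map_add, ha, hb, add_zero]
    | mul a b _ _ ha hb => rw [oddLie_mul hy, ha, hb, zero_mul, mul_zero, add_zero]
  exact Subtype.ext (LinearMap.ext key)

variable (H) in
/-- The dimension of `𝔥₁`. -/
def oddRank : ℕ := Module.finrank k H.oddLie

variable (H) in
/-- A basis of `𝔥₁`. -/
def oddBasis : Module.Basis (Fin H.oddRank) k H.oddLie :=
  Module.finBasis k H.oddLie

/-- The members of the chosen basis of `𝔥₁`. -/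
def oddVec (i : Fin H.oddRank) : Module.Dual k H.Coord := (H.oddBasis i : Module.Dual k H.Coord)

theorem oddVec_mem (i : Fin H.oddRank) : oddVec i ∈ H.oddLie := (H.oddBasis i).2

theorem eq_zero_of_oddVec {x : H.Coord} (hx : ∀ i : Fin H.oddRank, oddVec i x = 0) :
    ∀ y ∈ H.oddLie, y x = 0 := by
  intro y hy
  have h := H.oddBasis.sum_repr ⟨y, hy⟩
  have h2 := congrArg (fun z : H.oddLie => (z : Module.Dual k H.Coord) x) h
  simp only [Submodule.coe_sum, Submodule.coe_smul, LinearMap.sum_apply, LinearMap.smul_apply] at h2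
  rw [← h2]
  exact Finset.sum_eq_zero fun i _ => by
    rw [show (H.oddBasis i : Module.Dual k H.Coord) x = 0 from hx i, smul_zero]

/-- Independence makes the joint evaluation `V → k^ι` surjective: a nonzero functional on `k^ι`
killing its range would be a linear relation between the `f i`. -/
theorem exists_dual_family {V ι : Type*} [AddCommGroup V] [Module k V] [Fintype ι] [DecidableEq ι]
    {f : ι → Module.Dual k V} (hf : LinearIndependent k f) :
    ∃ a : ι → V, ∀ i j, f i (a j) = if i = j then 1 else 0 := by
  have hev : LinearMap.range (LinearMap.pi f) = ⊤ := by
    by_contra hne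
    obtain ⟨φ, hφ, hle⟩ := Submodule.exists_le_ker_of_lt_top _ (lt_top_iff_ne_top.2 hne)
    apply hφ
    have hφ' : ∀ w : ι → k, φ w = ∑ i, w i * φ (Pi.single i 1) := by
      intro w
      rw [LinearMap.pi_apply_eq_sum_univ φ w]
      refine Finset.sum_congr rfl fun i _ => ?_
      rw [smul_eq_mul]
      congr 2
      ext j
      simp [Pi.single_apply, eq_comm]
    have hli := Fintype.linearIndependent_iff.1 hf (fun i => φ (Pi.single i 1)) (by
        ext x
        have h : φ (LinearMap.pi f x) = 0 := hle (LinearMap.mem_range_self _ x)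
        rw [hφ'] at h
        rw [LinearMap.sum_apply, LinearMap.zero_apply, ← h]
        exact Finset.sum_congr rfl fun i _ => mul_comm _ _)
    ext w
    simp [hli]
  choose a ha using fun j => LinearMap.range_eq_top.1 hev (Pi.single j 1)
  refine ⟨a, fun i j => ?_⟩
  have := congrFun (ha j) i
  rw [Pi.single_apply] at this
  exact this

theorem linearIndependent_oddVec : LinearIndependent k (oddVec (H := H)) :=
  H.oddBasis.linearIndependent.map' H.oddLie.subtype (Submodule.ker_subtype _)

variable (H) in
theorem exists_oddCoord : ∃ a : Fin H.oddRank → H.Coord,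
    ∀ i j, oddVec i (a j) = if i = j then 1 else 0 :=
  exists_dual_family linearIndependent_oddVec

/-- Functions whose differentials at the identity are dual to the chosen basis of `𝔥₁`. -/
def oddCoord : Fin H.oddRank → H.Coord := (exists_oddCoord H).choose

theorem oddVec_oddCoord (i j : Fin H.oddRank) :
    oddVec i (oddCoord j) = if i = j then 1 else 0 := (exists_oddCoord H).choose_spec i j

/-- The left invariant frame. -/
def leftFrame (i : Fin H.oddRank) : H.Coord := H.leftForm (oddCoord i)

/-- The right invariant frame. -/
def rightFrame (i : Fin H.oddRank) : H.Coord := H.rightForm (oddCoord i)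

theorem leftFrame_mem (i : Fin H.oddRank) : leftFrame i ∈ H.gr 1 := leftForm_mem _

theorem rightFrame_mem (i : Fin H.oddRank) : rightFrame i ∈ H.gr 1 := rightForm_mem _

theorem oddVec_sub_sum (x : H.Coord) (i : Fin H.oddRank) :
    oddVec i (x - ∑ j, oddVec j x • oddCoord j) = 0 := by
  simp [map_sum, oddVec_oddCoord]

/-- The difference between `x` and `∑ yᵢ(x) aᵢ` is killed by `𝔥₁`, so `mem_of_oddLie_eq_zero` places
its form in `I²`. -/
theorem leftForm_sub_sum_mem (x : H.Coord) :
    H.leftForm x - ∑ i, oddVec i x • leftFrame i ∈ H.filt 2 := by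
  have h := mem_of_oddLie_eq_zero (fun b hb => leftForm_even hb)
    (fun b hb x => leftForm_mul_even hb x) (eq_zero_of_oddVec (oddVec_sub_sum x))
  rw [map_sub, map_sum] at h
  simp only [map_smul] at h
  exact h

theorem rightForm_sub_sum_mem (x : H.Coord) :
    H.rightForm x - ∑ i, oddVec i x • rightFrame i ∈ H.filt 2 := by
  have h := mem_of_oddLie_eq_zero (fun b hb => rightForm_even hb)
    (fun b hb x => rightForm_mul_even hb x) (eq_zero_of_oddVec (oddVec_sub_sum x))
  rw [map_sub, map_sum] at h
  simp only [map_smul] at h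
  exact h

/-- Expanding `x₁ λ(x₂)` from `id_conv_leftForm` in the frame gives the first order Taylor formula
for `x` in the odd directions. -/
theorem pr_one_sub_leftFrame_mem (x : H.Coord) :
    H.pr 1 x - ∑ i, H.rightAct (oddVec i) x * leftFrame i ∈ H.filt 2 := by
  have key : ∀ t : H.Coord ⊗[k] H.Coord,
      LinearMap.mul' k H.Coord (TensorProduct.map LinearMap.id H.leftForm t) -
        ∑ i, TensorProduct.rid k H.Coord (LinearMap.lTensor H.Coord (oddVec i) t) * leftFrame i ∈
        H.filt 2 := by
    intro t
    induction t with
    | zero => simp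
    | add s t hs ht =>
      have := add_mem hs ht
      simp only [map_add, add_mul, Finset.sum_add_distrib]
      rwa [add_sub_add_comm]
    | tmul a b =>
      have := filt_mul_left a (leftForm_sub_sum_mem b)
      simpa [mul_sub, Finset.mul_sum] using this
  have h := sub_mem (key (comul x)) (id_conv_leftForm x)
  rw [sub_sub_sub_cancel_left] at h
  exact h

theorem pr_one_sub_rightFrame_mem (x : H.Coord) :
    H.pr 1 x - ∑ i, rightFrame i * H.leftAct (oddVec i) x ∈ H.filt 2 := by
  have key : ∀ t : H.Coord ⊗[k] H.Coord,
      LinearMap.mul' k H.Coord (TensorProduct.map H.rightForm LinearMap.id t) -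
        ∑ i, rightFrame i * TensorProduct.lid k H.Coord (LinearMap.rTensor H.Coord (oddVec i) t) ∈
        H.filt 2 := by
    intro t
    induction t with
    | zero => simp
    | add s t hs ht =>
      have := add_mem hs ht
      simp only [map_add, mul_add, Finset.sum_add_distrib]
      rwa [add_sub_add_comm]
    | tmul a b =>
      have := filt_mul_right (rightForm_sub_sum_mem a) b
      simpa [sub_mul, Finset.sum_mul] using this
  have h := sub_mem (key (comul x)) (rightForm_conv_id x)
  rw [sub_sub_sub_cancel_left] at h
  exact h

/-- By the derivation rule `y(S(x₁) x₂) = ε(x₁) y(x₂)`, since the counit kills the odd factor.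
Consequently the left frame is dual to the chosen basis of `𝔥₁`. -/
theorem oddLie_leftForm {y : Module.Dual k H.Coord} (hy : y ∈ H.oddLie) (x : H.Coord) :
    y (H.leftForm x) = y x := by
  have key : ∀ t : H.Coord ⊗[k] H.Coord,
      y (LinearMap.mul' k H.Coord (TensorProduct.map (H.antipode ∘ₗ H.pr 0) (H.pr 1) t)) =
        y (TensorProduct.lid k H.Coord (LinearMap.rTensor H.Coord (counit (R := k)) t)) := by
    intro t
    induction t with
    | zero => simp
    | add s t hs ht => simp only [map_add, hs, ht]
    | tmul a b =>
      simp [oddLie_mul hy, H.counit_odd _ (pr_mem 1 b), counit_antipode, counit_pr_zero,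
        oddLie_pr_one hy]
  refine (key (comul x)).trans ?_
  rw [rTensor_counit_comul]
  simp

variable (H) in
/-- The coaction of `k[H₀]` on `k[H]` by left translations. -/
def evenCoact : H.Coord →ₐ[k] H.EvenRing ⊗[k] H.Coord :=
  comulHomLeft H.evenMk evenMk_odd (AlgHom.id k H.Coord)

theorem evenCoact_apply (a : H.Coord) :
    H.evenCoact a = LinearMap.rTensor H.Coord H.evenMk.toLinearMap (comul a) := rfl

/-- Left invariant forms are invariant under left translations by `H₀`. -/
theorem evenCoact_leftForm (x : H.Coord) : H.evenCoact (H.leftForm x) = 1 ⊗ₜ H.leftForm x := by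
  let jD : H.Coord →ₗ[k] H.EvenRing ⊗[k] H.Coord :=
    (TensorProduct.mk k H.EvenRing H.Coord).flip 1 ∘ₗ H.evenMk.toLinearMap
  let jA : H.Coord →ₐ[k] H.EvenRing ⊗[k] H.Coord := Algebra.TensorProduct.includeRight
  -- Compatibility of `f` with the coaction `ρ` becomes a factorization `ρ ∘ f = jD * (jA ∘ f)` in
  -- the convolution algebra. It is used for the identity and for `pr 1`.
  have hρ : ∀ f : H.Coord →ₗ[k] H.Coord, (∀ x, LinearMap.rTensor H.Coord H.evenMk.toLinearMap
        (comul (f x)) = TensorProduct.map H.evenMk.toLinearMap f (comul x)) →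
      toConv (H.evenCoact.toLinearMap ∘ₗ f) = toConv jD * toConv (jA.toLinearMap ∘ₗ f) := by
    intro f hf
    ext x
    change H.evenCoact (f x) = LinearMap.mul' k _ (TensorProduct.map jD (jA.toLinearMap ∘ₗ f)
      (comul x))
    rw [evenCoact_apply, hf]
    induction comul (R := k) x with
    | zero => simp
    | add s t hs ht => simp only [map_add, hs, ht]
    | tmul a b => simp [jD, jA]
  have h1 : toConv H.evenCoact.toLinearMap = toConv jD * toConv jA.toLinearMap :=
    hρ LinearMap.id fun x => rfl
  have hodd : ∀ (i : ZMod 2) (x : H.Coord), LinearMap.rTensor H.Coord H.evenMk.toLinearMap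
        (comul (H.pr i x)) = TensorProduct.map H.evenMk.toLinearMap (H.pr i) (comul x) := by
    intro i x
    refine homogeneous_induction (p := fun x => LinearMap.rTensor H.Coord H.evenMk.toLinearMap
        (comul (H.pr i x)) = TensorProduct.map H.evenMk.toLinearMap (H.pr i) (comul x))
      (fun a b ha hb => by simp only [map_add, ha, hb]) ?_ x
    intro j a ha
    refine (tensorGr_induction (p := fun t => TensorProduct.map H.evenMk.toLinearMap (H.pr i) t =
      if i = j then LinearMap.rTensor H.Coord H.evenMk.toLinearMap t else 0)
      (fun s t hs ht => ?_) ?_ _ (H.comul_mem j a ha)).symm ▸ ?_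
    · rw [map_add, map_add, hs, ht]
      split_ifs <;> simp
    · intro l p hp q hq
      rcases parity_cases l with rfl | rfl
      · rw [sub_zero] at hq
        split_ifs with hij
        · subst hij
          simp [pr_of_mem hq]
        · simp [pr_of_mem_ne hq (Ne.symm hij)]
      · have hp0 := evenMk_odd p hp
        split_ifs <;> simp [hp0]
    · split_ifs with hij
      · subst hij
        rw [pr_of_mem ha]
      · rw [pr_of_mem_ne ha (Ne.symm hij)]
        simp
  have h2 := hρ (H.pr 1) (hodd 1)
  -- From `(ρ ∘ S) * ρ = 1` and `ρ = jD * jA`, convolving on the right with the inverse `jA ∘ S` of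
  -- `jA`.
  have h3 : toConv (H.evenCoact.toLinearMap ∘ₗ H.antipode) * toConv jD =
      toConv (jA.toLinearMap ∘ₗ H.antipode) := by
    have e := algHom_antipode_conv H.evenCoact
    rw [h1, ← mul_assoc] at e
    have e2 := algHom_conv_antipode jA
    calc _ = toConv (H.evenCoact.toLinearMap ∘ₗ H.antipode) * toConv jD *
          (toConv jA.toLinearMap * toConv (jA.toLinearMap ∘ₗ H.antipode)) := by rw [e2, mul_one]
      _ = _ := by rw [← mul_assoc, e, one_mul]
  have h4 : toConv (H.evenCoact.toLinearMap ∘ₗ H.antipode ∘ₗ H.pr 0) * toConv jD =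
      toConv (jA.toLinearMap ∘ₗ H.antipode ∘ₗ H.pr 0) := by
    ext x
    have e := congrArg (fun f : WithConv (H.Coord →ₗ[k] H.EvenRing ⊗[k] H.Coord) => f (H.pr 0 x)) h3
    refine Eq.trans ?_ e
    change LinearMap.mul' k _ (TensorProduct.map (H.evenCoact.toLinearMap ∘ₗ H.antipode ∘ₗ H.pr 0)
      jD (comul x)) = LinearMap.mul' k _ (TensorProduct.map (H.evenCoact.toLinearMap ∘ₗ H.antipode)
      jD (comul (H.pr 0 x)))
    refine homogeneous_induction (p := fun x => LinearMap.mul' k _ (TensorProduct.map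
      (H.evenCoact.toLinearMap ∘ₗ H.antipode ∘ₗ H.pr 0)
      jD (comul x)) = LinearMap.mul' k _ (TensorProduct.map (H.evenCoact.toLinearMap ∘ₗ H.antipode)
      jD (comul (H.pr 0 x)))) (fun a b ha hb => by simp only [map_add, ha, hb]) ?_ x
    intro j a ha
    refine (tensorGr_induction (p := fun t => LinearMap.mul' k _ (TensorProduct.map
      (H.evenCoact.toLinearMap ∘ₗ H.antipode ∘ₗ H.pr 0) jD t) =
      if j = 0 then LinearMap.mul' k _ (TensorProduct.map
      (H.evenCoact.toLinearMap ∘ₗ H.antipode) jD t) else 0)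
      (fun s t hs ht => ?_) ?_ _ (H.comul_mem j a ha)).trans ?_
    · simp only [map_add, hs, ht]
      split_ifs <;> simp
    · intro l p hp q hq
      rcases parity_cases j with rfl | rfl
      · rcases parity_cases l with rfl | rfl
        · simp [pr_of_mem hp]
        · have hq0 := evenMk_odd q (by simpa using hq)
          simp [jD, hq0]
      · rcases parity_cases l with rfl | rfl
        · have hq0 := evenMk_odd q (by simpa using hq)
          simp [jD, hq0]
        · simp [pr_zero_of_odd hp]
    · split_ifs with hj
      · subst hj
        rw [pr_of_mem ha]
      · rw [pr_of_mem_ne ha hj]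
        simp
  have h5 : toConv (H.evenCoact.toLinearMap ∘ₗ H.leftForm) =
      toConv (H.evenCoact.toLinearMap ∘ₗ H.antipode ∘ₗ H.pr 0) *
        toConv (H.evenCoact.toLinearMap ∘ₗ H.pr 1) := by
    exact congrArg toConv (LinearMap.algHom_comp_convMul_distrib H.evenCoact
      (toConv (H.antipode ∘ₗ H.pr 0)) (toConv (H.pr 1)))
  have h6 : toConv (jA.toLinearMap ∘ₗ H.leftForm) =
      toConv (jA.toLinearMap ∘ₗ H.antipode ∘ₗ H.pr 0) * toConv (jA.toLinearMap ∘ₗ H.pr 1) := by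
    exact congrArg toConv (LinearMap.algHom_comp_convMul_distrib jA
      (toConv (H.antipode ∘ₗ H.pr 0)) (toConv (H.pr 1)))
  -- In `(ρ ∘ S ∘ pr₀) * (ρ ∘ pr₁)` the factor `jD` coming from the right form is absorbed by the
  -- left one, and `jA ∘ λ` remains.
  rw [h2, ← mul_assoc, h4, ← h6] at h5
  exact congrArg (fun f : WithConv (H.Coord →ₗ[k] H.EvenRing ⊗[k] H.Coord) => f x) h5

end Supergroup

/-! ### Odd derivations, the Euler operator and invariant functionals -/

namespace Supergroup

open Coalgebra WithConv

set_option maxSynthPendingDepth 3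

variable {H : Supergroup k}

variable (H) in
/-- The parity automorphism of `k[H]`. -/
def sgn : H.Coord →ₗ[k] H.Coord := H.pr 0 - H.pr 1

theorem sgn_even {a : H.Coord} (ha : a ∈ H.gr 0) : H.sgn a = a := by
  rw [sgn, LinearMap.sub_apply, pr_of_mem ha, pr_one_of_even ha, sub_zero]

theorem sgn_odd {a : H.Coord} (ha : a ∈ H.gr 1) : H.sgn a = -a := by
  rw [sgn, LinearMap.sub_apply, pr_of_mem ha, pr_zero_of_odd ha, zero_sub]

theorem odd_mul_sgn {w : H.Coord} (hw : w ∈ H.gr 1) (a : H.Coord) : w * H.sgn a = a * w := by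
  refine homogeneous_induction (p := fun a => w * H.sgn a = a * w)
    (fun a b ha hb => by rw [map_add, mul_add, add_mul, ha, hb]) ?_ a
  intro i a ha
  rcases parity_cases i with rfl | rfl
  · rw [sgn_even ha, mul_comm_of_even_left ha]
  · rw [sgn_odd ha, mul_neg, mul_anticomm_of_odd hw ha, neg_neg]

theorem leftAct_apply (u : Module.Dual k H.Coord) (a : H.Coord) :
    H.leftAct u a = TensorProduct.lid k H.Coord (LinearMap.rTensor H.Coord u (comul a)) := rfl

theorem leftAct_counit (a : H.Coord) : H.leftAct (counit (R := k)) a = a := by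
  rw [leftAct_apply, rTensor_counit_comul]
  simp

/-- An odd element of the Lie superalgebra acts by an odd derivation. -/
theorem leftAct_mul {y : Module.Dual k H.Coord} (hy : y ∈ H.oddLie) (a b : H.Coord) :
    H.leftAct y (a * b) = H.leftAct y a * b + H.sgn a * H.leftAct y b := by
  let T : Module.Dual k H.Coord → H.Coord ⊗[k] H.Coord →ₗ[k] H.Coord := fun u =>
    (TensorProduct.lid k H.Coord).toLinearMap ∘ₗ LinearMap.rTensor H.Coord u
  have key : ∀ X Y : H.Coord ⊗[k] H.Coord, T y (H.star X Y) = T y X * T counit Y +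
      H.sgn (T counit X) * T y Y := by
    intro X Y
    refine tensor_induction (p := fun X => T y (H.star X Y) = T y X * T counit Y +
      H.sgn (T counit X) * T y Y) (fun X X' hX hX' => ?_) ?_ X
    · rw [add_star, map_add, hX, hX', map_add, map_add, map_add, add_mul, add_mul]
      abel
    intro i j p hp q hq
    refine tensor_induction (p := fun Y => T y (H.star (p ⊗ₜ q) Y) =
      T y (p ⊗ₜ q) * T counit Y + H.sgn (T counit (p ⊗ₜ q)) * T y Y) (fun Y Y' hY hY' => ?_) ?_ Y
    · rw [star_add, map_add, hY, hY', map_add, map_add, mul_add, mul_add]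
      abel
    intro i' j' r hr s hs
    rcases parity_cases i' with rfl | rfl
    · rw [star_tmul_even_right p q hr]
      simp [T, oddLie_mul hy, oddLie_even hy hr, smul_smul, mul_comm]
    · have hr0 := H.counit_odd r hr
      rcases parity_cases j with rfl | rfl
      · rw [star_tmul_even_left p r hq]
        simp [T, oddLie_mul hy, hr0, smul_smul, mul_comm, sgn_even hq]
      · rw [star_tmul_odd p hq hr]
        simp [T, oddLie_mul hy, hr0, smul_smul, mul_comm, sgn_odd hq]
  have h := key (comul a) (comul b)
  rw [← comul_mul_eq_star] at h
  have hc : ∀ a, T counit (comul a) = a := leftAct_counit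
  rw [hc, hc] at h
  exact h

theorem evenMk_leftAct_even {y : Module.Dual k H.Coord} (hy : y ∈ H.oddLie) {a : H.Coord}
    (ha : a ∈ H.gr 0) : H.evenMk (H.leftAct y a) = 0 := by
  rw [leftAct_apply]
  refine tensorGr_induction (p := fun t => H.evenMk (TensorProduct.lid k H.Coord
    (LinearMap.rTensor H.Coord y t)) = 0) (fun s t hs ht => by
      simp only [map_add, hs, ht, add_zero]) ?_ _ (H.comul_mem 0 a ha)
  intro j p hp q hq
  rcases parity_cases j with rfl | rfl
  · simp [oddLie_even hy hp]
  · have := evenMk_odd q (by simpa using hq)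
    simp [this]

/-- Followed by restriction to `H₀`, the operator `leftAct y` is the convolution of `y` with the
restriction map. Convolving with the antipode cancels the latter and leaves the constant `y x`, so
the derivations `leftAct (oddVec i)` are dual to the right frame along `H₀`. -/
theorem evenMk_leftAct_rightForm {y : Module.Dual k H.Coord} (hy : y ∈ H.oddLie) (x : H.Coord) :
    H.evenMk (H.leftAct y (H.rightForm x)) = algebraMap k _ (y x) := by
  let Y : H.Coord →ₗ[k] H.EvenRing := Algebra.linearMap k H.EvenRing ∘ₗ y
  have h1 : toConv (H.evenMk.toLinearMap ∘ₗ H.leftAct y) = toConv Y * toConv H.evenMk.toLinearMap := by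
    ext x
    change H.evenMk (H.leftAct y x) = LinearMap.mul' k _ (TensorProduct.map Y H.evenMk.toLinearMap
      (comul x))
    rw [leftAct_apply]
    induction comul (R := k) x with
    | zero => simp
    | add s t hs ht => simp only [map_add, hs, ht]
    | tmul a b => simp [Y, Algebra.smul_def]
  have h2 : toConv (H.evenMk.toLinearMap ∘ₗ H.leftAct y) *
      toConv (H.evenMk.toLinearMap ∘ₗ H.antipode) = toConv Y := by
    rw [h1, mul_assoc, algHom_conv_antipode, mul_one]
  have h3 := congrArg (fun f : WithConv (H.Coord →ₗ[k] H.EvenRing) => f x) h2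
  refine Eq.trans ?_ h3
  change H.evenMk (H.leftAct y (LinearMap.mul' k H.Coord (TensorProduct.map (H.pr 1)
    (H.antipode ∘ₗ H.pr 0) (comul x)))) = LinearMap.mul' k _ (TensorProduct.map
      (H.evenMk.toLinearMap ∘ₗ H.leftAct y) (H.evenMk.toLinearMap ∘ₗ H.antipode) (comul x))
  induction comul (R := k) x with
  | zero => simp
  | add s t hs ht => simp only [map_add, hs, ht]
  | tmul a b =>
    have e1 : H.evenMk (H.antipode (H.pr 0 b)) = H.evenMk (H.antipode b) :=
      congrArg (fun f : H.Coord →ₗ[k] H.EvenRing => f b) evenMk_antipode_pr_zero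
    have e2 : H.evenMk (H.leftAct y (H.pr 1 a)) = H.evenMk (H.leftAct y a) := by
      conv_rhs => rw [← pr_add_pr a, map_add, map_add, evenMk_leftAct_even hy (pr_mem 0 a),
        zero_add]
    simp only [TensorProduct.map_tmul, LinearMap.mul'_apply, LinearMap.comp_apply,
      AlgHom.toLinearMap_apply]
    rw [leftAct_mul hy, map_add, map_mul, map_mul, e1, e2, sgn_odd (pr_mem 1 a), map_neg,
      evenMk_odd _ (pr_mem 1 a), neg_zero, zero_mul, add_zero]

/-- The Euler operator acts on the `n`-th graded piece by `n`. -/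
theorem sum_rightFrame_mul_leftAct_sub_mem {n : ℕ} {x : H.Coord} (hx : x ∈ H.filt n) :
    (∑ i, rightFrame i * H.leftAct (oddVec i) x) - (n : k) • x ∈ H.filt (n + 1) := by
  induction n generalizing x with
  | zero =>
    rw [Nat.cast_zero, zero_smul, sub_zero]
    exact sum_mem fun i _ => filt_mul_right (odd_mem_filt (rightFrame_mem i)) _
  | succ n ih =>
    rw [filt_succ] at hx
    induction hx using Submodule.mul_induction_on' with
    | mem_mul_mem a ha c hc =>
      -- Leibniz rule for `a * c`: the first factor contributes `n` by induction, and the odd factor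
      -- `c` contributes `1` by `pr_one_sub_rightFrame_mem`. The sign in `sgn a` is undone when the
      -- frame element is moved past `a`.
      have h1 := mul_mem_filt (ih ha) (odd_mem_filt hc)
      have h2 := mul_mem_filt ha (pr_one_sub_rightFrame_mem c)
      rw [pr_of_mem hc] at h2
      have h3 := sub_mem h1 h2
      convert h3 using 1
      simp only [leftAct_mul (oddVec_mem _), mul_add, Finset.sum_add_distrib, mul_sub, sub_mul,
        Finset.sum_mul, Finset.mul_sum, Nat.cast_add, Nat.cast_one, add_smul, one_smul]
      have e : ∀ i, rightFrame i * (H.sgn a * H.leftAct (oddVec i) c) =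
          a * (rightFrame i * H.leftAct (oddVec i) c) := fun i => by
        rw [← mul_assoc, odd_mul_sgn (rightFrame_mem i), mul_assoc]
      simp only [e, smul_mul_assoc, mul_assoc]
      abel
    | add x _ y _ hx hy =>
      have := add_mem hx hy
      convert this using 1
      simp only [map_add, mul_add, Finset.sum_add_distrib, smul_add]
      abel

/-- The Leibniz rule gives the coefficient `oddRank` from the derivatives of the frame itself, which
are `1` modulo `I`, minus the Euler operator, as each derivation passes an odd frame element. -/
theorem sum_leftAct_rightFrame_mul_sub_mem {n : ℕ} {x : H.Coord} (hx : x ∈ H.filt n) :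
    (∑ i, H.leftAct (oddVec i) (rightFrame i * x)) - ((H.oddRank : k) - n) • x ∈
      H.filt (n + 1) := by
  have h1 := sum_rightFrame_mul_leftAct_sub_mem hx
  have h2 : ∀ i : Fin H.oddRank, H.leftAct (oddVec i) (rightFrame i) * x - x ∈ H.filt (n + 1) := by
    intro i
    have : H.leftAct (oddVec i) (rightFrame i) - 1 ∈ H.filt 1 := by
      rw [mem_filt_one_iff, map_sub, rightFrame, evenMk_leftAct_rightForm (oddVec_mem i),
        oddVec_oddCoord, if_pos rfl, map_one, map_one, sub_self]
    have h := mul_mem_filt this hx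
    rw [sub_mul, one_mul, add_comm 1 n] at h
    exact h
  have h3 := sub_mem (sum_mem (t := Finset.univ) fun i _ => h2 i) h1
  convert h3 using 1
  simp only [leftAct_mul (oddVec_mem _), sgn_odd (rightFrame_mem _), Finset.sum_add_distrib,
    Finset.sum_sub_distrib, neg_mul, Finset.sum_neg_distrib, sub_smul, Finset.sum_const,
    Finset.card_univ, Fintype.card_fin, Nat.cast_smul_eq_nsmul]
  abel

/-- An integral kills derivatives: `Γ(y(x₁) x₂) = y(x₁ Γ(x₂)) = Γ(x) y(1) = 0`. -/
theorem _root_.IsLeftInvariant.apply_leftAct {Γ : H.Coord →ₗ[k] k} (hΓ : IsLeftInvariant Γ)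
    {y : Module.Dual k H.Coord} (hy : y ∈ H.oddLie) (x : H.Coord) : Γ (H.leftAct y x) = 0 := by
  have h : y (coRight Γ x) = 0 := by rw [hΓ, map_smul, oddLie_one hy, smul_zero]
  rw [← h, leftAct_apply, coRight, LinearMap.comp_apply, LinearMap.comp_apply]
  induction comul (R := k) x with
  | zero => simp
  | add s t hs ht => simp only [map_add, hs, ht]
  | tmul a b => simp [mul_comm]

/-- On `I^m` the operator of `sum_leftAct_rightFrame_mul_sub_mem` is multiplication by `N - m`
modulo `I^(m+1)`, with `N` the odd rank, and `Γ` kills its values. For `m < N` this number is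
invertible in characteristic zero, so vanishing on `I^(m+1)` passes down to `I^m`. -/
theorem _root_.IsLeftInvariant.eq_zero_of_filt [CharZero k] {Γ : H.Coord →ₗ[k] k}
    (hΓ : IsLeftInvariant Γ) (h : ∀ x ∈ H.filt H.oddRank, Γ x = 0) : Γ = 0 := by
  have key : ∀ n ≤ H.oddRank, ∀ x ∈ H.filt (H.oddRank - n), Γ x = 0 := by
    intro n hn
    induction n with
    | zero => exact h
    | succ n ih =>
      intro x hx
      have ih := ih (Nat.le_of_succ_le hn)
      have e : H.oddRank - n = H.oddRank - (n + 1) + 1 := by omega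
      rw [e] at ih
      have h1 := ih _ (sum_leftAct_rightFrame_mul_sub_mem hx)
      rw [map_sub, map_sum, Finset.sum_eq_zero (fun i _ => hΓ.apply_leftAct (oddVec_mem i) _),
        zero_sub, map_smul, neg_eq_zero, smul_eq_mul, mul_eq_zero, Nat.cast_sub hn,
        sub_sub_cancel] at h1
      exact h1.resolve_left (Nat.cast_ne_zero.2 (Nat.succ_ne_zero n))
  ext x
  refine key H.oddRank le_rfl x ?_
  rw [Nat.sub_self]
  exact mem_filt_zero x

/-! ### The top form -/

/-- Nakayama's lemma for the nilpotent ideal `I`: the frame generates modulo `I²`, hence generates.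
-/
theorem gr_one_le_span_leftFrame [CharZero k] :
    H.gr 1 ≤ ⊤ * Submodule.span k (Set.range (leftFrame (H := H))) := by
  set N := (⊤ : Submodule k H.Coord) * Submodule.span k (Set.range (leftFrame (H := H))) with hN
  have hl : ∀ a, ∀ b ∈ N, a * b ∈ N := by
    intro a b hb
    have := Submodule.mul_mem_mul (Submodule.mem_top (x := a)) hb
    rwa [hN, ← mul_assoc, top_mul_top] at this
  have h2 : H.gr 1 ≤ N ⊔ H.filt 2 := by
    intro x hx
    have h := pr_one_sub_leftFrame_mem x
    rw [pr_of_mem hx] at h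
    rw [← add_sub_cancel (∑ i, H.rightAct (oddVec i) x * leftFrame i) x]
    refine Submodule.add_mem_sup (sum_mem fun i _ => ?_) h
    exact Submodule.mul_mem_mul Submodule.mem_top (Submodule.subset_span ⟨i, rfl⟩)
  have h3 : ∀ m, H.filt (m + 1) ≤ N ⊔ H.filt (m + 2) := by
    intro m
    rw [filt_succ, Submodule.mul_le]
    intro x hx y hy
    obtain ⟨n, hn, z, hz, rfl⟩ := Submodule.mem_sup.1 (h2 hy)
    rw [mul_add]
    exact Submodule.add_mem_sup (hl x n hn) (mul_mem_filt hx hz)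
  have h4 : ∀ m, H.gr 1 ≤ N ⊔ H.filt (m + 1) := by
    intro m
    induction m with
    | zero => exact fun x hx => Submodule.mem_sup_right (odd_mem_filt hx)
    | succ m ih => exact ih.trans (sup_le le_sup_left (h3 m))
  obtain ⟨n, hn⟩ := exists_filt_eq_bot H
  have h5 : H.filt (n + 1) = ⊥ := eq_bot_iff.2 ((filt_succ_le n).trans hn.le)
  simpa [h5] using h4 n

theorem span_leftFrame_le : Submodule.span k (Set.range (leftFrame (H := H))) ≤ H.gr 1 :=
  Submodule.span_le.2 (by rintro _ ⟨i, rfl⟩; exact leftFrame_mem i)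

/-- The ideal `I` is generated by the members of the frame. Only an upper bound for the number of
distinct members is needed. -/
theorem filt_oddRank_succ [CharZero k] : H.filt (H.oddRank + 1) = ⊥ := by
  classical
  let t : Finset H.Coord := Finset.univ.image leftFrame
  have ht : (t : Set H.Coord) = Set.range leftFrame := by simp [t]
  have hcard : t.card ≤ H.oddRank := Finset.card_image_le.trans (by simp)
  have h1 := gr_one_le_span_leftFrame (H := H)
  rw [← ht] at h1
  have h2 := pow_top_mul_span_eq_bot t (by
    intro x hx
    obtain ⟨i, _, rfl⟩ := Finset.mem_image.1 hx
    exact leftFrame_mem i)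
  exact eq_bot_iff.2 ((filt_antitone (Nat.succ_le_succ hcard)).trans
    ((filt_le_pow h1 (Nat.succ_ne_zero _)).trans h2.le))

variable (H) in
/-- The product of `n` odd functions, as an alternating map. -/
def oddProd [CharZero k] (n : ℕ) : (H.gr 1) [⋀^Fin n]→ₗ[k] H.Coord :=
  (ExteriorAlgebra.lift k ⟨(H.gr 1).subtype, fun m => mul_self_of_odd m.2⟩).toLinearMap.compAlternatingMap
    (ExteriorAlgebra.ιMulti k n)

theorem oddProd_apply [CharZero k] {n : ℕ} (v : Fin n → H.gr 1) :
    H.oddProd n v = (List.ofFn fun i => (v i : H.Coord)).prod := by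
  rw [oddProd, LinearMap.compAlternatingMap_apply, ExteriorAlgebra.ιMulti_apply,
    AlgHom.toLinearMap_apply, map_list_prod, List.map_ofFn]
  congr 2
  ext i
  simp

variable (H) in
/-- The left invariant odd volume form. -/
def topForm : H.Coord := (List.ofFn (leftFrame (H := H))).prod

theorem topForm_eq [CharZero k] :
    H.topForm = H.oddProd H.oddRank (fun i => ⟨leftFrame i, leftFrame_mem i⟩) := by
  rw [oddProd_apply]
  rfl

theorem list_prod_mem_filt {n : ℕ} (v : Fin n → H.Coord) (hv : ∀ i, v i ∈ H.gr 1) :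
    (List.ofFn v).prod ∈ H.filt n := by
  induction n with
  | zero => exact mem_filt_zero _
  | succ n ih =>
    rw [List.ofFn_succ, List.prod_cons]
    have h := mul_mem_filt (odd_mem_filt (hv 0)) (ih (fun i => v i.succ) fun i => hv _)
    have e : 1 + n = n + 1 := add_comm 1 n
    simp only [e] at h
    exact h

theorem topForm_mem_filt : H.topForm ∈ H.filt H.oddRank := list_prod_mem_filt _ leftFrame_mem

theorem list_prod_mem_gr {n : ℕ} (v : Fin n → H.Coord) (hv : ∀ i, v i ∈ H.gr 1) :
    (List.ofFn v).prod ∈ H.gr (n : ZMod 2) := by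
  induction n with
  | zero => simpa using one_mem
  | succ n ih =>
    rw [List.ofFn_succ, List.prod_cons, Nat.cast_succ, add_comm]
    exact mul_mem (hv 0) (ih _ fun i => hv _)

theorem topForm_mem_gr : H.topForm ∈ H.gr (H.oddRank : ZMod 2) := list_prod_mem_gr _ leftFrame_mem

theorem pow_top_mul_le {P : Submodule k H.Coord} (hP : P ≤ H.gr 1) (n : ℕ) :
    (⊤ * P) ^ n ≤ ⊤ * P ^ n := by
  induction n with
  | zero => rw [pow_zero, pow_zero, mul_one]; exact le_top
  | succ n ih =>
    calc (⊤ * P) ^ (n + 1) = (⊤ * P) ^ n * (⊤ * P) := pow_succ _ _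
      _ ≤ (⊤ * P ^ n) * (⊤ * P) := mul_mono_left ih
      _ = ⊤ * (P ^ n * ⊤) * P := by simp only [mul_assoc]
      _ ≤ ⊤ * (⊤ * P ^ n) * P := mul_mono_left (mul_mono_right (pow_mul_top_le_of_odd hP n))
      _ = ⊤ * P ^ (n + 1) := by rw [← mul_assoc ⊤ ⊤, top_mul_top, mul_assoc, pow_succ]

/-- Products of `N` members of the frame are alternating in the factors: a repetition gives zero,
and a permutation gives the top form up to sign. -/
theorem filt_oddRank_le [CharZero k] : H.filt H.oddRank ≤ ⊤ * Submodule.span k {H.topForm} := by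
  have h1 : H.gr 1 ^ H.oddRank ≤ ⊤ * Submodule.span k (Set.range (leftFrame (H := H))) ^ H.oddRank :=
    (pow_le_pow_left' gr_one_le_span_leftFrame _).trans (pow_top_mul_le span_leftFrame_le _)
  have h2 : Submodule.span k (Set.range (leftFrame (H := H))) ^ H.oddRank ≤
      Submodule.span k {H.topForm} := by
    rw [Submodule.span_pow, Submodule.span_le]
    intro x hx
    obtain ⟨f, rfl⟩ := Set.mem_pow.1 hx
    choose e he using fun i => (f i).2
    have e1 : (List.ofFn fun i => (f i : H.Coord)).prod = H.oddProd H.oddRank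
        (fun i => ⟨leftFrame (e i), leftFrame_mem _⟩) := by
      rw [oddProd_apply]
      simp only [he]
    rw [e1]
    by_cases hinj : Function.Injective e
    · let σ := Equiv.ofBijective e (Finite.injective_iff_bijective.1 hinj)
      have h := (H.oddProd H.oddRank).map_perm (fun i => ⟨leftFrame i, leftFrame_mem i⟩) σ
      rw [← topForm_eq] at h
      have h' : H.oddProd H.oddRank (fun i => ⟨leftFrame (e i), leftFrame_mem _⟩) =
        Equiv.Perm.sign σ • H.topForm := h
      rw [h']
      exact Submodule.smul_of_tower_mem _ _ (Submodule.subset_span rfl)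
    · obtain ⟨i, j, hij, hne⟩ := Function.not_injective_iff.1 hinj
      rw [(H.oddProd H.oddRank).map_eq_zero_of_eq _ (by simp only [hij]) hne]
      exact zero_mem _
  calc H.filt H.oddRank ≤ ⊤ * (⊤ * Submodule.span k {H.topForm}) :=
        mul_mono_right (h1.trans (mul_mono_right h2))
    _ = _ := by rw [← mul_assoc, top_mul_top]

theorem evenCoact_leftFrame (i : Fin H.oddRank) :
    H.evenCoact (leftFrame i) = 1 ⊗ₜ leftFrame i := evenCoact_leftForm _

theorem evenCoact_topForm : H.evenCoact H.topForm = 1 ⊗ₜ H.topForm := by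
  have h : ∀ x : H.Coord, (1 : H.EvenRing) ⊗ₜ[k] x =
    (Algebra.TensorProduct.includeRight : H.Coord →ₐ[k] H.EvenRing ⊗[k] H.Coord) x := fun _ => rfl
  rw [topForm, h, map_list_prod, map_list_prod, List.map_ofFn, List.map_ofFn]
  congr 2
  ext i
  exact evenCoact_leftFrame i

/-- A left invariant functional is determined by its value at the top form. -/
theorem _root_.IsLeftInvariant.eq_zero_of_topForm [CharZero k] {Γ : H.Coord →ₗ[k] k}
    (hΓ : IsLeftInvariant Γ) (h : Γ H.topForm = 0) : Γ = 0 := by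
  obtain ⟨s, hs⟩ := H.evenMk.toLinearMap.exists_rightInverse_of_surjective
    (LinearMap.range_eq_top.2 evenMk_surjective)
  -- The functional `b ↦ Γ(b ω)`, with `ω` the top form, passes to `k[H₀]` because `I ω ⊆ I^(N+1) =
  -- 0`. It is left invariant because `ω` is invariant under `H₀`.
  let F : H.EvenRing →ₗ[k] k := Γ ∘ₗ LinearMap.mulRight k H.topForm ∘ₗ s
  have hF : ∀ b, F (H.evenMk b) = Γ (b * H.topForm) := by
    intro b
    have h1 : H.evenMk (s (H.evenMk b)) = H.evenMk b :=
      congrArg (fun f : H.EvenRing →ₗ[k] H.EvenRing => f (H.evenMk b)) hs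
    have h2 : s (H.evenMk b) - b ∈ H.filt 1 := by rw [mem_filt_one_iff, map_sub, h1, sub_self]
    have h3 := mul_mem_filt h2 topForm_mem_filt
    rw [add_comm, filt_oddRank_succ, Submodule.mem_bot, sub_mul, sub_eq_zero] at h3
    exact congrArg Γ h3
  have hFinv : IsLeftInvariant F := by
    intro x
    obtain ⟨b, rfl⟩ := evenMk_surjective x
    have e1 : ∀ t : H.Coord ⊗[k] H.Coord, TensorProduct.rid k H.EvenRing
        (LinearMap.lTensor H.EvenRing F (TensorProduct.map H.evenMk.toLinearMap
          H.evenMk.toLinearMap t)) = TensorProduct.rid k H.EvenRing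
        (LinearMap.lTensor H.EvenRing Γ (LinearMap.rTensor H.Coord H.evenMk.toLinearMap t *
          1 ⊗ₜ H.topForm)) := by
      intro t
      induction t with
      | zero => simp
      | add s t hs ht => simp only [map_add, add_mul, hs, ht]
      | tmul a b => simp [hF]
    have e2 : ∀ t : H.Coord ⊗[k] H.Coord, TensorProduct.rid k H.EvenRing
        (LinearMap.lTensor H.EvenRing Γ (LinearMap.rTensor H.Coord H.evenMk.toLinearMap t)) =
        H.evenMk (TensorProduct.rid k H.Coord (LinearMap.lTensor H.Coord Γ t)) := by
      intro t
      induction t with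
      | zero => simp
      | add s t hs ht => simp only [map_add, hs, ht]
      | tmul a b => simp
    have e3 : coRight F (H.evenMk b) = H.evenMk (coRight Γ (b * H.topForm)) := by
      refine (e1 (comul b)).trans ?_
      rw [← evenCoact_apply, ← evenCoact_topForm, ← map_mul, evenCoact_apply]
      exact e2 _
    rw [e3, hΓ, map_smul, map_one, hF]
  -- Here `F 1 = Γ ω = 0`, so the theorem on commutative Hopf algebras applies. Then `Γ` vanishes on
  -- `I^N`, whose elements are multiples of `ω`.
  have hF0 : F = 0 := by
    by_contra hne
    apply hFinv.apply_one_ne_zero hne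
    rw [← map_one H.evenMk, hF, one_mul, h]
  refine hΓ.eq_zero_of_filt fun x hx => ?_
  have hx' := filt_oddRank_le hx
  clear hx
  induction hx' using Submodule.mul_induction_on' with
  | mem_mul_mem a _ c hc =>
    obtain ⟨r, rfl⟩ := Submodule.mem_span_singleton.1 hc
    rw [mul_smul_comm, map_smul, ← hF, hF0, LinearMap.zero_apply, smul_zero]
  | add x _ y _ hx hy => rw [map_add, hx, hy, add_zero]

end Supergroup

/-! ### The supertrace construction of an invariant functional -/

namespace Supergroup

open Coalgebra WithConv

set_option maxSynthPendingDepth 3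

variable {H : Supergroup k}

variable (k) in
/-- The sign `(-1)^i`. -/
def sg (i : ZMod 2) : k := if i = 0 then 1 else -1

theorem sg_add (i j : ZMod 2) : sg k (i + j) = sg k i * sg k j := by
  rcases parity_cases i with rfl | rfl <;> rcases parity_cases j with rfl | rfl <;>
    simp [sg, show (1 : ZMod 2) + 1 = 0 from rfl]

theorem sg_mul_self (i : ZMod 2) : sg k i * sg k i = 1 := by
  rcases parity_cases i with rfl | rfl <;> simp [sg]

theorem sg_ne_zero (i : ZMod 2) : sg k i ≠ 0 := left_ne_zero_of_mul_eq_one (sg_mul_self i)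

theorem supercomm_sg {i j : ZMod 2} {a b : H.Coord} (ha : a ∈ H.gr i) (hb : b ∈ H.gr j) :
    a * b = sg k (i * j) • (b * a) := by
  rcases parity_cases i with rfl | rfl
  · rw [mul_comm_of_even_left ha]
    simp [sg]
  · rcases parity_cases j with rfl | rfl
    · rw [← mul_comm_of_even_left hb]
      simp [sg]
    · rw [mul_anticomm_of_odd ha hb]
      simp [sg]

/-- The parity automorphism to the power `i`. -/
def twist (H : Supergroup k) (i : ZMod 2) : H.Coord →ₗ[k] H.Coord :=
  if i = 0 then LinearMap.id else H.sgn

theorem twist_of_mem (i : ZMod 2) {j : ZMod 2} {a : H.Coord} (ha : a ∈ H.gr j) :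
    H.twist i a = sg k (i * j) • a := by
  rcases parity_cases i with rfl | rfl
  · simp [twist, sg]
  · rcases parity_cases j with rfl | rfl
    · simp [twist, sg, sgn_even ha]
    · simp [twist, sg, sgn_odd ha]

theorem sum_star {ι : Type*} (s : Finset ι) (f : ι → H.Coord ⊗[k] H.Coord)
    (y : H.Coord ⊗[k] H.Coord) : H.star (∑ i ∈ s, f i) y = ∑ i ∈ s, H.star (f i) y :=
  map_sum (AddMonoidHom.mk' (fun x => H.star x y) fun a b => add_star a b y) f s

/-- `b₁ η(q b₂)`. -/
theorem rid_lTensor_star (η : H.Coord →ₗ[k] k) (p : H.Coord) {q : H.Coord} {c : ZMod 2}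
    (hq : q ∈ H.gr c) (Y : H.Coord ⊗[k] H.Coord) :
    TensorProduct.rid k H.Coord (LinearMap.lTensor H.Coord η (H.star (p ⊗ₜ q) Y)) =
      p * H.twist c (TensorProduct.rid k H.Coord
        (LinearMap.lTensor H.Coord (η ∘ₗ LinearMap.mulLeft k q) Y)) := by
  refine tensor_induction (p := fun Y => TensorProduct.rid k H.Coord
    (LinearMap.lTensor H.Coord η (H.star (p ⊗ₜ q) Y)) =
      p * H.twist c (TensorProduct.rid k H.Coord
        (LinearMap.lTensor H.Coord (η ∘ₗ LinearMap.mulLeft k q) Y)))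
    (fun X Y hX hY => by simp only [star_add, map_add, hX, hY, mul_add]) ?_ Y
  intro i j r hr s hs
  rcases parity_cases i with rfl | rfl
  · rw [star_tmul_even_right p q hr]
    simp [twist_of_mem c hr, sg]
  · rcases parity_cases c with rfl | rfl
    · rw [star_tmul_even_left p r hq]
      simp [twist]
    · rw [star_tmul_odd p hq hr]
      simp [twist_of_mem 1 hr, sg]

/-- The data of a comodule map from `k[H]` to a comodule with a homogeneous basis: the matrix
coefficients of the comodule and the coordinates of the map. -/
structure MatrixMap (H : Supergroup k) (ι : Type*) [Fintype ι] [DecidableEq ι] where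
  parity : ι → ZMod 2
  t : ι → ι → H.Coord
  η : ι → H.Coord →ₗ[k] k
  t_mem : ∀ i j, t i j ∈ H.gr (parity i + parity j)
  t_comul : ∀ i j, comul (R := k) (t i j) = ∑ l, t i l ⊗ₜ[k] t l j
  t_counit : ∀ i j, counit (R := k) (t i j) = if i = j then 1 else 0
  coRight_η : ∀ i x, coRight (η i) x = ∑ l, η l x • t l i
  η_parity : ∀ i j, ∀ x ∈ H.gr j, j ≠ parity i → η i x = 0

namespace MatrixMap

variable {ι : Type*} [Fintype ι] [DecidableEq ι] (T : MatrixMap H ι)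

theorem antipode_mul (i j : ι) :
    ∑ l, H.antipode (T.t i l) * T.t l j = if i = j then 1 else 0 := by
  have h := H.antipode_left (T.t i j)
  rw [T.t_comul, T.t_counit, map_sum, map_sum] at h
  simp only [TensorProduct.map_tmul, LinearMap.mul'_apply, LinearMap.id_apply] at h
  rw [h]
  split_ifs <;> simp

theorem mul_antipode (i j : ι) :
    ∑ l, T.t i l * H.antipode (T.t l j) = if i = j then 1 else 0 := by
  have h := H.antipode_right (T.t i j)
  rw [T.t_comul, T.t_counit, map_sum, map_sum] at h
  simp only [TensorProduct.map_tmul, LinearMap.mul'_apply, LinearMap.id_apply] at h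
  rw [h]
  split_ifs <;> simp

/-- The supertrace functional `a ↦ ∑ (-1)^{|m|} η_m(t_{mr} a)`. -/
def strace (r : ι) : H.Coord →ₗ[k] k :=
  ∑ m, sg k (T.parity m) • (T.η m ∘ₗ LinearMap.mulLeft k (T.t m r))

theorem strace_apply (r : ι) (a : H.Coord) :
    T.strace r a = ∑ m, sg k (T.parity m) * T.η m (T.t m r * a) := by
  simp [strace, LinearMap.sum_apply]

/-- The comodule identity for `η i`, evaluated at `t j r * a`, with `Δ(t_{jr})` expanded as `∑
t_{jm} ⊗ t_{mr}`. The twist is the sign for moving `t_{mr}` past the first leg of `Δ(a)`. -/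
theorem sum_mul_twist (r i j : ι) (a : H.Coord) :
    ∑ l, T.η l (T.t j r * a) • T.t l i = ∑ m, T.t j m * H.twist (T.parity m + T.parity r)
      (coRight (T.η i ∘ₗ LinearMap.mulLeft k (T.t m r)) a) := by
  rw [← T.coRight_η]
  simp only [coRight, LinearMap.comp_apply, LinearEquiv.coe_coe]
  rw [comul_mul_eq_star, T.t_comul, sum_star, map_sum, map_sum]
  exact Finset.sum_congr rfl fun m _ => rid_lTensor_star _ _ (T.t_mem m r) _

/-- The matrix `t` in `sum_mul_twist` is inverted by the antipode; this is the signed counterpart of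
`coRight_mul_eq_antipode`. -/
theorem twist_coRight (r i n : ι) (a : H.Coord) :
    H.twist (T.parity n + T.parity r) (coRight (T.η i ∘ₗ LinearMap.mulLeft k (T.t n r)) a) =
      ∑ j, ∑ l, T.η l (T.t j r * a) • (H.antipode (T.t n j) * T.t l i) := by
  have h : ∀ j, ∑ l, T.η l (T.t j r * a) • (H.antipode (T.t n j) * T.t l i) =
      ∑ m, (H.antipode (T.t n j) * T.t j m) * H.twist (T.parity m + T.parity r)
      (coRight (T.η i ∘ₗ LinearMap.mulLeft k (T.t m r)) a) := by
    intro j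
    simp only [← mul_smul_comm, ← Finset.mul_sum, mul_assoc]
    rw [T.sum_mul_twist]
  simp only [h]
  rw [Finset.sum_comm]
  simp only [← Finset.sum_mul, T.antipode_mul]
  simp

theorem coRight_mem (r m : ι) {s : ZMod 2} {a : H.Coord} (ha : a ∈ H.gr (s + T.parity r)) :
    coRight (T.η m ∘ₗ LinearMap.mulLeft k (T.t m r)) a ∈ H.gr s := by
  refine tensorGr_induction (p := fun x => TensorProduct.rid k H.Coord (LinearMap.lTensor H.Coord
    (T.η m ∘ₗ LinearMap.mulLeft k (T.t m r)) x) ∈ H.gr s)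
    (fun x y hx hy => by rw [map_add, map_add]; exact add_mem hx hy) ?_ _ (H.comul_mem _ a ha)
  intro j p hp q hq
  simp only [LinearMap.lTensor_tmul, TensorProduct.rid_tmul, LinearMap.comp_apply,
    LinearMap.mulLeft_apply]
  by_cases hj : j = s
  · subst hj
    exact Submodule.smul_mem _ _ hp
  · rw [T.η_parity m _ _ (mul_mem (T.t_mem m r) hq), zero_smul]
    · exact zero_mem _
    · intro h
      apply hj
      have h2 : T.parity r + T.parity r = 0 := by
        rcases parity_cases (T.parity r) with h | h <;> rw [h] <;> rfl
      have h3 : s - j = 0 := by linear_combination h - h2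
      exact (sub_eq_zero.1 h3).symm

/-- By `twist_coRight`, `a₁ η_m(t_{mr} a₂)` is a combination of the products `S(t_{mj}) t_{lm}`.
Once the factors are exchanged, the sum over `m` of `t_{lm} S(t_{mj})` collapses to a Kronecker
delta. The exchange produces a sign, and the supertrace sign is the one that makes the total sign
independent of `m`. -/
theorem isLeftInvariant_strace (r : ι) : IsLeftInvariant (T.strace r) := by
  intro a
  refine homogeneous_induction
    (p := fun a => coRight (T.strace r) a = T.strace r a • (1 : H.Coord))
    (fun a b ha hb => by rw [map_add, map_add, add_smul, ha, hb]) ?_ a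
  intro i a ha
  obtain ⟨s, rfl⟩ : ∃ s, i = s + T.parity r := ⟨i - T.parity r, by ring⟩
  have h1 : coRight (T.strace r) a = ∑ m, sg k (T.parity m) •
      coRight (T.η m ∘ₗ LinearMap.mulLeft k (T.t m r)) a := by
    simp only [coRight, LinearMap.comp_apply, LinearEquiv.coe_coe]
    induction comul (R := k) a with
    | zero => simp
    | add x y hx hy => simp only [map_add, smul_add, Finset.sum_add_distrib, hx, hy]
    | tmul x y => simp [strace_apply, Finset.sum_smul, smul_smul]
  have h2 : ∀ m, coRight (T.η m ∘ₗ LinearMap.mulLeft k (T.t m r)) a =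
      sg k ((T.parity m + T.parity r) * s) •
        ∑ j, ∑ l, T.η l (T.t j r * a) • (H.antipode (T.t m j) * T.t l m) := by
    intro m
    rw [← T.twist_coRight, twist_of_mem _ (T.coRight_mem r m ha), smul_smul, sg_mul_self, one_smul]
  -- The sign on the right no longer involves `m`. Only those `l` matter for which the parity of `t
  -- j r * a` matches that of `η l`, since otherwise the coefficient is zero.
  have h3 : ∀ m j l, (sg k (T.parity m) * sg k ((T.parity m + T.parity r) * s)) •
      T.η l (T.t j r * a) • (H.antipode (T.t m j) * T.t l m) =
      sg k (T.parity j) • T.η l (T.t j r * a) • sg k (s * (T.parity r + T.parity j)) •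
        (T.t l m * H.antipode (T.t m j)) := by
    intro m j l
    by_cases hl : T.parity l = T.parity j + s
    · rw [supercomm_sg (H.antipode_mem _ _ (T.t_mem m j)) (T.t_mem l m), hl]
      simp only [smul_smul]
      congr 1
      have e : sg k (T.parity m) * sg k ((T.parity m + T.parity r) * s) *
          sg k ((T.parity m + T.parity j) * (T.parity j + s + T.parity m)) =
          sg k (T.parity j) * sg k (s * (T.parity r + T.parity j)) := by
        rw [← sg_add, ← sg_add, ← sg_add]
        congr 1
        exact (by decide : ∀ x y z s : ZMod 2,
          x + (x + y) * s + (x + z) * (z + s + x) = z + s * (y + z)) _ _ _ _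
      linear_combination T.η l (T.t j r * a) * e
    · rw [T.η_parity l _ _ (mul_mem (T.t_mem j r) ha)]
      · simp
      · intro h
        apply hl
        rw [← h]
        exact (by decide : ∀ y z s : ZMod 2, z + y + (s + y) = z + s) _ _ _
  rw [h1]
  simp only [h2, Finset.smul_sum, smul_smul]
  simp only [← smul_smul]
  simp only [smul_smul (sg k (T.parity _)) (sg k _), h3]
  rw [Finset.sum_comm]
  rw [strace_apply, Finset.sum_smul]
  refine Finset.sum_congr rfl fun j _ => ?_
  rw [Finset.sum_comm]
  simp only [← Finset.smul_sum, T.mul_antipode]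
  -- On the diagonal `l = j` the leftover sign is harmless: the coefficient vanishes unless `s = 0`.
  have h4 : sg k (s * (T.parity r + T.parity j)) * T.η j (T.t j r * a) =
      T.η j (T.t j r * a) := by
    by_cases hs : s = 0
    · subst hs
      simp [sg]
    · rw [T.η_parity j _ _ (mul_mem (T.t_mem j r) ha), mul_zero]
      intro h
      exact hs ((by decide : ∀ y z s : ZMod 2, z + y + (s + y) = z → s = 0) _ _ _ h)
  rw [Finset.sum_eq_single j]
  · rw [if_pos rfl, smul_smul, smul_smul]
    congr 1
    linear_combination sg k (T.parity j) * h4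
  · intro l _ hl
    rw [if_neg hl]
    simp
  · simp

/-- Since `∑ t_{mr} S(t_{ri})` is the identity matrix, `∑ strace_r(S(t_{ri}) a) = ± η_i(a)`, so the
supertraces recover `η i`. -/
theorem exists_strace_ne_zero {i : ι} (h : T.η i ≠ 0) : ∃ r, T.strace r ≠ 0 := by
  by_contra! hcon
  apply h
  ext a
  have h1 : ∑ r, T.strace r (H.antipode (T.t r i) * a) = 0 := by simp [hcon]
  simp only [strace_apply, ← mul_assoc] at h1
  rw [Finset.sum_comm] at h1
  simp only [← Finset.mul_sum, ← map_sum, ← Finset.sum_mul, T.mul_antipode] at h1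
  rw [Finset.sum_eq_single i] at h1
  · simpa [sg_ne_zero] using h1
  · intro b _ hb
    simp [hb]
  · simp

end MatrixMap

end Supergroup

/-! ### Matrix coefficients of maps to finite dimensional comodules -/

section

open Coalgebra WithConv Supergroup

namespace GModule

set_option maxSynthPendingDepth 3

variable {H : Supergroup k}

theorem exists_homogeneous_basis (J : GModule H) [FiniteDimensional k J.V] :
    ∃ (n : ℕ) (b : Module.Basis (Fin n) k J.V) (p : Fin n → ZMod 2),
      (∀ i, b i ∈ J.gr (p i)) ∧ ∀ i j, ∀ v ∈ J.gr j, j ≠ p i → b.coord i v = 0 := by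
  let b0 := Module.finBasis k (J.gr 0)
  let b1 := Module.finBasis k (J.gr 1)
  let E := Submodule.prodEquivOfIsCompl _ _ J.isCompl
  let b := ((b0.prod b1).map E).reindex finSumFinEquiv
  let p : Fin (Module.finrank k (J.gr 0) + Module.finrank k (J.gr 1)) → ZMod 2 :=
    fun i => Sum.elim (fun _ => (0 : ZMod 2)) (fun _ => 1) (finSumFinEquiv.symm i)
  refine ⟨_, b, p, ?_, ?_⟩
  · intro i
    obtain ⟨i, rfl⟩ := finSumFinEquiv.surjective i
    rcases i with i | i
    · simp [b, p, E]
    · simp [b, p, E]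
  · intro i j v hv hj
    obtain ⟨i, rfl⟩ := finSumFinEquiv.surjective i
    rcases i with i | i
    · obtain rfl : j = 1 := (parity_cases j).resolve_left (by simpa [p] using hj)
      have e : E.symm v = (0, ⟨v, hv⟩) := by
        rw [LinearEquiv.symm_apply_eq]
        simp [E]
      simp [b, e]
    · obtain rfl : j = 0 := (parity_cases j).resolve_right (by simpa [p] using hj)
      have e : E.symm v = (⟨v, hv⟩, 0) := by
        rw [LinearEquiv.symm_apply_eq]
        simp [E]
      simp [b, e]

theorem sum_coord_tmul {V W ι : Type*} [AddCommGroup V] [Module k V] [AddCommGroup W] [Module k W]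
    [Fintype ι] (b : Module.Basis ι k W) (x : V ⊗[k] W) :
    x = ∑ i, TensorProduct.rid k V (LinearMap.lTensor V (b.coord i) x) ⊗ₜ b i := by
  induction x with
  | zero => simp
  | add x y hx hy =>
    conv_lhs => rw [hx, hy]
    simp only [map_add, TensorProduct.add_tmul, Finset.sum_add_distrib]
  | tmul v w =>
    conv_lhs => rw [← b.sum_repr w, TensorProduct.tmul_sum]
    simp [TensorProduct.smul_tmul]

/-- A homomorphism from the regular representation, as a map on functions. -/
def Hom.ofRegular {J : GModule H} (r : Hom (regular H) J) : H.Coord →ₗ[k] J.V := r.toLin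

/-- The matrix coefficients of a comodule map to a finite dimensional comodule. -/
def matrixMap {J : GModule H} (r : Hom (regular H) J) {n : ℕ} (b : Module.Basis (Fin n) k J.V)
    (p : Fin n → ZMod 2) (hb : ∀ i, b i ∈ J.gr (p i))
    (hc : ∀ i j, ∀ v ∈ J.gr j, j ≠ p i → b.coord i v = 0) : MatrixMap H (Fin n) where
  parity := p
  t i j := TensorProduct.rid k H.Coord (LinearMap.lTensor H.Coord (b.coord j) (J.coact (b i)))
  η i := b.coord i ∘ₗ r.ofRegular
  t_mem i j := by
    refine tensorGr_induction (p := fun x => TensorProduct.rid k H.Coord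
      (LinearMap.lTensor H.Coord (b.coord j) x) ∈ H.gr (p i + p j))
      (fun x y hx hy => by rw [map_add, map_add]; exact add_mem hx hy) ?_ _
      (J.coact_mem _ _ (hb i))
    intro l a ha v hv
    rw [LinearMap.lTensor_tmul, TensorProduct.rid_tmul]
    by_cases h : p i - l = p j
    · have e : l = p i + p j := by
        rw [← h]
        exact (by decide : ∀ x y : ZMod 2, y = x + (x - y)) _ _
      rw [← e]
      exact Submodule.smul_mem _ _ ha
    · rw [hc j _ v hv h, zero_smul]
      exact zero_mem _
  t_comul i j := by
    have h := J.coassoc (b i)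
    have h2 := congrArg (fun x => TensorProduct.map LinearMap.id
      ((TensorProduct.rid k H.Coord).toLinearMap ∘ₗ LinearMap.lTensor H.Coord (b.coord j)) x) h
    beta_reduce at h2
    have e1 : ∀ x : H.Coord ⊗[k] J.V, TensorProduct.map LinearMap.id
        ((TensorProduct.rid k H.Coord).toLinearMap ∘ₗ LinearMap.lTensor H.Coord (b.coord j))
        (TensorProduct.assoc k H.Coord H.Coord J.V (LinearMap.rTensor J.V comul x)) =
        comul (TensorProduct.rid k H.Coord (LinearMap.lTensor H.Coord (b.coord j) x)) := by
      intro x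
      induction x with
      | zero => simp
      | add x y hx hy => simp only [map_add, hx, hy]
      | tmul a v =>
        simp only [LinearMap.rTensor_tmul, LinearMap.lTensor_tmul, TensorProduct.rid_tmul, map_smul]
        induction comul (R := k) a with
        | zero => simp
        | add x y hx hy => simp only [map_add, TensorProduct.add_tmul, smul_add, hx, hy]
        | tmul a c => simp
    rw [e1] at h2
    rw [h2]
    conv_lhs => rw [sum_coord_tmul b (J.coact (b i))]
    simp
  t_counit i j := by
    have h := congrArg (b.coord j) (J.counit_coact (b i))
    have e : ∀ x : H.Coord ⊗[k] J.V, b.coord j (TensorProduct.lid k J.V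
        (LinearMap.rTensor J.V (counit (R := k)) x)) =
        counit (R := k) (TensorProduct.rid k H.Coord (LinearMap.lTensor H.Coord (b.coord j) x)) := by
      intro x
      induction x with
      | zero => simp
      | add x y hx hy => simp only [map_add, hx, hy]
      | tmul a v => simp [mul_comm]
    rw [e] at h
    rw [h]
    simp [Finsupp.single_apply]
  coRight_η i x := by
    have h := r.equivariant x
    have h1 : coRight (b.coord i ∘ₗ r.ofRegular) x = TensorProduct.rid k H.Coord
        (LinearMap.lTensor H.Coord (b.coord i) (J.coact (r.toLin x))) := by
      rw [h, coRight, LinearMap.comp_apply, LinearMap.comp_apply, LinearMap.lTensor_comp]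
      rfl
    rw [h1]
    conv_lhs => rw [← b.sum_repr (r.toLin x)]
    simp only [map_sum, map_smul]
    rfl
  η_parity i j x hx hj := hc i j _ (r.even j x hx) hj

/-- A nonzero map has a nonzero coordinate in a homogeneous basis, and then one of the supertrace
functionals is nonzero. -/
theorem exists_isLeftInvariant {J : GModule H} [FiniteDimensional k J.V] (r : Hom (regular H) J)
    (hr : r.toLin ≠ 0) : ∃ Γ : H.Coord →ₗ[k] k, IsLeftInvariant Γ ∧ Γ ≠ 0 := by
  obtain ⟨n, b, p, hb, hc⟩ := J.exists_homogeneous_basis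
  let T := matrixMap r b p hb hc
  obtain ⟨i, hi⟩ : ∃ i, T.η i ≠ 0 := by
    by_contra! h
    apply hr
    ext x
    exact b.ext_elem fun i => (congrArg (fun f : H.Coord →ₗ[k] k => f x) (h i)).trans
      (map_zero (b.coord i)).symm
  obtain ⟨m, hm⟩ := T.exists_strace_ne_zero hi
  exact ⟨_, T.isLeftInvariant_strace m, hm⟩

end GModule

end

/-! ### Translations, the adjoint action and the top form -/

namespace Supergroup

open Coalgebra WithConv

set_option maxSynthPendingDepth 3

variable {H : Supergroup k}

theorem coRight_apply (u : Module.Dual k H.Coord) (a : H.Coord) :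
    coRight u a = TensorProduct.rid k H.Coord (LinearMap.lTensor H.Coord u (comul a)) := rfl

theorem apply_leftAct (u v : Module.Dual k H.Coord) (a : H.Coord) :
    u (H.leftAct v a) = v (coRight u a) := by
  rw [leftAct_apply, coRight_apply]
  induction comul (R := k) a with
  | zero => simp
  | add x y hx hy => simp only [map_add, hx, hy]
  | tmul x y => simp [mul_comm]

theorem comul_leftAct (u : Module.Dual k H.Coord) (a : H.Coord) :
    comul (R := k) (H.leftAct u a) = LinearMap.rTensor H.Coord (H.leftAct u) (comul a) := by
  have e1 : ∀ x : H.Coord ⊗[k] H.Coord, comul (R := k) (TensorProduct.lid k H.Coord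
      (LinearMap.rTensor H.Coord u x)) = TensorProduct.lid k _
      (LinearMap.rTensor _ u (LinearMap.lTensor H.Coord comul x)) := by
    intro x
    induction x with
    | zero => simp
    | add x y hx hy => simp only [map_add, hx, hy]
    | tmul a b => simp
  have e2 : ∀ x : H.Coord ⊗[k] H.Coord, TensorProduct.lid k _
      (LinearMap.rTensor _ u (TensorProduct.assoc k _ _ _ (LinearMap.rTensor H.Coord comul x))) =
      LinearMap.rTensor H.Coord (H.leftAct u) x := by
    intro x
    induction x with
    | zero => simp
    | add x y hx hy => simp only [map_add, hx, hy]
    | tmul a b =>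
      rw [LinearMap.rTensor_tmul, LinearMap.rTensor_tmul, leftAct_apply]
      induction comul (R := k) a with
      | zero => simp
      | add x y hx hy => simp only [map_add, TensorProduct.add_tmul, hx, hy]
      | tmul p q => simp [TensorProduct.smul_tmul']
  rw [leftAct_apply, e1, ← coassoc_apply, e2]

theorem comul_coRight (u : Module.Dual k H.Coord) (a : H.Coord) :
    comul (R := k) (coRight u a) = LinearMap.lTensor H.Coord (coRight u) (comul a) := by
  have e1 : ∀ x : H.Coord ⊗[k] H.Coord, comul (R := k) (TensorProduct.rid k H.Coord
      (LinearMap.lTensor H.Coord u x)) = LinearMap.lTensor H.Coord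
      ((TensorProduct.rid k H.Coord).toLinearMap ∘ₗ LinearMap.lTensor H.Coord u)
      (TensorProduct.assoc k _ _ _ (LinearMap.rTensor H.Coord comul x)) := by
    intro x
    induction x with
    | zero => simp
    | add x y hx hy => simp only [map_add, hx, hy]
    | tmul a b =>
      simp only [LinearMap.rTensor_tmul, LinearMap.lTensor_tmul, TensorProduct.rid_tmul, map_smul]
      induction comul (R := k) a with
      | zero => simp
      | add x y hx hy => simp only [map_add, TensorProduct.add_tmul, smul_add, hx, hy]
      | tmul p q => simp
  rw [coRight_apply, e1, coassoc_apply, ← LinearMap.comp_apply, ← LinearMap.lTensor_comp]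
  rfl

theorem leftAct_coRight (u v : Module.Dual k H.Coord) (a : H.Coord) :
    H.leftAct u (coRight v a) = coRight v (H.leftAct u a) := by
  have e : ∀ x : H.Coord ⊗[k] H.Coord, TensorProduct.lid k H.Coord (LinearMap.rTensor H.Coord u
      (LinearMap.lTensor H.Coord (coRight v) x)) = coRight v (TensorProduct.lid k H.Coord
      (LinearMap.rTensor H.Coord u x)) := by
    intro x
    induction x with
    | zero => simp
    | add x y hx hy => simp only [map_add, hx, hy]
    | tmul p q => simp
  rw [leftAct_apply, comul_coRight, e, leftAct_apply]

/-- `Ad(g) y` is the functional `a ↦ y(g(a₁) a₂ g⁻¹(a₃))`. -/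
theorem Ad_apply (g : H.Point) (y : Module.Dual k H.Coord) (a : H.Coord) :
    H.Ad g y a = y (H.leftAct g.toLinearMap (coRight (H.pointInv g) a)) := by
  rw [apply_leftAct]
  have e1 : ∀ u v : Module.Dual k H.Coord, ∀ a, H.conv u v a = u (coRight v a) := by
    intro u v a
    rw [coRight_apply, conv, LinearMap.comp_apply, LinearMap.comp_apply]
    induction comul (R := k) a with
    | zero => simp
    | add x y hx hy => simp only [map_add, hx, hy]
    | tmul x y => simp [mul_comm]
  change H.conv (H.conv g.toLinearMap y) (H.pointInv g) a = _
  rw [e1, e1]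

/-! ### Translations by points -/

section Points

variable (g : H.Point)

/-- The inverse of a point. -/
def inv [CharZero k] : H.Point :=
  AlgHom.ofLinearMap (H.pointInv g) (by simp [pointInv, antipode_one])
    (algHom_antipode_mul g fun _ ha => point_odd g ha)

/-- Right translation of functions. -/
def coRightHom [CharZero k] : H.Coord →ₐ[k] H.Coord :=
  (Algebra.TensorProduct.rid k k H.Coord).toAlgHom.comp
    (comulHomRight g (fun _ ha => point_odd g ha) (AlgHom.id k H.Coord))

/-- Left translation of functions. -/
def leftActHom [CharZero k] : H.Coord →ₐ[k] H.Coord :=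
  (Algebra.TensorProduct.lid k H.Coord).toAlgHom.comp
    (comulHomLeft g (fun _ ha => point_odd g ha) (AlgHom.id k H.Coord))

theorem coRight_point_mem [CharZero k] {i : ZMod 2} {a : H.Coord} (ha : a ∈ H.gr i) :
    coRight g.toLinearMap a ∈ H.gr i := by
  refine tensorGr_induction (p := fun x => TensorProduct.rid k H.Coord
    (LinearMap.lTensor H.Coord g.toLinearMap x) ∈ H.gr i) (fun x y hx hy => by
      rw [map_add, map_add]; exact add_mem hx hy) ?_ _ (H.comul_mem i a ha)
  intro j p hp q hq
  rw [LinearMap.lTensor_tmul, TensorProduct.rid_tmul]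
  rcases parity_cases (i - j) with h | h
  · rw [sub_eq_zero.1 h]
    exact Submodule.smul_mem _ _ hp
  · rw [h] at hq
    rw [AlgHom.toLinearMap_apply, point_odd g hq, zero_smul]
    exact zero_mem _

theorem leftAct_point_mem [CharZero k] {i : ZMod 2} {a : H.Coord} (ha : a ∈ H.gr i) :
    H.leftAct g.toLinearMap a ∈ H.gr i := by
  refine tensorGr_induction (p := fun x => TensorProduct.lid k H.Coord
    (LinearMap.rTensor H.Coord g.toLinearMap x) ∈ H.gr i) (fun x y hx hy => by
      rw [map_add, map_add]; exact add_mem hx hy) ?_ _ (H.comul_mem i a ha)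
  intro j p hp q hq
  rw [LinearMap.rTensor_tmul, TensorProduct.lid_tmul]
  rcases parity_cases j with rfl | rfl
  · rw [sub_zero] at hq
    exact Submodule.smul_mem _ _ hq
  · rw [AlgHom.toLinearMap_apply, point_odd g hp, zero_smul]
    exact zero_mem _

theorem counit_conj (a : H.Coord) : counit (R := k)
    (H.leftAct g.toLinearMap (coRight (H.pointInv g) a)) = counit (R := k) a := by
  have h := congrArg (fun f : WithConv (H.Coord →ₗ[k] k) => f a) (algHom_conv_antipode g)
  refine Eq.trans ?_ h
  change _ = LinearMap.mul' k k (TensorProduct.map g.toLinearMap (H.pointInv g) (comul a))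
  rw [apply_leftAct]
  have e1 : coRight (counit (R := k)) (coRight (H.pointInv g) a) = coRight (H.pointInv g) a := by
    rw [coRight_apply counit, lTensor_counit_comul]
    simp
  rw [e1, coRight_apply]
  induction comul (R := k) a with
  | zero => simp
  | add x y hx hy => simp only [map_add, hx, hy]
  | tmul x y => simp [mul_comm]

/-- Conjugation by a point is a parity preserving algebra homomorphism of `k[H]` that fixes the
counit, because points kill odd functions. -/
theorem Ad_mem_oddLie [CharZero k] {y : Module.Dual k H.Coord} (hy : y ∈ H.oddLie) :
    H.Ad g y ∈ H.oddLie := by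
  refine ⟨fun a b => ?_, (Submodule.mem_dualAnnihilator _).2 fun a ha => ?_⟩
  · have hmul : ∀ a b : H.Coord, H.leftAct g.toLinearMap (coRight (H.pointInv g) (a * b)) =
        H.leftAct g.toLinearMap (coRight (H.pointInv g) a) *
          H.leftAct g.toLinearMap (coRight (H.pointInv g) b) := fun a b =>
      map_mul ((leftActHom g).comp (coRightHom (inv g))) a b
    rw [Ad_apply, Ad_apply, Ad_apply, hmul, oddLie_mul hy, counit_conj, counit_conj]
  · rw [Ad_apply]
    exact oddLie_even hy (leftAct_point_mem g (coRight_point_mem (inv g) ha))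

/-- Left invariant forms are invariant under left translations. -/
theorem leftAct_leftFrame [CharZero k] (i : Fin H.oddRank) :
    H.leftAct g.toLinearMap (leftFrame i) = leftFrame i := by
  have h := congrArg (fun x => TensorProduct.lid k H.Coord (LinearMap.rTensor H.Coord
    (evenLift g fun _ ha => point_odd g ha).toLinearMap x)) (evenCoact_leftFrame i)
  beta_reduce at h
  rw [evenCoact_apply, ← LinearMap.comp_apply (LinearMap.rTensor _ _), ← LinearMap.rTensor_comp,
    LinearMap.rTensor_tmul, AlgHom.toLinearMap_apply, map_one, TensorProduct.lid_tmul,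
    one_smul] at h
  exact h

/-- Apply `v` to the second leg of the invariance `evenCoact_leftFrame`: along `H₀` the result is
constant. -/
theorem evenMk_coRight_leftFrame (v : Module.Dual k H.Coord) (i : Fin H.oddRank) :
    H.evenMk (coRight v (leftFrame i)) = algebraMap k _ (v (leftFrame i)) := by
  have h := congrArg (fun x => TensorProduct.rid k H.EvenRing (LinearMap.lTensor H.EvenRing v x))
    (evenCoact_leftFrame i)
  beta_reduce at h
  rw [evenCoact_apply, LinearMap.lTensor_tmul, TensorProduct.rid_tmul,
    ← Algebra.algebraMap_eq_smul_one] at h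
  rw [← h, coRight_apply]
  induction comul (R := k) (leftFrame i) with
  | zero => simp
  | add x y hx hy => simp only [map_add, hx, hy]
  | tmul x y => simp

/-- Right translation acts on the left invariant frame through the adjoint representation. -/
theorem coRight_leftFrame_sub_mem [CharZero k] (j : Fin H.oddRank) :
    coRight (H.pointInv g) (leftFrame j) -
      ∑ i, H.Ad g (oddVec i) (leftFrame j) • leftFrame i ∈ H.filt 2 := by
  have hodd : coRight (H.pointInv g) (leftFrame j) ∈ H.gr 1 :=
    coRight_point_mem (inv g) (leftFrame_mem j)
  have h := pr_one_sub_leftFrame_mem (coRight (H.pointInv g) (leftFrame j))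
  rw [pr_of_mem hodd] at h
  -- The coefficient of an odd frame element matters only modulo `I`. There it is a constant, which
  -- left invariance of the frame identifies with `Ad(g) yᵢ` evaluated at the frame.
  have h2 : ∀ i : Fin H.oddRank, H.rightAct (oddVec i) (coRight (H.pointInv g) (leftFrame j)) *
      leftFrame i - H.Ad g (oddVec i) (leftFrame j) • leftFrame i ∈ H.filt 2 := by
    intro i
    rw [← one_mul (leftFrame i), ← smul_mul_assoc, one_mul, ← sub_mul]
    refine mul_mem_filt (m := 1) (n := 1) ?_ (odd_mem_filt (leftFrame_mem i))
    have e : H.rightAct (oddVec i) (coRight (H.pointInv g) (leftFrame j)) =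
        coRight (oddVec i ∘ₗ coRight (H.pointInv g)) (leftFrame j) := coRight_coRight _ _ _
    rw [mem_filt_one_iff, map_sub, e, evenMk_coRight_leftFrame, map_smul, map_one,
      ← Algebra.algebraMap_eq_smul_one, Ad_apply, leftAct_coRight, leftAct_leftFrame, sub_eq_zero]
    rfl
  have h3 := add_mem h (sum_mem (t := Finset.univ) fun i _ => h2 i)
  rwa [Finset.sum_sub_distrib, sub_add_sub_cancel] at h3

end Points

/-- Replace the factors one at a time: each replacement trades an odd factor for an element of `I²`,
which gains one power of `I`. -/
theorem list_prod_sub_mem {n : ℕ} {v w : Fin n → H.Coord} (hv : ∀ i, v i ∈ H.gr 1)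
    (hw : ∀ i, w i ∈ H.gr 1) (h : ∀ i, v i - w i ∈ H.filt 2) :
    (List.ofFn v).prod - (List.ofFn w).prod ∈ H.filt (n + 1) := by
  induction n with
  | zero => simp
  | succ n ih =>
    rw [List.ofFn_succ, List.ofFn_succ, List.prod_cons, List.prod_cons]
    set x := (List.ofFn fun i => v i.succ).prod
    set y := (List.ofFn fun i => w i.succ).prod
    have e : v 0 * x - w 0 * y = (v 0 - w 0) * x + w 0 * (x - y) := by noncomm_ring
    rw [e]
    have h1 := mul_mem_filt (h 0) (list_prod_mem_filt (fun i => v i.succ) fun i => hv _)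
    have h2 := mul_mem_filt (odd_mem_filt (hw 0))
      (ih (v := fun i => v i.succ) (w := fun i => w i.succ) (fun i => hv _) (fun i => hw _)
        fun i => h _)
    have e1 : 2 + n = n + 1 + 1 := by omega
    have e2 : 1 + (n + 1) = n + 1 + 1 := by omega
    exact add_mem (e1 ▸ h1) (e2 ▸ h2)

/-- Right translation multiplies the top form by a determinant. -/
theorem apply_coRight_topForm [CharZero k] (g : H.Point) (Γ : H.Coord →ₗ[k] k) :
    Γ (coRight (H.pointInv g) H.topForm) =
      (Matrix.of fun j i => H.Ad g (oddVec i) (leftFrame j)).det * Γ H.topForm := by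
  let L : (Fin H.oddRank → k) →ₗ[k] H.gr 1 :=
    ∑ i, (LinearMap.proj i).smulRight ⟨leftFrame i, leftFrame_mem i⟩
  have hL : ∀ w, ((L w : H.gr 1) : H.Coord) = ∑ i, w i • leftFrame i := by
    intro w
    simp [L, LinearMap.sum_apply]
  let M : Matrix (Fin H.oddRank) (Fin H.oddRank) k :=
    Matrix.of fun j i => H.Ad g (oddVec i) (leftFrame j)
  have h1 : coRight (H.pointInv g) H.topForm = (List.ofFn fun j =>
      coRight (H.pointInv g) (leftFrame j)).prod := by
    change coRightHom (inv g) _ = _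
    rw [topForm, map_list_prod, List.map_ofFn]
    rfl
  -- The translated frame agrees with its linear part modulo `I²`, and the product of `N` factors
  -- does not see the difference because `I^(N+1) = 0`.
  have h2 : (List.ofFn fun j => coRight (H.pointInv g) (leftFrame j)).prod =
      (List.ofFn fun j => ((L (M j) : H.gr 1) : H.Coord)).prod := by
    have h := list_prod_sub_mem (H := H) (v := fun j => coRight (H.pointInv g) (leftFrame j))
      (w := fun j => ((L (M j) : H.gr 1) : H.Coord))
      (fun j => coRight_point_mem (inv g) (leftFrame_mem j)) (fun j => (L (M j)).2) (fun j => by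
        rw [hL]
        exact coRight_leftFrame_sub_mem g j)
    rw [filt_oddRank_succ, Submodule.mem_bot, sub_eq_zero] at h
    exact h
  -- An alternating form of top degree on `k^N`. Its value on the rows of `M` is `det M` times its
  -- value on the standard basis, where it is `Γ` of the top form.
  let Θ : (Fin H.oddRank → k) [⋀^Fin H.oddRank]→ₗ[k] k :=
    Γ.compAlternatingMap ((H.oddProd H.oddRank).compLinearMap L)
  have h3 : Θ M = M.det * Θ (Pi.basisFun k (Fin H.oddRank)) := by
    have h := congrArg (fun f : (Fin H.oddRank → k) [⋀^Fin H.oddRank]→ₗ[k] k => f fun i => M i)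
      (Θ.eq_smul_basis_det (Pi.basisFun k (Fin H.oddRank)))
    rw [Pi.basisFun_det] at h
    exact h.trans (mul_comm _ _)
  have h4 : Θ (Pi.basisFun k (Fin H.oddRank)) = Γ H.topForm := by
    have e : ∀ i, L (Pi.basisFun k (Fin H.oddRank) i) = ⟨leftFrame i, leftFrame_mem i⟩ := by
      intro i
      apply Subtype.ext
      simp [hL, Pi.single_apply]
    change Γ (H.oddProd H.oddRank fun i => L (Pi.basisFun k (Fin H.oddRank) i)) = _
    simp only [e, topForm_eq]
  rw [h1, h2, ← h4, ← h3]
  change _ = Γ (H.oddProd H.oddRank fun i => L (M i))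
  rw [oddProd_apply]

/-- By `oddLie_leftForm` the left frame is dual to the basis, so these entries form the matrix of
`Ad g` on `𝔥₁`. -/
theorem det_Ad_oddLie [CharZero k] (g : H.Point) :
    H.HasAdDet g H.oddLie (Matrix.of fun j i => H.Ad g (oddVec i) (leftFrame j)).det := by
  refine ⟨fun u hu => Ad_mem_oddLie g hu, ?_⟩
  rw [← LinearMap.det_toMatrix H.oddBasis]
  congr 1
  ext j i
  rw [LinearMap.toMatrix_apply, Matrix.of_apply]
  have h := H.oddBasis.sum_repr ((H.Ad g).restrict (fun u hu => Ad_mem_oddLie g hu) (H.oddBasis i))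
  have h2 := congrArg (fun z : H.oddLie => (z : Module.Dual k H.Coord) (leftFrame j)) h
  have e : ∀ l, (H.oddBasis l : Module.Dual k H.Coord) (leftFrame j) = if l = j then 1 else 0 := by
    intro l
    exact (oddLie_leftForm (oddVec_mem l) _).trans (oddVec_oddCoord l j)
  simp only [Submodule.coe_sum, Submodule.coe_smul, LinearMap.sum_apply, LinearMap.smul_apply, e,
    smul_eq_mul, mul_ite, mul_one, mul_zero, Finset.sum_ite_eq', Finset.mem_univ, if_true] at h2
  rw [h2]
  rfl

end Supergroup

namespace Supergroup

open Coalgebra WithConv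

set_option maxSynthPendingDepth 3

variable {H : Supergroup k}

/-! ### The modular character -/

theorem _root_.IsLeftInvariant.sub_smul {Γ Γ' : H.Coord →ₗ[k] k} (hΓ : IsLeftInvariant Γ)
    (hΓ' : IsLeftInvariant Γ') (c : k) : IsLeftInvariant (Γ' - c • Γ) := by
  intro b
  have h : coRight (Γ' - c • Γ) b = coRight Γ' b - c • coRight Γ b := by
    simp only [coRight, LinearMap.lTensor_sub, LinearMap.lTensor_smul, LinearMap.comp_apply,
      LinearMap.sub_apply, LinearMap.smul_apply, map_sub, map_smul]
  rw [h, hΓ, hΓ', LinearMap.sub_apply, LinearMap.smul_apply, _root_.sub_smul,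
    smul_assoc]

theorem _root_.IsLeftInvariant.comp_coRight {Γ : H.Coord →ₗ[k] k} (hΓ : IsLeftInvariant Γ)
    (u : H.Coord →ₗ[k] k) : IsLeftInvariant (Γ ∘ₗ coRight u) := by
  intro b
  rw [← coRight_coRight, hΓ, LinearMap.comp_apply]

/-- The component of parity `i` of an invariant functional is again invariant because the function
`1` is even. -/
theorem _root_.IsLeftInvariant.comp_pr {Γ : H.Coord →ₗ[k] k} (hΓ : IsLeftInvariant Γ)
    (i : ZMod 2) : IsLeftInvariant (Γ ∘ₗ H.pr i) := by
  intro b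
  refine homogeneous_induction (p := fun b => coRight (Γ ∘ₗ H.pr i) b = (Γ ∘ₗ H.pr i) b • (1 : H.Coord))
    (fun a b ha hb => by rw [map_add, map_add, add_smul, ha, hb]) ?_ b
  intro j b hb
  have h : coRight (Γ ∘ₗ H.pr i) b = H.pr (j - i) (coRight Γ b) := by
    rw [coRight_apply, coRight_apply]
    refine tensorGr_induction (p := fun x => TensorProduct.rid k H.Coord
      (LinearMap.lTensor H.Coord (Γ ∘ₗ H.pr i) x) = H.pr (j - i) (TensorProduct.rid k H.Coord
      (LinearMap.lTensor H.Coord Γ x))) (fun x y hx hy => by simp only [map_add, hx, hy]) ?_ _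
      (H.comul_mem j b hb)
    intro l p hp q hq
    by_cases hl : j - l = i
    · have hl' : l = j - i := by rw [← hl]; ring
      rw [hl] at hq
      rw [hl'] at hp
      simp [pr_of_mem hq, pr_of_mem hp]
    · have hl' : l ≠ j - i := fun h => hl (by rw [h]; ring)
      simp [pr_of_mem_ne hq hl, pr_of_mem_ne hp hl']
  rw [h, hΓ, map_smul, LinearMap.comp_apply]
  by_cases hij : j = i
  · subst hij
    rw [sub_self, pr_of_mem one_mem, pr_of_mem hb]
  · rw [pr_of_mem_ne hb hij, pr_of_mem_ne one_mem (Ne.symm (sub_ne_zero.2 hij)), smul_zero, map_zero,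
      zero_smul]

variable {Γ : H.Coord →ₗ[k] k}

/-- The character by which `H` acts on the left invariant functionals by right translations. -/
def modularChar (Γ : H.Coord →ₗ[k] k) : H.Coord := (Γ H.topForm)⁻¹ • H.leftAct Γ H.topForm

theorem apply_topForm_ne_zero [CharZero k] (hΓ : IsLeftInvariant Γ) (h0 : Γ ≠ 0) :
    Γ H.topForm ≠ 0 := fun h => h0 (hΓ.eq_zero_of_topForm h)

theorem eq_smul_of_isLeftInvariant [CharZero k] (hΓ : IsLeftInvariant Γ) (h0 : Γ ≠ 0)
    {Γ' : H.Coord →ₗ[k] k} (hΓ' : IsLeftInvariant Γ') :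
    Γ' = (Γ' H.topForm * (Γ H.topForm)⁻¹) • Γ := by
  rw [← sub_eq_zero]
  refine (hΓ.sub_smul hΓ' _).eq_zero_of_topForm ?_
  rw [LinearMap.sub_apply, LinearMap.smul_apply, smul_eq_mul,
    inv_mul_cancel_right₀ (apply_topForm_ne_zero hΓ h0), sub_self]

/-- A right translate of an invariant functional is invariant, hence a multiple of `Γ`; the
multiplier is read off at the top form. -/
theorem apply_coRight [CharZero k] (hΓ : IsLeftInvariant Γ) (h0 : Γ ≠ 0)
    (u : H.Coord →ₗ[k] k) (a : H.Coord) :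
    Γ (coRight u a) = u (modularChar Γ) * Γ a := by
  have h := eq_smul_of_isLeftInvariant hΓ h0 (hΓ.comp_coRight u)
  have h2 := congrArg (fun f : H.Coord →ₗ[k] k => f a) h
  rw [LinearMap.comp_apply] at h2
  refine h2.trans ?_
  rw [LinearMap.smul_apply, smul_eq_mul, modularChar, map_smul, smul_eq_mul, apply_leftAct,
    LinearMap.comp_apply, mul_comm (Γ H.topForm)⁻¹]

theorem leftAct_eq_smul_modularChar [CharZero k] (hΓ : IsLeftInvariant Γ) (h0 : Γ ≠ 0)
    (a : H.Coord) : H.leftAct Γ a = Γ a • modularChar Γ := by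
  rw [← sub_eq_zero, ← Module.forall_dual_apply_eq_zero_iff k]
  intro u
  rw [map_sub, apply_leftAct, apply_coRight hΓ h0, map_smul, smul_eq_mul, mul_comm, sub_self]

/-- Left translation by `Γ` acts on the first leg of `Δ` only, and there it gives multiples of `χ`;
so `Δ(Γ(ω₁) ω₂) = χ ⊗ Γ(ω₁) ω₂`. The counit is found by translating with the identity. -/
theorem isGroupLikeElem_modularChar [CharZero k] (hΓ : IsLeftInvariant Γ) (h0 : Γ ≠ 0) :
    IsGroupLikeElem k (modularChar Γ) where
  counit_eq_one := by
    have h := apply_coRight hΓ h0 counit H.topForm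
    have e1 : coRight (counit (R := k)) H.topForm = H.topForm := by
      rw [coRight_apply, lTensor_counit_comul]
      simp
    rw [e1] at h
    exact (mul_eq_right₀ (apply_topForm_ne_zero hΓ h0)).1 h.symm
  comul_eq_tmul_self := by
    have h := comul_leftAct Γ H.topForm
    have e : ∀ x : H.Coord ⊗[k] H.Coord, LinearMap.rTensor H.Coord (H.leftAct Γ) x =
        modularChar Γ ⊗ₜ TensorProduct.lid k H.Coord (LinearMap.rTensor H.Coord Γ x) := by
      intro x
      induction x with
      | zero => simp
      | add x y hx hy => simp only [map_add, TensorProduct.tmul_add, hx, hy]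
      | tmul a b => simp [leftAct_eq_smul_modularChar hΓ h0 a, TensorProduct.smul_tmul]
    rw [e, ← leftAct_apply] at h
    conv_lhs => rw [modularChar, map_smul, h, ← TensorProduct.tmul_smul]
    rfl

/-- The component of `Γ` in the parity of `ω` has the same value at `ω` as `Γ`, so by uniqueness `Γ`
is homogeneous of that parity. Then `Γ(ω₁) ω₂` is even. -/
theorem modularChar_mem [CharZero k] (hΓ : IsLeftInvariant Γ) (h0 : Γ ≠ 0) : modularChar Γ ∈ H.gr 0 := by
  have h1 : Γ ∘ₗ H.pr (H.oddRank : ZMod 2) = Γ := by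
    have h := eq_smul_of_isLeftInvariant hΓ h0 (hΓ.comp_pr (H.oddRank : ZMod 2))
    rwa [LinearMap.comp_apply, pr_of_mem topForm_mem_gr,
      mul_inv_cancel₀ (apply_topForm_ne_zero hΓ h0), one_smul] at h
  refine Submodule.smul_mem _ _ ?_
  rw [leftAct_apply]
  refine tensorGr_induction (p := fun x => TensorProduct.lid k H.Coord
    (LinearMap.rTensor H.Coord Γ x) ∈ H.gr 0) (fun x y hx hy => by
      rw [map_add, map_add]; exact add_mem hx hy) ?_ _ (H.comul_mem _ _ topForm_mem_gr)
  intro j p hp q hq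
  rw [LinearMap.rTensor_tmul, TensorProduct.lid_tmul]
  by_cases hj : j = H.oddRank
  · rw [hj, sub_self] at hq
    exact Submodule.smul_mem _ _ hq
  · rw [← h1, LinearMap.comp_apply, pr_of_mem_ne hp hj, map_zero, zero_smul]
    exact zero_mem _

theorem antipode_mul_of_isGroupLikeElem {χ : H.Coord} (hχ : IsGroupLikeElem k χ) :
    H.antipode χ * χ = 1 := by
  have h := H.antipode_left χ
  rw [hχ.comul_eq_tmul_self, hχ.counit_eq_one, map_one] at h
  simpa using h

theorem mul_antipode_of_isGroupLikeElem {χ : H.Coord} (hχ : IsGroupLikeElem k χ) :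
    χ * H.antipode χ = 1 := by
  have h := H.antipode_right χ
  rw [hχ.comul_eq_tmul_self, hχ.counit_eq_one, map_one] at h
  simpa using h

/-- Compute `Γ` of the translate of `ω` by `g⁻¹` twice: uniqueness gives the factor `χ(g⁻¹)`, and
the action on the frame gives `det Ad(g)`. -/
theorem exists_hasAdDet [CharZero k] (hΓ : IsLeftInvariant Γ) (h0 : Γ ≠ 0)
    (g : H.Point) : ∃ d, H.HasAdDet g H.oddLie d ∧ g (modularChar Γ) = d⁻¹ := by
  refine ⟨_, det_Ad_oddLie g, ?_⟩
  have h := apply_coRight hΓ h0 (H.pointInv g) H.topForm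
  rw [apply_coRight_topForm, mul_left_inj' (apply_topForm_ne_zero hΓ h0)] at h
  rw [h, ← one_div]
  refine eq_one_div_of_mul_eq_one_right ?_
  have h2 := congrArg g (antipode_mul_of_isGroupLikeElem (isGroupLikeElem_modularChar hΓ h0))
  rwa [map_mul, map_one] at h2

/-- `a ↦ Γ(χ a)` is right semi-invariant for a character `χ`. -/
theorem coRight_comp_mulLeft (hΓ : IsLeftInvariant Γ) {χ : H.Coord} (hχ : IsGroupLikeElem k χ)
    (hχ0 : χ ∈ H.gr 0)
    (a : H.Coord) :
    coRight (Γ ∘ₗ LinearMap.mulLeft k χ) a = Γ (χ * a) • H.antipode χ := by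
  have h := hΓ (χ * a)
  rw [coRight_apply, comul_mul_eq_star, hχ.comul_eq_tmul_self, rid_lTensor_star Γ χ hχ0,
    ← coRight_apply] at h
  have h2 := congrArg (fun x => H.antipode χ * x) h
  simp only [twist, if_true, LinearMap.id_apply, ← mul_assoc, antipode_mul_of_isGroupLikeElem hχ,
    one_mul, mul_smul_comm, mul_one] at h2
  exact h2

/-- `a ↦ Γ(χ a)` is invariant under left translations if `χ` is the modular character. -/
theorem leftAct_comp_mulLeft [CharZero k] (hΓ : IsLeftInvariant Γ) (h0 : Γ ≠ 0)
    (a : H.Coord) :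
    H.leftAct (Γ ∘ₗ LinearMap.mulLeft k (modularChar Γ)) a = Γ (modularChar Γ * a) • 1 := by
  have hχ := isGroupLikeElem_modularChar hΓ h0
  set χ := modularChar Γ with hdef
  have h := leftAct_eq_smul_modularChar hΓ h0 (χ * a)
  rw [leftAct_apply, comul_mul_eq_star, hχ.comul_eq_tmul_self] at h
  have e : ∀ x : H.Coord ⊗[k] H.Coord, TensorProduct.lid k H.Coord (LinearMap.rTensor H.Coord Γ
      (H.star (χ ⊗ₜ χ) x)) = χ * TensorProduct.lid k H.Coord
      (LinearMap.rTensor H.Coord (Γ ∘ₗ LinearMap.mulLeft k χ) x) := by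
    intro x
    refine tensor_induction (p := fun x => TensorProduct.lid k H.Coord
      (LinearMap.rTensor H.Coord Γ (H.star (χ ⊗ₜ χ) x)) = χ * TensorProduct.lid k H.Coord
      (LinearMap.rTensor H.Coord (Γ ∘ₗ LinearMap.mulLeft k χ) x))
      (fun x y hx hy => by simp only [star_add, map_add, mul_add, hx, hy]) ?_ x
    intro i j p hp q hq
    rw [star_tmul_even_left _ _ (modularChar_mem hΓ h0)]
    simp [hdef]
  rw [e, ← leftAct_apply, ← hdef] at h
  have h2 := congrArg (fun x => H.antipode χ * x) h
  simp only [← mul_assoc, antipode_mul_of_isGroupLikeElem hχ, one_mul, mul_smul_comm] at h2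
  exact h2

end Supergroup

/-! ### Comodules: gradings, submodules, matrix coefficients and semi-invariant functionals -/

section

open Coalgebra WithConv Supergroup

set_option maxSynthPendingDepth 3

theorem mem_range_lTensor_ker {A V W : Type*} [AddCommGroup A] [Module k A] [AddCommGroup V]
    [Module k V] [AddCommGroup W] [Module k W] (f : V →ₗ[k] W) {x : A ⊗[k] V}
    (hx : LinearMap.lTensor A f x = 0) :
    x ∈ LinearMap.range (LinearMap.lTensor A (LinearMap.ker f).subtype) :=
  (Module.Flat.lTensor_exact A f.exact_subtype_ker_map x).1 hx

theorem eq_zero_of_lid_rTensor {A V : Type*} [AddCommGroup A] [Module k A] [AddCommGroup V]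
    [Module k V] {x : A ⊗[k] V}
    (hx : ∀ u : Module.Dual k A, TensorProduct.lid k V (LinearMap.rTensor V u x) = 0) : x = 0 := by
  classical
  let b := Module.Basis.ofVectorSpace k A
  apply (TensorProduct.equivFinsuppOfBasisLeft b).injective
  ext i
  rw [map_zero, TensorProduct.equivFinsuppOfBasisLeft_apply]
  exact hx _

/-- Functionals on `A` separate the elements of `A ⊗ (V ⧸ W)`, so stability under a coaction can be
tested by contracting its first leg. -/
theorem mem_range_lTensor_subtype {A V : Type*} [AddCommGroup A] [Module k A] [AddCommGroup V]
    [Module k V] (W : Submodule k V) {x : A ⊗[k] V}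
    (hx : ∀ u : Module.Dual k A, TensorProduct.lid k V (LinearMap.rTensor V u x) ∈ W) :
    x ∈ LinearMap.range (LinearMap.lTensor A W.subtype) := by
  have h : LinearMap.lTensor A W.mkQ x = 0 := by
    refine eq_zero_of_lid_rTensor fun u => ?_
    have e : ∀ x : A ⊗[k] V, TensorProduct.lid k (V ⧸ W) (LinearMap.rTensor (V ⧸ W) u
        (LinearMap.lTensor A W.mkQ x)) = W.mkQ (TensorProduct.lid k V (LinearMap.rTensor V u x)) := by
      intro x
      induction x with
      | zero => simp
      | add x y hx hy => simp only [map_add, hx, hy]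
      | tmul a v => simp
    rw [e]
    exact (Submodule.Quotient.mk_eq_zero W).2 (hx u)
  have h2 := mem_range_lTensor_ker W.mkQ h
  rwa [Submodule.ker_mkQ] at h2

theorem exists_finiteDimensional_lid_rTensor {A V : Type*} [AddCommGroup A] [Module k A]
    [AddCommGroup V] [Module k V] (x : A ⊗[k] V) : ∃ S : Submodule k V, FiniteDimensional k S ∧
      ∀ u : Module.Dual k A, TensorProduct.lid k V (LinearMap.rTensor V u x) ∈ S := by
  induction x with
  | zero => exact ⟨⊥, inferInstance, fun u => by simp⟩
  | add x y hx hy =>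
    obtain ⟨S, hS, hxS⟩ := hx
    obtain ⟨T, hT, hyT⟩ := hy
    refine ⟨S ⊔ T, inferInstance, fun u => ?_⟩
    rw [map_add, map_add]
    exact Submodule.add_mem_sup (hxS u) (hyT u)
  | tmul a v =>
    refine ⟨Submodule.span k {v}, inferInstance, fun u => ?_⟩
    rw [LinearMap.rTensor_tmul, TensorProduct.lid_tmul]
    exact Submodule.smul_mem _ _ (Submodule.subset_span rfl)

namespace GModule

variable {H : Supergroup k}

section Grading

variable (M : GModule H)

/-- The projection to the part of parity `i`. -/
def pr (i : ZMod 2) : M.V →ₗ[k] M.V :=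
  if i = 0 then Submodule.projection _ _ M.isCompl else Submodule.projection _ _ M.isCompl.symm

variable {M}

theorem pr_mem (i : ZMod 2) (v : M.V) : M.pr i v ∈ M.gr i := by
  rcases parity_cases i with rfl | rfl
  · simp [pr]
  · simp [pr]

theorem pr_of_mem {i : ZMod 2} {v : M.V} (hv : v ∈ M.gr i) : M.pr i v = v := by
  rcases parity_cases i with rfl | rfl
  · exact (Submodule.projection_eq_self_iff M.isCompl v).2 hv
  · exact (Submodule.projection_eq_self_iff M.isCompl.symm v).2 hv

theorem pr_of_mem_ne {i j : ZMod 2} {v : M.V} (hv : v ∈ M.gr j) (h : j ≠ i) : M.pr i v = 0 := by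
  rcases parity_cases i with rfl | rfl
  · obtain rfl : j = 1 := (parity_cases j).resolve_left h
    exact (Submodule.projection_apply_eq_zero_iff M.isCompl).2 hv
  · obtain rfl : j = 0 := (parity_cases j).resolve_right h
    exact (Submodule.projection_apply_eq_zero_iff M.isCompl.symm).2 hv

theorem pr_add_pr (v : M.V) : M.pr 0 v + M.pr 1 v = v := by
  have hv : v ∈ M.gr 0 ⊔ M.gr 1 := M.isCompl.sup_eq_top ▸ Submodule.mem_top
  obtain ⟨x, hx, y, hy, rfl⟩ := Submodule.mem_sup.1 hv
  rw [map_add, map_add, pr_of_mem hx, pr_of_mem hy, pr_of_mem_ne hy (by decide),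
    pr_of_mem_ne hx (by decide), add_zero, zero_add]

theorem homogeneous_induction {p : M.V → Prop} (hadd : ∀ a b, p a → p b → p (a + b))
    (hom : ∀ (i : ZMod 2), ∀ a ∈ M.gr i, p a) (a : M.V) : p a := by
  rw [← pr_add_pr a]
  exact hadd _ _ (hom 0 _ (pr_mem 0 a)) (hom 1 _ (pr_mem 1 a))

theorem Hom.map_pr {N : GModule H} (h : Hom M N) (i : ZMod 2) (v : M.V) :
    h.toLin (M.pr i v) = N.pr i (h.toLin v) := by
  refine homogeneous_induction (p := fun v => h.toLin (M.pr i v) = N.pr i (h.toLin v))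
    (fun a b ha hb => by simp only [map_add, ha, hb]) ?_ v
  intro j v hv
  by_cases hij : j = i
  · subst hij
    rw [pr_of_mem hv, pr_of_mem (h.even j v hv)]
  · rw [pr_of_mem_ne hv hij, pr_of_mem_ne (h.even j v hv) hij, map_zero]

theorem isSubrep_of_pr {W : Submodule k M.V} (h0 : ∀ w ∈ W, ∀ i, M.pr i w ∈ W)
    (h1 : ∀ w ∈ W, M.coact w ∈ LinearMap.range (LinearMap.lTensor H.Coord W.subtype)) :
    M.IsSubrep W := by
  refine ⟨fun w hw => ?_, h1⟩
  rw [← pr_add_pr w]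
  exact Submodule.add_mem_sup ⟨h0 w hw 0, pr_mem 0 w⟩ ⟨h0 w hw 1, pr_mem 1 w⟩

theorem IsSubrep.pr_mem {W : Submodule k M.V} (hW : M.IsSubrep W) {w : M.V} (hw : w ∈ W)
    (i : ZMod 2) : M.pr i w ∈ W := by
  obtain ⟨x, hx, y, hy, rfl⟩ := Submodule.mem_sup.1 (hW.1 hw)
  rcases parity_cases i with rfl | rfl
  · rw [map_add, pr_of_mem hx.2, pr_of_mem_ne hy.2 (by decide), add_zero]
    exact hx.1
  · rw [map_add, pr_of_mem hy.2, pr_of_mem_ne hx.2 (by decide), zero_add]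
    exact hy.1

end Grading

section Hom

variable {M N P : GModule H}

/-- The identity homomorphism. -/
def Hom.id (M : GModule H) : Hom M M where
  toLin := LinearMap.id
  even _ _ hv := hv
  equivariant v := by simp

/-- The composition of homomorphisms. -/
def Hom.comp (g : Hom N P) (h : Hom M N) : Hom M P where
  toLin := g.toLin ∘ₗ h.toLin
  even i v hv := g.even i _ (h.even i v hv)
  equivariant v := by
    rw [LinearMap.comp_apply, g.equivariant, h.equivariant, LinearMap.lTensor_comp,
      LinearMap.comp_apply]

theorem isSubrep_top (M : GModule H) : M.IsSubrep ⊤ :=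
  isSubrep_of_pr (fun _ _ _ => Submodule.mem_top) fun _ _ =>
    mem_range_lTensor_subtype _ fun _ => Submodule.mem_top

theorem IsSubrep.map (h : Hom M N) {W : Submodule k M.V} (hW : M.IsSubrep W) :
    N.IsSubrep (W.map h.toLin) := by
  refine isSubrep_of_pr ?_ ?_
  · rintro _ ⟨w, hw, rfl⟩ i
    exact ⟨_, hW.pr_mem hw i, h.map_pr i w⟩
  · rintro _ ⟨w, hw, rfl⟩
    rw [h.equivariant]
    obtain ⟨x, hx⟩ := hW.2 w hw
    rw [← hx, ← LinearMap.comp_apply, ← LinearMap.lTensor_comp]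
    have e : h.toLin ∘ₗ W.subtype = (W.map h.toLin).subtype ∘ₗ
        (h.toLin.restrict (p := W) (q := W.map h.toLin) fun v hv => ⟨v, hv, rfl⟩) := rfl
    rw [e, LinearMap.lTensor_comp]
    exact ⟨_, rfl⟩

theorem isSubrep_ker (h : Hom M N) : M.IsSubrep (LinearMap.ker h.toLin) := by
  refine isSubrep_of_pr (fun w hw i => ?_) fun w hw => mem_range_lTensor_ker _ ?_
  · rw [LinearMap.mem_ker, h.map_pr, LinearMap.mem_ker.1 hw, map_zero]
  · rw [← h.equivariant, LinearMap.mem_ker.1 hw, map_zero]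

theorem isSubrep_generated_le {v : M.V} {W : Submodule k M.V} (hW : M.IsSubrep W) (hv : v ∈ W) :
    M.generated v ≤ W := sInf_le ⟨hW, hv⟩

theorem mem_generated (v : M.V) : v ∈ M.generated v :=
  Submodule.mem_sInf.2 fun _ h => h.2

/-- A homomorphism into the image of an injective homomorphism lifts. -/
theorem Hom.exists_lift {h : Hom M N} (hh : Function.Injective h.toLin) (m : Hom P N)
    (hm : LinearMap.range m.toLin ≤ LinearMap.range h.toLin) :
    ∃ l : Hom P M, ∀ v, h.toLin (l.toLin v) = m.toLin v := by
  let E := LinearEquiv.ofInjective h.toLin hh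
  let L : P.V →ₗ[k] M.V := E.symm.toLinearMap ∘ₗ
    (m.toLin.codRestrict _ fun v => hm (LinearMap.mem_range_self _ v))
  have hL : ∀ v, h.toLin (L v) = m.toLin v := by
    intro v
    have := E.apply_symm_apply (m.toLin.codRestrict _ (fun v => hm (LinearMap.mem_range_self _ v)) v)
    exact congrArg Subtype.val this
  refine ⟨⟨L, fun i v hv => ?_, fun v => ?_⟩, hL⟩
  · have e : M.pr i (L v) = L v := by
      apply hh
      rw [h.map_pr, hL, pr_of_mem (m.even i v hv)]
    rw [← e]
    exact GModule.pr_mem i _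
  · apply Module.Flat.lTensor_preserves_injective_linearMap (M := H.Coord) h.toLin hh
    have e : h.toLin ∘ₗ L = m.toLin := LinearMap.ext hL
    rw [← h.equivariant, hL, m.equivariant, ← e, LinearMap.lTensor_comp, LinearMap.comp_apply]

end Hom

section MatrixCoefficients

variable (M : GModule H)

/-- The matrix coefficient `v ↦ v₋₁ φ(v₀)`. -/
def coeff (φ : Module.Dual k M.V) : M.V →ₗ[k] H.Coord :=
  (TensorProduct.rid k H.Coord).toLinearMap ∘ₗ LinearMap.lTensor H.Coord φ ∘ₗ M.coact

variable {M}

theorem coeff_apply (φ : Module.Dual k M.V) (v : M.V) :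
    M.coeff φ v = TensorProduct.rid k H.Coord (LinearMap.lTensor H.Coord φ (M.coact v)) := rfl

/-- Coassociativity in the form needed for Frobenius reciprocity: taking matrix coefficients
commutes with the coactions of `M` and of `k[H]`. -/
theorem comul_coeff (φ : Module.Dual k M.V) (v : M.V) :
    comul (R := k) (M.coeff φ v) = LinearMap.lTensor H.Coord (M.coeff φ) (M.coact v) := by
  have e : ∀ x : H.Coord ⊗[k] M.V, comul (R := k) (TensorProduct.rid k H.Coord
      (LinearMap.lTensor H.Coord φ x)) = LinearMap.lTensor H.Coord
      ((TensorProduct.rid k H.Coord).toLinearMap ∘ₗ LinearMap.lTensor H.Coord φ)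
      (TensorProduct.assoc k H.Coord H.Coord M.V (LinearMap.rTensor M.V comul x)) := by
    intro x
    induction x with
    | zero => simp
    | add x y hx hy => simp only [map_add, hx, hy]
    | tmul a w =>
      simp only [LinearMap.rTensor_tmul, LinearMap.lTensor_tmul, TensorProduct.rid_tmul, map_smul]
      induction comul (R := k) a with
      | zero => simp
      | add x y hx hy => simp only [map_add, TensorProduct.add_tmul, smul_add, hx, hy]
      | tmul p q => simp
  rw [coeff_apply, e, M.coassoc, ← LinearMap.comp_apply, ← LinearMap.lTensor_comp]
  rfl

theorem counit_coeff (φ : Module.Dual k M.V) (v : M.V) :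
    counit (R := k) (M.coeff φ v) = φ v := by
  conv_rhs => rw [← M.counit_coact v]
  rw [coeff_apply]
  induction M.coact v with
  | zero => simp
  | add x y hx hy => simp only [map_add, hx, hy]
  | tmul a w => simp [mul_comm]

theorem coeff_comp {N : GModule H} (h : Hom M N) (φ : Module.Dual k N.V) (v : M.V) :
    M.coeff (φ ∘ₗ h.toLin) v = N.coeff φ (h.toLin v) := by
  rw [coeff_apply, coeff_apply, h.equivariant, LinearMap.lTensor_comp, LinearMap.comp_apply]

theorem coeff_comp_pr (φ : Module.Dual k M.V) (i : ZMod 2) {j : ZMod 2} {v : M.V}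
    (hv : v ∈ M.gr j) : M.coeff (φ ∘ₗ M.pr i) v = H.pr (j - i) (M.coeff φ v) := by
  rw [coeff_apply, coeff_apply]
  refine tensorGr_induction (p := fun x => TensorProduct.rid k H.Coord
    (LinearMap.lTensor H.Coord (φ ∘ₗ M.pr i) x) = H.pr (j - i) (TensorProduct.rid k H.Coord
    (LinearMap.lTensor H.Coord φ x))) (fun x y hx hy => by simp only [map_add, hx, hy]) ?_ _
    (M.coact_mem j v hv)
  intro l p hp q hq
  by_cases hl : j - l = i
  · have hl' : l = j - i := by rw [← hl]; ring
    rw [hl] at hq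
    rw [hl'] at hp
    simp [pr_of_mem hq, Supergroup.pr_of_mem hp]
  · have hl' : l ≠ j - i := fun h => hl (by rw [h]; ring)
    simp [pr_of_mem_ne hq hl, Supergroup.pr_of_mem_ne hp hl']

/-- `φ` is semi-invariant with multiplier `c`. -/
def SemiInvariant (M : GModule H) (c : H.Coord) (φ : Module.Dual k M.V) : Prop :=
  ∀ v, M.coeff φ v = φ v • c

theorem SemiInvariant.comp {N : GModule H} {c : H.Coord} {φ : Module.Dual k N.V}
    (hφ : N.SemiInvariant c φ) (h : Hom M N) : M.SemiInvariant c (φ ∘ₗ h.toLin) := fun v => by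
  rw [coeff_comp, hφ, LinearMap.comp_apply]

/-- Since the multiplier is even, the identity for `φ` splits into its parity components. -/
theorem SemiInvariant.comp_pr {c : H.Coord} (hc : c ∈ H.gr 0) {φ : Module.Dual k M.V}
    (hφ : M.SemiInvariant c φ) (i : ZMod 2) : M.SemiInvariant c (φ ∘ₗ M.pr i) := by
  intro v
  refine homogeneous_induction (p := fun v => M.coeff (φ ∘ₗ M.pr i) v = (φ ∘ₗ M.pr i) v • c)
    (fun a b ha hb => by rw [map_add, map_add, add_smul, ha, hb]) ?_ v
  intro j v hv
  rw [coeff_comp_pr φ i hv, hφ, map_smul, LinearMap.comp_apply]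
  by_cases hij : j = i
  · subst hij
    rw [sub_self, Supergroup.pr_of_mem hc, pr_of_mem hv]
  · rw [pr_of_mem_ne hv hij, Supergroup.pr_of_mem_ne hc (Ne.symm (sub_ne_zero.2 hij)), smul_zero,
      map_zero, zero_smul]

/-- The kernel of a homogeneous semi-invariant functional is a submodule. -/
theorem SemiInvariant.isSubrep_ker {c : H.Coord} {φ : Module.Dual k M.V}
    (hφ : M.SemiInvariant c φ) {i : ZMod 2} (hi : ∀ v, φ (M.pr i v) = φ v) :
    M.IsSubrep (LinearMap.ker φ) := by
  refine isSubrep_of_pr (fun w hw j => ?_) fun w hw => mem_range_lTensor_ker _ ?_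
  · rw [LinearMap.mem_ker]
    by_cases hij : j = i
    · rw [hij, hi, LinearMap.mem_ker.1 hw]
    · rw [← hi, pr_of_mem_ne (pr_mem j w) hij, map_zero]
  · apply (TensorProduct.rid k H.Coord).injective
    have h := hφ w
    rw [LinearMap.mem_ker.1 hw, zero_smul] at h
    rw [map_zero]
    exact h

/-- An even functional defines a homomorphism to the regular representation. -/
def coeffHom (M : GModule H) (φ : Module.Dual k M.V) (hφ : ∀ v, φ (M.pr 0 v) = φ v) :
    Hom M (regular H) where
  toLin := M.coeff φ
  even i v hv := by
    have e : φ ∘ₗ M.pr 0 = φ := LinearMap.ext hφ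
    have h := coeff_comp_pr φ 0 hv
    rw [e, sub_zero] at h
    change M.coeff φ v ∈ H.gr i
    rw [h]
    exact Supergroup.pr_mem i _
  equivariant v := comul_coeff φ v

/-- The submodule generated by a homogeneous vector is finite dimensional. -/
theorem finiteDimensional_generated {i : ZMod 2} {v : M.V} (hv : v ∈ M.gr i) :
    FiniteDimensional k (M.generated v) := by
  -- The candidate submodule consists of the contractions `u(v₋₁) v₀`. It is finite dimensional
  -- because a tensor is a finite sum, stable by coassociativity, graded because `v` is homogeneous,
  -- and contains `v` as the contraction with the counit.
  let T : Module.Dual k H.Coord →ₗ[k] M.V :=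
    (TensorProduct.lid k M.V).toLinearMap ∘ₗ LinearMap.applyₗ (M.coact v) ∘ₗ
      LinearMap.rTensorHom M.V
  have hT : ∀ u, T u = TensorProduct.lid k M.V (LinearMap.rTensor M.V u (M.coact v)) := fun _ => rfl
  obtain ⟨S, hS, hvS⟩ := exists_finiteDimensional_lid_rTensor (M.coact v)
  have hle : LinearMap.range T ≤ S := by
    rintro _ ⟨u, rfl⟩
    exact hvS u
  have hfin : FiniteDimensional k (LinearMap.range T) :=
    Submodule.finiteDimensional_of_le hle
  have hsub : M.IsSubrep (LinearMap.range T) := by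
    refine isSubrep_of_pr ?_ ?_
    · rintro _ ⟨u, rfl⟩ j
      refine ⟨u ∘ₗ H.pr (i - j), ?_⟩
      rw [hT, hT]
      refine tensorGr_induction (p := fun x => TensorProduct.lid k M.V
        (LinearMap.rTensor M.V (u ∘ₗ H.pr (i - j)) x) = M.pr j (TensorProduct.lid k M.V
        (LinearMap.rTensor M.V u x))) (fun x y hx hy => by simp only [map_add, hx, hy]) ?_ _
        (M.coact_mem i v hv)
      intro l p hp q hq
      by_cases hl : i - l = j
      · have hl' : l = i - j := by rw [← hl]; ring
        rw [hl] at hq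
        rw [hl'] at hp
        simp [pr_of_mem hq, Supergroup.pr_of_mem hp]
      · have hl' : l ≠ i - j := fun h => hl (by rw [h]; ring)
        simp [pr_of_mem_ne hq hl, Supergroup.pr_of_mem_ne hp hl']
    · rintro _ ⟨u, rfl⟩
      refine mem_range_lTensor_subtype _ fun u' => ⟨H.conv u u', ?_⟩
      rw [hT, hT]
      have e1 : ∀ x : H.Coord ⊗[k] M.V, TensorProduct.lid k M.V (LinearMap.rTensor M.V u'
          (M.coact (TensorProduct.lid k M.V (LinearMap.rTensor M.V u x)))) =
          TensorProduct.lid k M.V (LinearMap.rTensor M.V (LinearMap.mul' k k ∘ₗ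
            TensorProduct.map u u') ((TensorProduct.assoc k H.Coord H.Coord M.V).symm
            (LinearMap.lTensor H.Coord M.coact x))) := by
        intro x
        induction x with
        | zero => simp
        | add x y hx hy => simp only [map_add, hx, hy]
        | tmul a w =>
          simp only [LinearMap.rTensor_tmul, LinearMap.lTensor_tmul, TensorProduct.lid_tmul,
            map_smul]
          induction M.coact w with
          | zero => simp
          | add x y hx hy => simp only [map_add, TensorProduct.tmul_add, smul_add, hx, hy]
          | tmul p q => simp [smul_smul]
      have e2 : H.conv u u' = (LinearMap.mul' k k ∘ₗ TensorProduct.map u u') ∘ₗ comul := rfl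
      rw [e1, ← M.coassoc, LinearEquiv.symm_apply_apply, e2, LinearMap.rTensor_comp,
        LinearMap.comp_apply]
  have hmem : v ∈ LinearMap.range T := ⟨counit, M.counit_coact v⟩
  exact Submodule.finiteDimensional_of_le (isSubrep_generated_le hsub hmem)

end MatrixCoefficients

end GModule

end

/-! ### Characters, points and adjoint determinants of closed subgroups -/

section

open Coalgebra WithConv

set_option maxSynthPendingDepth 3

namespace Supergroup

variable {H : Supergroup k}

/-! ### Characters are determined by their values at points -/

theorem isGroupLikeElem_pow {χ : H.Coord} (hχ : IsGroupLikeElem k χ) (hχ0 : χ ∈ H.gr 0) (n : ℕ) :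
    IsGroupLikeElem k (χ ^ n) := by
  induction n with
  | zero =>
    rw [pow_zero]
    exact ⟨H.counit_one, H.comul_one⟩
  | succ n ih =>
    refine ⟨?_, ?_⟩
    · rw [pow_succ, H.counit_mul, ih.counit_eq_one, hχ.counit_eq_one, one_mul]
    · rw [pow_succ, comul_mul_eq_star, ih.comul_eq_tmul_self, hχ.comul_eq_tmul_self,
        star_tmul_even_right _ _ hχ0]

/-- The Nullstellensatz: in a finitely generated algebra the nilradical is the intersection of the
maximal ideals, and all residue fields are `k`. -/
theorem exists_algHom_ne_zero [IsAlgClosed k] {D : Type*} [CommRing D] [Algebra k D]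
    [Algebra.FiniteType k D] {x : D} (hx : ¬ IsNilpotent x) : ∃ q : D →ₐ[k] k, q x ≠ 0 := by
  have hJ : IsJacobsonRing D := isJacobsonRing_of_finiteType (A := k)
  have h1 : (nilradical D).jacobson = nilradical D :=
    hJ.out (Ideal.radical_isRadical _)
  have h2 : x ∉ (nilradical D).jacobson := by rwa [h1, mem_nilradical]
  obtain ⟨m, hm, hxm⟩ : ∃ m : Ideal D, m.IsMaximal ∧ x ∉ m := by
    by_contra! hcon
    exact h2 ((Submodule.mem_sInf).2 fun m hm => hcon m hm.2)
  let _ : Field (D ⧸ m) := Ideal.Quotient.field m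
  have : Algebra.FiniteType k (D ⧸ m) :=
    Algebra.FiniteType.of_surjective (Ideal.Quotient.mkₐ k m) (Ideal.Quotient.mkₐ_surjective k m)
  have : Module.Finite k (D ⧸ m) := finite_of_finite_type_of_isJacobsonRing k (D ⧸ m)
  let e : k ≃ₐ[k] (D ⧸ m) := AlgEquiv.ofBijective (Algebra.ofId k (D ⧸ m))
    (IsAlgClosed.algebraMap_bijective_of_isIntegral (k := k) (K := D ⧸ m))
  refine ⟨e.symm.toAlgHom.comp (Ideal.Quotient.mkₐ k m), fun h => hxm ?_⟩
  have h3 : Ideal.Quotient.mkₐ k m x = 0 := by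
    apply e.symm.injective
    rw [map_zero]
    exact h
  exact Ideal.Quotient.eq_zero_iff_mem.1 h3

/-- The Nullstellensatz on `H₀` puts a power of `x` into the odd ideal, which is nilpotent. -/
theorem isNilpotent_of_point [IsAlgClosed k] [CharZero k] {x : H.Coord}
    (hx : ∀ g : H.Point, g x = 0) : IsNilpotent x := by
  have : Algebra.FiniteType k H.EvenRing :=
    have := H.finiteType
    Algebra.FiniteType.of_surjective H.evenMk evenMk_surjective
  obtain ⟨n, hn⟩ : IsNilpotent (H.evenMk x) := by
    by_contra hcon
    obtain ⟨q, hq⟩ := exists_algHom_ne_zero (k := k) hcon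
    exact hq (hx (q.comp H.evenMk))
  rw [← map_pow, ← mem_filt_one_iff] at hn
  have h : ∀ m, (x ^ n) ^ m ∈ H.filt m := by
    intro m
    induction m with
    | zero => exact mem_filt_zero _
    | succ m ih =>
      rw [pow_succ]
      exact mul_mem_filt ih hn
  obtain ⟨m, hm⟩ := exists_filt_eq_bot H
  refine ⟨n * m, ?_⟩
  have h2 := h m
  rwa [hm, Submodule.mem_bot, ← pow_mul] at h2

/-- The element `χ - 1` is nilpotent, so `χ` satisfies a polynomial equation. Distinct group-like
elements are linearly independent, so the powers of `χ` cannot all be distinct and `χ` has finite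
order. -/
theorem eq_one_of_point_eq_one [IsAlgClosed k] [CharZero k] {χ : H.Coord}
    (hχ : IsGroupLikeElem k χ) (hχ0 : χ ∈ H.gr 0) (h : ∀ g : H.Point, g χ = 1) : χ = 1 := by
  have hnil : IsNilpotent (χ - 1) := isNilpotent_of_point fun g => by
    rw [map_sub, h, map_one, sub_self]
  obtain ⟨N, hN⟩ := hnil
  have hinj : ¬ Function.Injective fun n : ℕ => χ ^ n := by
    intro hinj
    have hli : LinearIndependent k fun n : ℕ => χ ^ n := by
      have h1 := linearIndepOn_isGroupLikeElem (R := k) (A := H.Coord)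
      exact h1.comp (fun n : ℕ => ⟨χ ^ n, isGroupLikeElem_pow hχ hχ0 n⟩)
        fun a b hab => hinj (congrArg Subtype.val hab)
    have h2 : Polynomial.aeval χ ((Polynomial.X - 1 : Polynomial k) ^ N) = 0 := by
      simpa using hN
    rw [Polynomial.aeval_eq_sum_range] at h2
    have h3 := linearIndependent_iff'.1 hli _ _ h2 _
      (Finset.self_mem_range_succ ((Polynomial.X - 1 : Polynomial k) ^ N).natDegree)
    rw [Polynomial.coeff_natDegree, Polynomial.leadingCoeff_eq_zero] at h3
    exact pow_ne_zero N (Polynomial.X_sub_C_ne_zero (1 : k)) (by simpa using h3)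
  obtain ⟨m, hm, hm1⟩ : ∃ m : ℕ, m ≠ 0 ∧ χ ^ m = 1 := by
    have hu : IsUnit χ := ⟨⟨χ, H.antipode χ, mul_antipode_of_isGroupLikeElem hχ,
      antipode_mul_of_isGroupLikeElem hχ⟩, rfl⟩
    have key : ∀ a b : ℕ, a < b → χ ^ a = χ ^ b → χ ^ (b - a) = 1 := by
      intro a b hab he
      have : b = a + (b - a) := by omega
      rw [this, pow_add] at he
      have h4 : χ ^ a * 1 = χ ^ a * χ ^ (b - a) := by rw [mul_one]; exact he
      exact ((hu.pow a).mul_left_cancel h4).symm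
    obtain ⟨a, b, hab, hne⟩ := Function.not_injective_iff.1 hinj
    rcases lt_or_gt_of_ne hne with hlt | hlt
    · exact ⟨b - a, by omega, key a b hlt hab⟩
    · exact ⟨a - b, by omega, key b a hlt hab.symm⟩
  -- In characteristic zero `1 + X + ⋯ + X^(m-1)` takes the nonzero value `m` at `1`. So `χ - 1`,
  -- which is killed both by this polynomial in `χ` and by a power of `χ - 1`, is zero.
  have hcop : IsCoprime ((Polynomial.X - Polynomial.C (1 : k)) ^ N)
      (∑ i ∈ Finset.range m, Polynomial.X ^ i : Polynomial k) := by
    refine IsCoprime.pow_left ?_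
    rw [(Polynomial.irreducible_X_sub_C (1 : k)).coprime_iff_not_dvd, Polynomial.dvd_iff_isRoot,
      Polynomial.IsRoot, Polynomial.eval_finsetSum]
    simpa using hm
  obtain ⟨a, b, hab⟩ := hcop
  have h5 := congrArg (fun p => (χ - 1) * Polynomial.aeval χ p) hab
  simp only [map_add, map_mul, map_pow, map_sub, Polynomial.aeval_X, map_one,
    map_sum, hN, mul_zero, zero_add, mul_one] at h5
  have hc : Commute (χ - 1) (Polynomial.aeval χ b) := by
    have e : χ - 1 = Polynomial.aeval χ (Polynomial.X - 1 : Polynomial k) := by simp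
    rw [e]
    exact (Commute.all _ b).map (Polynomial.aeval χ)
  rw [← mul_assoc, hc.eq, mul_assoc, mul_geom_sum, hm1, sub_self, mul_zero] at h5
  exact (sub_eq_zero.1 h5.symm)

/-! ### The adjoint representation of a closed subgroup -/

theorem evenDual_inf_oddDual (G : Supergroup k) : G.evenDual ⊓ G.oddDual = ⊥ := by
  rw [eq_bot_iff]
  rintro u ⟨h1, h2⟩
  rw [Submodule.mem_bot]
  ext a
  rw [← pr_add_pr a, map_add, (Submodule.mem_dualAnnihilator u).1 h2 _ (pr_mem 0 a),
    (Submodule.mem_dualAnnihilator u).1 h1 _ (pr_mem 1 a), add_zero, LinearMap.zero_apply]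

theorem hasAdDet_bot (G : Supergroup k) (g : G.Point) : G.HasAdDet g ⊥ 1 := by
  refine ⟨fun u hu => ?_, LinearMap.det_eq_one_of_subsingleton _⟩
  rw [(Submodule.mem_bot k).1 hu, map_zero]
  exact zero_mem _

theorem HasAdDet.unique {G : Supergroup k} {g : G.Point}
    {W : Submodule k (Module.Dual k G.Coord)} {d d' : k} (h : G.HasAdDet g W d)
    (h' : G.HasAdDet g W d') : d = d' := by
  obtain ⟨_, rfl⟩ := h
  obtain ⟨_, rfl⟩ := h'
  rfl

end Supergroup

namespace ClosedSubsupergroup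

open Supergroup

variable {G : Supergroup k} (K : ClosedSubsupergroup G)

theorem pullback_pr (i : ZMod 2) (a : G.Coord) :
    K.incl.pullback (G.pr i a) = K.grp.pr i (K.incl.pullback a) := by
  refine homogeneous_induction (p := fun a => K.incl.pullback (G.pr i a) =
    K.grp.pr i (K.incl.pullback a)) (fun a b ha hb => by simp only [map_add, ha, hb]) ?_ a
  intro j a ha
  by_cases hij : j = i
  · subst hij
    rw [pr_of_mem ha, pr_of_mem (K.incl.even j a ha)]
  · rw [pr_of_mem_ne ha hij, pr_of_mem_ne (K.incl.even j a ha) hij, map_zero]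

/-- Functionals on `k[K]`, as functionals on `k[G]`. -/
def dualIncl : Module.Dual k K.grp.Coord →ₗ[k] Module.Dual k G.Coord :=
  Module.Dual.transpose (R := k) K.incl.pullback.toLinearMap

theorem dualIncl_apply (u : Module.Dual k K.grp.Coord) (a : G.Coord) :
    K.dualIncl u a = u (K.incl.pullback a) := rfl

theorem dualIncl_injective : Function.Injective K.dualIncl := by
  intro u v huv
  ext a
  obtain ⟨b, rfl⟩ := K.surj a
  exact congrArg (fun f : Module.Dual k G.Coord => f b) huv

/-- A functional on `k[G]` that vanishes on the kernel of the surjection to `k[K]` factors through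
it, and the derivation rule and parity descend. This identifies the intrinsic `𝔥₁` of `K` with the
odd part of its Lie superalgebra inside `𝔤`. -/
theorem map_dualIncl_oddLie : K.grp.oddLie.map K.dualIncl = K.lie ⊓ G.oddDual := by
  ext w
  constructor
  · rintro ⟨u, hu, rfl⟩
    refine ⟨⟨fun a b => ?_, (Submodule.mem_dualAnnihilator _).2 fun a ha => ?_⟩,
      (Submodule.mem_dualAnnihilator _).2 fun a ha => ?_⟩
    · rw [dualIncl_apply, map_mul, oddLie_mul hu, K.incl.counit_pullback, K.incl.counit_pullback]
      rfl
    · rw [dualIncl_apply, show K.incl.pullback a = 0 from ha, map_zero]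
    · exact oddLie_even hu (K.incl.even 0 a ha)
  · rintro ⟨⟨hlie, hker⟩, hodd⟩
    obtain ⟨s, hs⟩ := K.incl.pullback.toLinearMap.exists_rightInverse_of_surjective
      (LinearMap.range_eq_top.2 K.surj)
    have hs' : ∀ a, K.incl.pullback (s a) = a := fun a =>
      congrArg (fun f : K.grp.Coord →ₗ[k] K.grp.Coord => f a) hs
    have hw : ∀ a, w (s (K.incl.pullback a)) = w a := by
      intro a
      rw [← sub_eq_zero, ← map_sub]
      refine (Submodule.mem_dualAnnihilator w).1 hker _ ?_
      rw [LinearMap.mem_ker, map_sub, AlgHom.toLinearMap_apply, hs', AlgHom.toLinearMap_apply,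
        sub_self]
    refine ⟨w ∘ₗ s, ⟨fun a b => ?_, (Submodule.mem_dualAnnihilator _).2 fun a ha => ?_⟩,
      LinearMap.ext hw⟩
    · obtain ⟨a, rfl⟩ := K.surj a
      obtain ⟨b, rfl⟩ := K.surj b
      rw [← map_mul, LinearMap.comp_apply, LinearMap.comp_apply, LinearMap.comp_apply, hw, hw, hw,
        K.incl.counit_pullback, K.incl.counit_pullback]
      exact hlie a b
    · obtain ⟨b, rfl⟩ := K.surj a
      rw [← pr_of_mem ha, ← K.pullback_pr, LinearMap.comp_apply, hw]
      exact (Submodule.mem_dualAnnihilator w).1 hodd _ (pr_mem 0 b)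

theorem pullback_leftAct (v : Module.Dual k K.grp.Coord) (a : G.Coord) :
    K.incl.pullback (G.leftAct (K.dualIncl v) a) = K.grp.leftAct v (K.incl.pullback a) := by
  rw [leftAct_apply, leftAct_apply, K.incl.comul_pullback]
  induction comul (R := k) a with
  | zero => simp
  | add x y hx hy => simp only [map_add, hx, hy]
  | tmul x y => simp [dualIncl_apply]

theorem pullback_coRight (v : Module.Dual k K.grp.Coord) (a : G.Coord) :
    K.incl.pullback (coRight (K.dualIncl v) a) = coRight v (K.incl.pullback a) := by
  rw [coRight_apply, coRight_apply, K.incl.comul_pullback]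
  induction comul (R := k) a with
  | zero => simp
  | add x y hx hy => simp only [map_add, hx, hy]
  | tmul x y => simp [dualIncl_apply]

/-- Compatibility with antipodes is not part of the data of a homomorphism; both sides are
convolution inverses of the same functional. -/
theorem pointInv_pointIncl (g : K.grp.Point) :
    G.pointInv (K.pointIncl g) = K.dualIncl (K.grp.pointInv g) := by
  have h1 := algHom_antipode_conv (K.pointIncl g)
  have h2 : toConv (K.pointIncl g).toLinearMap * toConv (K.dualIncl (K.grp.pointInv g)) = 1 := by
    ext a
    have h := congrArg (fun f : WithConv (K.grp.Coord →ₗ[k] k) => f (K.incl.pullback a))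
      (algHom_conv_antipode g)
    change LinearMap.mul' k k (TensorProduct.map g.toLinearMap (g.toLinearMap ∘ₗ K.grp.antipode)
      (comul (K.incl.pullback a))) = algebraMap k k (counit (K.incl.pullback a)) at h
    rw [K.incl.comul_pullback, K.incl.counit_pullback, ← LinearMap.comp_apply (TensorProduct.map _ _),
      ← TensorProduct.map_comp] at h
    exact h
  exact congrArg ofConv (left_inv_eq_right_inv h1 h2)

theorem Ad_dualIncl (g : K.grp.Point) (y : Module.Dual k K.grp.Coord) :
    G.Ad (K.pointIncl g) (K.dualIncl y) = K.dualIncl (K.grp.Ad g y) := by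
  ext a
  have e : (K.pointIncl g).toLinearMap = K.dualIncl g.toLinearMap := rfl
  rw [Ad_apply, dualIncl_apply, dualIncl_apply, Ad_apply, pointInv_pointIncl, e, pullback_leftAct,
    pullback_coRight]

theorem hasAdDet_oddDual {g : K.grp.Point} {d : k} (h : K.grp.HasAdDet g K.grp.oddLie d) :
    G.HasAdDet (K.pointIncl g) (K.lie ⊓ G.oddDual) d := by
  obtain ⟨hst, rfl⟩ := h
  rw [← map_dualIncl_oddLie]
  refine ⟨?_, ?_⟩
  · rintro _ ⟨u, hu, rfl⟩
    exact ⟨_, hst u hu, (K.Ad_dualIncl g u).symm⟩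
  · let e := Submodule.equivMapOfInjective K.dualIncl K.dualIncl_injective K.grp.oddLie
    rw [← LinearMap.det_conj _ e]
    congr 1
    ext x : 1
    obtain ⟨y, rfl⟩ := e.surjective x
    apply Subtype.ext
    simp only [LinearMap.comp_apply, LinearEquiv.coe_coe, LinearEquiv.symm_apply_apply]
    exact K.Ad_dualIncl g y

theorem semiInvariants_eq_of_isTrivial {χ : K.Character} (hχ : χ.IsTrivial) :
    K.semiInvariants χ = K.functionsOnQuotient := by
  have h : χ.val = 1 := hχ
  rw [semiInvariants, functionsOnQuotient, h, antipode_one]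

end ClosedSubsupergroup

end

/-! ### From a finite dimensional injective module to a semi-invariant functional -/

section

open Coalgebra WithConv Supergroup

set_option maxSynthPendingDepth 3

namespace GModule

section Integral

variable {H : Supergroup k}

theorem smul_one_mem {i : ZMod 2} {c : k} (hc : c ∈ (if i = 0 then ⊤ else ⊥ : Submodule k k)) :
    c • (1 : H.Coord) ∈ H.gr i := by
  by_cases hi : i = 0
  · subst hi
    exact Submodule.smul_mem _ _ one_mem
  · rw [if_neg hi, Submodule.mem_bot] at hc
    rw [hc, zero_smul]
    exact zero_mem _

theorem comul_smul_one (c : k) : comul (R := k) (c • (1 : H.Coord)) =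
    LinearMap.lTensor H.Coord (LinearMap.toSpanSingleton k H.Coord 1) (1 ⊗ₜ[k] c) := by
  simp [H.comul_one]

/-- The constant functions. -/
def unitHom (H : Supergroup k) : Hom (trivial H) (regular H) where
  toLin := LinearMap.toSpanSingleton k H.Coord 1
  even _ _ hv := smul_one_mem hv
  equivariant v := comul_smul_one (H := H) v

theorem unitHom_apply (c : k) : (unitHom H).toLin c = (c • 1 : H.Coord) := rfl

theorem nontrivial_coord (H : Supergroup k) : Nontrivial H.Coord := by
  refine ⟨1, 0, fun h => ?_⟩
  have := H.counit_one
  rw [h, map_zero] at this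
  exact zero_ne_one this

theorem unitHom_injective : Function.Injective (unitHom H).toLin := by
  have := nontrivial_coord H
  intro a b hab
  exact smul_left_injective k (one_ne_zero (α := H.Coord)) hab

/-- A finite dimensional injective module that contains the trivial module carries a nonzero
semi-invariant functional, whose character is the inverse determinant of `𝔥₁`. -/
theorem exists_semiInvariant [CharZero k] {J : GModule H} [FiniteDimensional k J.V]
    (hJ : J.Injective) (j : Hom (trivial H) J) (hj : Function.Injective j.toLin) :
    ∃ χ : H.Coord, χ ∈ H.gr 0 ∧ IsGroupLikeElem k χ ∧
      (∀ g : H.Point, ∃ d, H.HasAdDet g H.oddLie d ∧ g χ = d⁻¹) ∧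
      ∃ φ : Module.Dual k J.V, φ ≠ 0 ∧ J.SemiInvariant (H.antipode χ) φ := by
  -- Extension of `j` along the constants: a comodule map on `k[H]` with `g 1 = j 1`, which is
  -- nonzero.
  obtain ⟨g, hg⟩ := hJ _ _ (unitHom H) j unitHom_injective
  have hg1 : g.ofRegular 1 = j.toLin (1 : k) := by
    rw [← hg (1 : k), unitHom_apply, one_smul]
    rfl
  have hj1 : j.toLin (1 : k) ≠ 0 := fun h =>
    one_ne_zero (α := k) (hj (h.trans (map_zero j.toLin).symm))
  have hg0 : g.toLin ≠ 0 := by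
    intro h
    apply hj1
    rw [← hg1]
    exact congrArg (fun f : (regular H).V →ₗ[k] J.V => f (1 : H.Coord)) h
  obtain ⟨Γ, hΓ, hΓ0⟩ := exists_isLeftInvariant g hg0
  have hχ := isGroupLikeElem_modularChar hΓ hΓ0
  have hχ0 := modularChar_mem hΓ hΓ0
  refine ⟨modularChar Γ, hχ0, hχ, exists_hasAdDet hΓ hΓ0, ?_⟩
  set χ := modularChar Γ
  -- The modified integral `Γ(χ ·)`: right semi-invariance with multiplier `S(χ)` gives the
  -- multiplier of the functional on `J`, and left invariance serves to show that this functional is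
  -- nonzero.
  let Γr : Module.Dual k H.Coord := Γ ∘ₗ LinearMap.mulLeft k χ
  obtain ⟨α, hα⟩ : ∃ α : Module.Dual k J.V, α (j.toLin (1 : k)) ≠ 0 := by
    by_contra! hcon
    exact hj1 ((Module.forall_dual_apply_eq_zero_iff k _).1 hcon)
  refine ⟨Γr ∘ₗ J.coeff α, ?_, fun v => ?_⟩
  · obtain ⟨b, hb⟩ : ∃ b, Γ b ≠ 0 := by
      by_contra! hcon
      exact hΓ0 (LinearMap.ext hcon)
    intro h
    -- The test vector is chosen so that `χ S(χ) = 1` cancels: the functional takes there the value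
    -- `Γ(b) α(j 1)`.
    have h1 := congrArg (fun f : Module.Dual k J.V => f (g.ofRegular (H.antipode χ * b))) h
    have h2 : ∀ a : H.Coord, J.coeff α (g.ofRegular a) = coRight (α ∘ₗ g.ofRegular) a := fun a =>
      (coeff_comp g α a).symm
    have h3 : ∀ a : H.Coord, Γr (coRight (α ∘ₗ g.ofRegular) a) =
        (α ∘ₗ g.ofRegular) (H.leftAct Γr a) := fun a => (apply_leftAct _ _ _).symm
    rw [LinearMap.comp_apply, h2, h3, leftAct_comp_mulLeft hΓ hΓ0, map_smul, LinearMap.comp_apply,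
      hg1, ← mul_assoc, mul_antipode_of_isGroupLikeElem hχ, one_mul, LinearMap.zero_apply,
      smul_eq_mul, mul_eq_zero] at h1
    exact h1.elim hb hα
  · have h := coRight_comp_mulLeft hΓ hχ hχ0 (J.coeff α v)
    rw [coRight_apply, comul_coeff] at h
    rw [coeff_apply, LinearMap.lTensor_comp]
    exact h

end Integral

end GModule

end

/-! ### Frobenius reciprocity and the embedding of the injective hull -/

section

open Coalgebra WithConv Supergroup

set_option maxSynthPendingDepth 3

namespace GModule

variable {G : Supergroup k} {K : ClosedSubsupergroup G}

theorem Hom.rTensor_coact {M N : GModule G} (h : Hom M N) (K : ClosedSubsupergroup G) (v : M.V) :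
    LinearMap.rTensor N.V K.incl.pullback.toLinearMap (N.coact (h.toLin v)) =
      LinearMap.lTensor K.grp.Coord h.toLin
        (LinearMap.rTensor M.V K.incl.pullback.toLinearMap (M.coact v)) := by
  rw [h.equivariant, ← LinearMap.comp_apply, LinearMap.rTensor_comp_lTensor,
    ← LinearMap.lTensor_comp_rTensor, LinearMap.comp_apply]

/-- Restriction of homomorphisms to a closed subgroup. -/
def Hom.restrict {M N : GModule G} (h : Hom M N) (K : ClosedSubsupergroup G) :
    Hom (M.restrict K) (N.restrict K) where
  toLin := h.toLin
  even := h.even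
  equivariant v := h.rTensor_coact K v

theorem pullback_coeff (M : GModule G) (φ : Module.Dual k M.V) (v : M.V) :
    K.incl.pullback (M.coeff φ v) = (M.restrict K).coeff φ v := by
  change _ = TensorProduct.rid k K.grp.Coord (LinearMap.lTensor K.grp.Coord φ
    (LinearMap.rTensor M.V K.incl.pullback.toLinearMap (M.coact v)))
  rw [coeff_apply]
  induction M.coact v with
  | zero => simp
  | add x y hx hy => simp only [map_add, hx, hy]
  | tmul a w => simp

/-- Frobenius reciprocity: an even semi-invariant functional on the restriction to `K` gives a
homomorphism to the induced module. -/
theorem coeff_mem_semiInvariants (M : GModule G) {χ : K.Character} {φ : Module.Dual k M.V}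
    (hφ : (M.restrict K).SemiInvariant (K.grp.antipode χ.val) φ) (v : M.V) :
    M.coeff φ v ∈ K.semiInvariants χ := by
  change LinearMap.lTensor G.Coord K.incl.pullback.toLinearMap (comul (M.coeff φ v)) =
    M.coeff φ v ⊗ₜ K.grp.antipode χ.val
  rw [comul_coeff, ← LinearMap.comp_apply, ← LinearMap.lTensor_comp]
  have e : K.incl.pullback.toLinearMap ∘ₗ M.coeff φ =
      LinearMap.toSpanSingleton k K.grp.Coord (K.grp.antipode χ.val) ∘ₗ φ := by
    ext w
    exact (M.pullback_coeff φ w).trans (hφ w)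
  rw [e, coeff_apply]
  induction M.coact v with
  | zero => simp
  | add x y hx hy => simp only [map_add, TensorProduct.add_tmul, hx, hy]
  | tmul a w => simp [TensorProduct.smul_tmul]

/-- The counit of the matrix coefficient of `v` is `φ v`, so the map `v ↦ v₋₁ φ(v₀)` does not kill
`x`. Its kernel therefore meets the irreducible `L` trivially, and is zero because `I` is an
essential extension of `L`. -/
theorem embedsIn_semiInvariants {L I : GModule G} (hL : L.Irreducible) {i : Hom L I}
    (hI : IsInjectiveHull i) {χ : K.Character} {φ : Module.Dual k I.V}
    (hφ : (I.restrict K).SemiInvariant (K.grp.antipode χ.val) φ) (h0 : ∀ v, φ (I.pr 0 v) = φ v)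
    {x : L.V} (hx : φ (i.toLin x) ≠ 0) :
    I.EmbedsIn (regular G) (K.semiInvariants χ) := by
  refine ⟨I.coeffHom φ h0, ?_, ?_⟩
  · rw [← LinearMap.ker_eq_bot]
    refine hI.2.2 _ (isSubrep_ker _) ?_
    have h1 : LinearMap.ker ((I.coeffHom φ h0).comp i).toLin = ⊥ := by
      refine (hL.2 _ (isSubrep_ker _)).resolve_right fun htop => hx ?_
      have hmem : x ∈ LinearMap.ker ((I.coeffHom φ h0).comp i).toLin := htop ▸ Submodule.mem_top
      have h2 : I.coeff φ (i.toLin x) = 0 := hmem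
      rw [← counit_coeff, h2, map_zero]
    rw [eq_bot_iff]
    rintro _ ⟨hker, ⟨y, rfl⟩⟩
    have hy : y ∈ LinearMap.ker ((I.coeffHom φ h0).comp i).toLin := hker
    rw [h1, Submodule.mem_bot] at hy
    rw [hy, map_zero]
    exact zero_mem _
  · rintro _ ⟨v, rfl⟩
    exact I.coeff_mem_semiInvariants hφ v

theorem finiteDimensional_of_embedsIn_generated {H : Supergroup k} {J M : GModule H} {j : ZMod 2}
    {v : M.V} (hv : v ∈ M.gr j) (h : J.EmbedsIn M (M.generated v)) : FiniteDimensional k J.V := by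
  obtain ⟨m, hm, hmr⟩ := h
  have := finiteDimensional_generated hv
  exact FiniteDimensional.of_injective
    (m.toLin.codRestrict (M.generated v) fun w => hmr (LinearMap.mem_range_self _ w))
    fun a b hab => hm (congrArg Subtype.val hab)

/-- The inclusions `J ⊆ ⟨K·f⟩ ⊆ ⟨G·f⟩ ≅ L ⊆ I` make the injective `K`-module `J` a direct summand of
the restriction of `I`. A semi-invariant functional on `J` is thus extended to `I`, where it defines
the map to `k[G]^χ`. -/
theorem exists_character_embedsIn [CharZero k] {f : G.Coord} {d : ZMod 2} (hf : f ∈ G.gr d)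
    (hf1 : counit (R := k) f = 1)
    {J : GModule K.grp} {j : Hom (trivial K.grp) J} (hJ : IsInjectiveHull j)
    (hcopy : J.EmbedsIn ((regular G).restrict K) (((regular G).restrict K).generated f))
    {L : GModule G} (hL : L.Irreducible) {l : Hom L (regular G)} (hl : Function.Injective l.toLin)
    (hlf : LinearMap.range l.toLin = (regular G).generated f)
    {I : GModule G} {i : Hom L I} (hI : IsInjectiveHull i) :
    ∃ χ : K.Character,
      (∀ g : K.grp.Point, ∃ d, K.grp.HasAdDet g K.grp.oddLie d ∧ g χ.val = d⁻¹) ∧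
      I.EmbedsIn (regular G) (K.semiInvariants χ) := by
  have := finiteDimensional_of_embedsIn_generated (M := (regular G).restrict K) hf hcopy
  obtain ⟨χ, hχ0, hχ, hdet, φ, hφ0, hφ⟩ := exists_semiInvariant hJ.1 j hJ.2.1
  refine ⟨⟨χ, hχ0, hχ⟩, hdet, ?_⟩
  have hSχ : K.grp.antipode χ ∈ K.grp.gr 0 := K.grp.antipode_mem 0 _ hχ0
  -- A homogeneous component is needed so that kernels of the functionals below are graded, hence
  -- submodules.
  obtain ⟨c, hc⟩ : ∃ c : ZMod 2, φ ∘ₗ J.pr c ≠ 0 := by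
    by_contra! hcon
    apply hφ0
    ext v
    have h0 : φ (J.pr 0 v) = 0 := LinearMap.congr_fun (hcon 0) v
    have h1 : φ (J.pr 1 v) = 0 := LinearMap.congr_fun (hcon 1) v
    rw [LinearMap.zero_apply, ← pr_add_pr v, map_add, h0, h1, add_zero]
  obtain ⟨m, hm, hmr⟩ := hcopy
  -- `⟨G·f⟩` is also stable under `K` and contains `f`, so it contains `⟨K·f⟩`.
  have hrange : LinearMap.range m.toLin ≤ LinearMap.range (l.restrict K).toLin := by
    refine hmr.trans (isSubrep_generated_le ?_ ?_)
    · rw [LinearMap.range_eq_map]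
      exact (isSubrep_top _).map (l.restrict K)
    · change f ∈ LinearMap.range l.toLin
      rw [hlf]
      exact mem_generated (M := regular G) f
  obtain ⟨κ, hκ⟩ := Hom.exists_lift (h := l.restrict K) hl m hrange
  let ι := (i.restrict K).comp κ
  have hι : Function.Injective ι.toLin := by
    intro a b hab
    have h1 : κ.toLin a = κ.toLin b := hI.2.1 hab
    apply hm
    rw [← hκ, ← hκ, h1]
  -- Injectivity of `J` extends the identity of `J` along `ι`, which gives a retraction of the
  -- restriction of `I` onto `J`.
  obtain ⟨r, hr⟩ := hJ.1 _ _ ι (Hom.id J) hι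
  have hr' : ∀ v, r.toLin ((i.restrict K).toLin (κ.toLin v)) = v := hr
  let Φ : Module.Dual k (I.restrict K).V := (φ ∘ₗ J.pr c) ∘ₗ r.toLin
  have hΦ : (I.restrict K).SemiInvariant (K.grp.antipode χ) Φ := (hφ.comp_pr hSχ c).comp r
  have hΨ : (L.restrict K).SemiInvariant (K.grp.antipode χ) (Φ ∘ₗ (i.restrict K).toLin) :=
    hΦ.comp _
  have hΨc : ∀ v, (Φ ∘ₗ (i.restrict K).toLin) ((L.restrict K).pr c v) =
      (Φ ∘ₗ (i.restrict K).toLin) v := by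
    intro v
    simp only [Φ, LinearMap.comp_apply]
    rw [Hom.map_pr, Hom.map_pr, pr_of_mem (pr_mem c _)]
  obtain ⟨x, hx⟩ : ∃ x, l.toLin x = f := by
    have h1 : f ∈ LinearMap.range l.toLin := hlf ▸ mem_generated (M := regular G) f
    exact h1
  -- Otherwise the image in `k[G]` of the kernel on `L`, a `K`-submodule, contains `f`, hence
  -- `⟨K·f⟩` and the copy of `J`. But on `J` the functional is `φ ∘ₗ J.pr c`, which is not zero.
  have hΨx : (Φ ∘ₗ (i.restrict K).toLin) x ≠ 0 := by
    intro hzero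
    apply hc
    ext v
    have hsub := (hΨ.isSubrep_ker hΨc).map (l.restrict K)
    have hfm : f ∈ (LinearMap.ker (Φ ∘ₗ (i.restrict K).toLin)).map (l.restrict K).toLin :=
      ⟨x, hzero, hx⟩
    have hle := isSubrep_generated_le hsub hfm
    obtain ⟨y, hy, hyv⟩ := hle (hmr (LinearMap.mem_range_self m.toLin v))
    have hyκ : y = κ.toLin v := hl (hyv.trans (hκ v).symm)
    have hy0 : (φ ∘ₗ J.pr c) (r.toLin ((i.restrict K).toLin y)) = 0 := hy
    rw [hyκ, hr'] at hy0
    exact hy0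
  -- The normalization at the identity forces `f` to be even, since the counit kills odd functions.
  -- So the even component of `Φ`, as Frobenius reciprocity requires, is already nonzero at `i x`.
  have hd : d = 0 := by
    refine (parity_cases d).resolve_right fun h => ?_
    rw [h] at hf
    rw [G.counit_odd f hf] at hf1
    exact zero_ne_one hf1
  have hx0 : L.pr 0 x = x := by
    apply hl
    rw [l.map_pr, hx]
    exact pr_of_mem (M := regular G) (hd ▸ hf)
  have hpr : ∀ v : (I.restrict K).V,
      Φ ((I.restrict K).pr 0 ((I.restrict K).pr 0 v)) = Φ ((I.restrict K).pr 0 v) := by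
    intro v
    rw [pr_of_mem (pr_mem 0 v)]
  refine embedsIn_semiInvariants hL hI (χ := ⟨χ, hχ0, hχ⟩) (hΦ.comp_pr hSχ 0) hpr (x := x) ?_
  have e : (I.restrict K).pr 0 (i.toLin x) = i.toLin x := by
    have h1 := i.map_pr 0 x
    rw [hx0] at h1
    exact h1.symm
  exact fun h => hΨx ((congrArg Φ e).symm.trans h)

end GModule

/-! ### Even and odd parts of `𝔨'` and `𝔭₁` -/

section Symmetric

variable {G : Supergroup k} {θ : SupergroupHom G G}

theorem lieKEven_le_evenDual : lieKEven θ ≤ G.evenDual := inf_le_right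

theorem liePOdd_le_oddDual : liePOdd θ ≤ G.oddDual := inf_le_right

theorem lieK'_inf_oddDual : lieK' θ ⊓ G.oddDual = liePOdd θ := by
  rw [lieK', sup_comm, sup_inf_assoc_of_le _ liePOdd_le_oddDual]
  have h : lieKEven θ ⊓ G.oddDual = ⊥ := eq_bot_iff.2
    ((inf_le_inf_right _ lieKEven_le_evenDual).trans (evenDual_inf_oddDual G).le)
  rw [h, sup_bot_eq]

theorem lieK'_inf_evenDual : lieK' θ ⊓ G.evenDual = lieKEven θ := by
  rw [lieK', sup_inf_assoc_of_le _ lieKEven_le_evenDual]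
  have h : liePOdd θ ⊓ G.evenDual = ⊥ := eq_bot_iff.2
    ((inf_le_inf_right _ liePOdd_le_oddDual).trans
      ((inf_comm _ _).trans (evenDual_inf_oddDual G)).le)
  rw [h, sup_bot_eq]

theorem liePOdd_inf_evenDual : liePOdd θ ⊓ G.evenDual = ⊥ := eq_bot_iff.2
  ((inf_le_inf_right _ liePOdd_le_oddDual).trans
    ((inf_comm _ _).trans (evenDual_inf_oddDual G)).le)

theorem liePOdd_inf_oddDual : liePOdd θ ⊓ G.oddDual = liePOdd θ :=
  inf_eq_left.2 liePOdd_le_oddDual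

end Symmetric

end

end

theorem mainTheorem3 {k : Type u} [Field k] [IsAlgClosed k] [CharZero k]
    (G : Supergroup k) (hG : G.Quasireductive)
    (θ : SupergroupHom G G) (hθ : IsInvolution θ)
    (K K' : ClosedSubsupergroup G) (hK : IsSymmetricSubgroup θ K) (hK' : IsDualSubgroup θ K K')
    (𝔞 : Submodule k (Module.Dual k G.Coord)) (ψ : Module.Dual k 𝔞 →+ ℝ)
    (hIwasawa : IsIwasawa θ 𝔞 ψ)
    (lam : Module.Dual k 𝔞) (f : G.Coord) (hf : IsHighestWeightFunction K 𝔞 ψ lam f)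
    -- `⟨K' · f⟩` contains a copy of the injective hull `J` of the trivial `K'`-module
    (J : GModule K'.grp) (j : GModule.Hom (GModule.trivial K'.grp) J)
    (hJ : GModule.IsInjectiveHull j)
    (hcopy : J.EmbedsIn ((GModule.regular G).restrict K')
      (((GModule.regular G).restrict K').generated f))
    -- `⟨G · f⟩` is isomorphic to the irreducible `G`-module `L`
    (L : GModule G) (hL : L.Irreducible) (l : GModule.Hom L (GModule.regular G))
    (hl : Function.Injective l.toLin)
    (hlf : LinearMap.range l.toLin = (GModule.regular G).generated f)
    -- `I` is the injective hull of `L`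
    (I : GModule G) (i : GModule.Hom L I) (hI : GModule.IsInjectiveHull i) :
    (∃ χ : K'.Character, χ.IsBer (liePOdd θ) ∧
      I.EmbedsIn (GModule.regular G) (K'.semiInvariants χ)) ∧
    (K'.TopExteriorTrivial (lieKEven θ) →
      ∃ χ : K'.Character, χ.IsBer (lieK' θ) ∧
        I.EmbedsIn (GModule.regular G) (K'.semiInvariants χ) ∧
        (χ.IsTrivial → K'.semiInvariants χ = K'.functionsOnQuotient)) ∧
    (K'.TopExteriorTrivial (liePOdd θ) →
      I.EmbedsIn (GModule.regular G) K'.functionsOnQuotient) := by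
  obtain ⟨d, hfd⟩ := hf.2.1
  obtain ⟨χ, hχ, hemb⟩ := GModule.exists_character_embedsIn hfd hf.2.2.2.2 hJ hcopy hL hl hlf hI
  -- The determinant on the odd part of `Lie K'`, which is `𝔭₁`, transported from the intrinsic Lie
  -- superalgebra of `K'` to `𝔤`.
  have hdet : ∀ g : K'.grp.Point, ∃ d, G.HasAdDet (K'.pointIncl g) (liePOdd θ) d ∧
      g χ.val = d⁻¹ := by
    intro g
    obtain ⟨d, hd, hgd⟩ := hχ g
    refine ⟨d, ?_, hgd⟩
    have h := K'.hasAdDet_oddDual hd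
    rwa [hK'.2, lieK'_inf_oddDual] at h
  -- The same `χ = det_{𝔭₁}⁻¹` serves in all three assertions. It is `ber_{𝔭₁}` because `𝔭₁` has no
  -- even part, and `ber_{𝔨'}` once the determinant on `𝔨₀` is `1`. It is trivial once the
  -- determinant on `𝔭₁` is `1`.
  refine ⟨⟨χ, fun g => ?_, hemb⟩, fun htop => ⟨χ, fun g => ?_, hemb, fun h =>
    K'.semiInvariants_eq_of_isTrivial h⟩, fun htop => ?_⟩
  · obtain ⟨d, hd, hgd⟩ := hdet g
    refine ⟨1, d, ?_, ?_, by rw [hgd, one_mul]⟩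
    · rw [liePOdd_inf_evenDual]
      exact G.hasAdDet_bot _
    · rwa [liePOdd_inf_oddDual]
  · obtain ⟨d, hd, hgd⟩ := hdet g
    refine ⟨1, d, ?_, ?_, by rw [hgd, one_mul]⟩
    · rw [lieK'_inf_evenDual]
      exact htop g
    · rwa [lieK'_inf_oddDual]
  · have h1 : χ.val = 1 := by
      refine Supergroup.eq_one_of_point_eq_one χ.groupLike χ.even fun g => ?_
      obtain ⟨d, hd, hgd⟩ := hdet g
      rw [hgd, hd.unique (htop g), inv_one]
    rw [← K'.semiInvariants_eq_of_isTrivial (χ := χ) h1]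
    exact hemb
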